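/- Let $a>0$, $\varepsilon_1,\varepsilon_2\in\{1,-1\}$ and $b,c\in\mathbb R$ with $c\neq 0$. Null curves $\gamma$ in a flat $\mathbb R^4_q$ are parametrized by the pseudo arc-length $\sigma$ and have a Cartan frame $(T=\gamma',W_1,N,W_2)$ with $\langle T,T\rangle=\langle N,N\rangle=0$, $\langle T,N\rangle=-1$, $\langle W_i,W_i\rangle=\varepsilon_i$ (other products $0$) and $$\nabla_TT=aW_1,\quad \nabla_TW_1=-k_1T+a\varepsilon_1N,\quad \nabla_TN=-\varepsilon_1k_1W_1+\varepsilon_2k_2W_2,\quad \nabla_TW_2=k_2T .$$ Let $\mathcal P=\mathbb R[k_1^{(m)},k_2^{(n)}:m,n\ge 0]$ with the derivation $f\mapsto f'$, $k_i^{(m)}\mapsto k_i^{(m+1)}$, let $\mathcal P_0\subset\mathcal P$ be the polynomials without constant term, and for $f=p'$ with $p\in\mathcal P_0$ put $\partial^{-1}f=p$. A local vector field is $V=fT+hW_1+gN+lW_2$ with $f,h,g,l\in\mathcal P$. Put $\varphi_V=\varepsilon_1\langle\nabla_TV,W_1\rangle$, $\psi_V=\varepsilon_2\langle\nabla_TV,W_2\rangle$.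 $V$ is an evolution field if $\langle\nabla_TV,T\rangle=\langle\nabla_T^2V,W_1\rangle=0$. An evolution field $V$ acts on $\mathcal P$ as the derivation commuting with $'$ for which $$V(k_1)=\tfrac1a\big(\theta\varphi_V-S\psi_V\big),\qquad V(k_2)=\tfrac1a\big(S\varphi_V+\varepsilon_1\varepsilon_2\,\theta\psi_V\big),\qquad \theta u=\tfrac1au'''+k_1u'+(k_1u)',\quad Su=k_2u'+(k_2u)',$$ and on local vector fields as the derivation $D_V$ over it with $$D_VT=-\alpha T+\varphi_VW_1+\psi_VW_2,\qquad D_VW_1=-\beta T+\varepsilon_1\varphi_VN+\tfrac1a\psi_V'W_2,$$ $$D_VN=-\varepsilon_1\beta W_1+\alpha N+\tfrac{\varepsilon_1}{a}\delta W_2,\qquad D_VW_2=\tfrac{\varepsilon_1\varepsilon_2}{a}\delta T-\tfrac{\varepsilon_1\varepsilon_2}{a}\psi_V'W_1+\varepsilon_2\psi_VN,$$ where $\alpha=\frac1a\varphi_V'$, $\beta=\frac1a(\alpha'+k_1\varphi_V-k_2\psi_V)$, $\delta=\frac1a\psi_V''+k_1\psi_V+\varepsilon_1\varepsilon_2k_2\varphi_V$.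 The bracket is $[V,U]=D_VU-D_UV$. Let $V_0=bT$ and $V_1=-ack_1T-2\varepsilon_1a^2cN$; the null localized induction equation (NLIE) is $\gamma_t=V_1$, and a symmetry of it is an evolution field $V$ with $[V_1,V]=0$. Let $\mathcal Q$ be the set of $(h,l)\in\mathcal P_0^2$ such that $h$ and $k_1h-k_2l$ are derivatives of elements of $\mathcal P_0$. For $(h,l)\in\mathcal Q$ and constants $c_1,c_2$ put $$\mathcal X_{c_1,c_2}(h,l)=\Big(-\tfrac1{2a}\big[h'+ak_1\partial^{-1}h-a\,\partial^{-1}(k_1h-k_2l)-\varepsilon_1c_1k_1\big]+c_2\Big)T+hW_1+\big(-\varepsilon_1a\,\partial^{-1}h+c_1\big)N+lW_2,$$ and let $R_{c_1,c_2}(V)=\mathcal X_{c_1,c_2}\big(\tfrac12V(k_1),-\varepsilon_1\varepsilon_2V(k_2)\big)$, which is defined for $V$ in the set $\mathcal D$ of evolution fields with $\big(\tfrac12V(k_1),-\varepsilon_1\varepsilon_2V(k_2)\big)\in\mathcal Q$. Then: 1. Every symmetry $V$ of NLIE lies in $\mathcal D$, and $R_{c_1,c_2}(V)$ is again a symmetry,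 for all $c_1,c_2$. 2. $R$ is a recursion operator for NLIE: $\mathcal D$ is a linear space and $R$ is linear, that is, $R_{rc_1+sd_1,\,rc_2+sd_2}(rV+sU)=rR_{c_1,c_2}(V)+sR_{d_1,d_2}(U)$; and $R$ is invariant under $V_1$: for $V\in\mathcal D$ also $[V_1,V]\in\mathcal D$, $R_{c_1,c_2}(V)$ is an evolution field, and $[V_1,R_{c_1,c_2}(V)]=R_{0,0}([V_1,V])$. 3. For every choice of the constants of integration in each step, the fields $V_{n+2}=R(V_n)$ (so that $V_{2n}=R^nV_0$, $V_{2n+1}=R^nV_1$) are all defined, are symmetries of NLIE (tangent to the space of pseudo arc-length parametrized null curves: along every such curve in $\mathbb R^4_q$ they satisfy $\langle\nabla_TV_n,T\rangle=\langle\nabla_T^2V_n,W_1\rangle=0$), and commute: $[V_m,V_n]=0$ for all $m,n$. If $b\ne0$, they are linearly independent over $\mathbb R$. -/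

import Mathlib

open scoped ContDiff

noncomputable section

namespace NullCurve

/-! ### The differential algebra of the curvatures -/

/-- The algebra `𝒫 = ℝ[k₁⁽ᵐ⁾, k₂⁽ⁿ⁾]` of differential polynomials in the two curvatures.
The variable `(0, m)` is `k₁⁽ᵐ⁾`, and `(1, m)` is `k₂⁽ᵐ⁾`. -/
abbrev DiffPoly : Type := MvPolynomial (Fin 2 × ℕ) ℝ

/-- The curvature `k₁` as an element of `𝒫`. -/
def k₁ : DiffPoly := MvPolynomial.X (0, 0)

/-- The curvature `k₂` as an element of `𝒫`. -/
def k₂ : DiffPoly := MvPolynomial.X (1, 0)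

/-- The total derivative with respect to the pseudo arc-length parameter, the derivation of `𝒫`
with `k_i⁽ᵐ⁾ ↦ k_i⁽ᵐ⁺¹⁾`. -/
def D : Derivation ℝ DiffPoly DiffPoly :=
  MvPolynomial.mkDerivation ℝ fun i => MvPolynomial.X (i.1, i.2 + 1)

/-- `𝒫₀`: the differential polynomials with vanishing constant term. -/
def P₀ : Set DiffPoly := {f | MvPolynomial.constantCoeff f = 0}

open Classical in
/-- The anti-derivative `∂⁻¹`: the element `p` of `𝒫₀` with `p' = f`, which is unique if it exists,
so that `∂⁻¹ (∂ p) = p` for `p ∈ 𝒫₀`. (The value is `0` if `f` is not a total derivative.) -/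
def antideriv (f : DiffPoly) : DiffPoly :=
  if h : ∃ p ∈ P₀, D p = f then h.choose else 0

/-- The pairs `(h, l) ∈ 𝒫₀²` for which both `h` and `k₁ h - k₂ l` are derivatives of elements
of `𝒫₀`. -/
def Q : Set (DiffPoly × DiffPoly) :=
  {x | x.1 ∈ P₀ ∧ x.2 ∈ P₀ ∧ ∃ p ∈ P₀, ∃ q ∈ P₀, D p = x.1 ∧ D q = k₁ * x.1 - k₂ * x.2}

/-! ### Local vector fields along null curves -/

/-- A local vector field `V = f T + h W₁ + g N + l W₂` along null curves, given by its components
`V 0 = f`, `V 1 = h`, `V 2 = g`, `V 3 = l` in the Cartan frame. -/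
abbrev VecField : Type := Fin 4 → DiffPoly

/-- The tangent field `T`. -/
def T : VecField := Pi.single 0 1
/-- The field `W₁` of the Cartan frame. -/
def W₁ : VecField := Pi.single 1 1
/-- The null transversal field `N`. -/
def N : VecField := Pi.single 2 1
/-- The field `W₂` of the Cartan frame. -/
def W₂ : VecField := Pi.single 3 1

/-- The Cartan frame `(T, W₁, N, W₂)`. -/
def frame : Fin 4 → VecField := ![T, W₁, N, W₂]

/-- The metric on local vector fields: `⟨T, T⟩ = ⟨N, N⟩ = 0`, `⟨T, N⟩ = -1`, `⟨W_i, W_i⟩ = ε_i`,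
the other products of frame fields being `0`. -/
def metric (ε₁ ε₂ : ℝ) (V U : VecField) : DiffPoly :=
  -(V 0 * U 2) - V 2 * U 0 + ε₁ • (V 1 * U 1) + ε₂ • (V 3 * U 3)

/-- The Cartan equations: the covariant derivatives `∇_T` of `T`, `W₁`, `N`, `W₂`. -/
def covFrame (a ε₁ ε₂ : ℝ) : Fin 4 → VecField :=
  ![a • W₁,
    -(k₁ • T) + (a * ε₁) • N,
    -(ε₁ • k₁ • W₁) + ε₂ • k₂ • W₂,
    k₂ • T]

/-- The covariant derivative `∇_T V` of a local vector field. -/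
def covT (a ε₁ ε₂ : ℝ) (V : VecField) : VecField :=
  ∑ i, (D (V i) • frame i + V i • covFrame a ε₁ ε₂ i)

/-- `φ_V = ε₁ ⟨∇_T V, W₁⟩`. -/
def phi (a ε₁ ε₂ : ℝ) (V : VecField) : DiffPoly :=
  ε₁ • metric ε₁ ε₂ (covT a ε₁ ε₂ V) W₁

/-- `ψ_V = ε₂ ⟨∇_T V, W₂⟩`. -/
def psi (a ε₁ ε₂ : ℝ) (V : VecField) : DiffPoly :=
  ε₂ • metric ε₁ ε₂ (covT a ε₁ ε₂ V) W₂

/-- `ρ_V = -ε₁ ⟨∇_T² V, W₁⟩`. -/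
def rho (a ε₁ ε₂ : ℝ) (V : VecField) : DiffPoly :=
  -(ε₁ • metric ε₁ ε₂ (covT a ε₁ ε₂ (covT a ε₁ ε₂ V)) W₁)

/-- `α_V = (φ_V' + ρ_V / 2) / a`. -/
def alpha (a ε₁ ε₂ : ℝ) (V : VecField) : DiffPoly :=
  (1 / a) • (D (phi a ε₁ ε₂ V) + (1 / 2 : ℝ) • rho a ε₁ ε₂ V)

/-- `β_V = (α_V' + k₁ φ_V - k₂ ψ_V) / a` (the ambient space is flat). -/
def beta (a ε₁ ε₂ : ℝ) (V : VecField) : DiffPoly :=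
  (1 / a) • (D (alpha a ε₁ ε₂ V) + k₁ * phi a ε₁ ε₂ V - k₂ * psi a ε₁ ε₂ V)

/-- `δ_V = ψ_V'' / a + k₁ ψ_V + ε₁ ε₂ k₂ φ_V`. -/
def delta (a ε₁ ε₂ : ℝ) (V : VecField) : DiffPoly :=
  (1 / a) • D (D (psi a ε₁ ε₂ V)) + k₁ * psi a ε₁ ε₂ V + (ε₁ * ε₂) • (k₂ * phi a ε₁ ε₂ V)

/-- The operator `θ(k₁) = D³ / a + k₁ D + D k₁`. -/
def theta (a : ℝ) (f : DiffPoly) : DiffPoly :=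
  (1 / a) • D (D (D f)) + k₁ * D f + D (k₁ * f)

/-- The operator `S(k₂) = D k₂ + k₂ D`. -/
def opS (f : DiffPoly) : DiffPoly := D (k₂ * f) + k₂ * D f

/-- `V(k₁)`, the variation of the first curvature along `V` (flat ambient space). -/
def varK₁ (a ε₁ ε₂ : ℝ) (V : VecField) : DiffPoly :=
  (1 / a) • theta a (phi a ε₁ ε₂ V) - (1 / a) • opS (psi a ε₁ ε₂ V)
    + (1 / a) • ((1 / (2 * a)) • D (D (rho a ε₁ ε₂ V)) + k₁ * rho a ε₁ ε₂ V)

/-- `V(k₂)`, the variation of the second curvature along `V` (flat ambient space). -/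
def varK₂ (a ε₁ ε₂ : ℝ) (V : VecField) : DiffPoly :=
  (1 / a) • opS (phi a ε₁ ε₂ V) + (ε₁ * ε₂ / a) • theta a (psi a ε₁ ε₂ V)
    + (1 / a) • (k₂ * rho a ε₁ ε₂ V)

/-- `V(k_i⁽ᵐ⁾)`, from `V(k_i)` through the rule `V(f') = V(f)' + ρ_V f' / (2a)`. -/
def varJet (a ε₁ ε₂ : ℝ) (V : VecField) (i : Fin 2) : ℕ → DiffPoly
  | 0 => if i = 0 then varK₁ a ε₁ ε₂ V else varK₂ a ε₁ ε₂ V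
  | m + 1 => D (varJet a ε₁ ε₂ V i m)
      + (1 / (2 * a)) • (rho a ε₁ ε₂ V * MvPolynomial.X (i, m + 1))

/-- The derivation `f ↦ V(f)` of `𝒫` induced by a local vector field `V`. -/
def act (a ε₁ ε₂ : ℝ) (V : VecField) : Derivation ℝ DiffPoly DiffPoly :=
  MvPolynomial.mkDerivation ℝ fun i => varJet a ε₁ ε₂ V i.1 i.2

/-- The fields `D_V T`, `D_V W₁`, `D_V N`, `D_V W₂`. -/
def tensorFrame (a ε₁ ε₂ : ℝ) (V : VecField) : Fin 4 → VecField :=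
  ![-(alpha a ε₁ ε₂ V • T) + phi a ε₁ ε₂ V • W₁ + psi a ε₁ ε₂ V • W₂,
    -(beta a ε₁ ε₂ V • T) + ε₁ • phi a ε₁ ε₂ V • N + (1 / a) • D (psi a ε₁ ε₂ V) • W₂,
    -(ε₁ • beta a ε₁ ε₂ V • W₁) + alpha a ε₁ ε₂ V • N + (ε₁ / a) • delta a ε₁ ε₂ V • W₂,
    (ε₁ * ε₂ / a) • delta a ε₁ ε₂ V • T - (ε₁ * ε₂ / a) • D (psi a ε₁ ε₂ V) • W₁
      + ε₂ • psi a ε₁ ε₂ V • N]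

/-- The tensor derivation `D_V` on local vector fields. -/
def tensorD (a ε₁ ε₂ : ℝ) (V U : VecField) : VecField :=
  ∑ i, (act a ε₁ ε₂ V (U i) • frame i + U i • tensorFrame a ε₁ ε₂ V i)

/-- The Lie bracket `[V, U] = D_V U - D_U V`. -/
def bracket (a ε₁ ε₂ : ℝ) (V U : VecField) : VecField :=
  tensorD a ε₁ ε₂ V U - tensorD a ε₁ ε₂ U V

/-- Evolution vector fields: the local vector fields that locally preserve the causal character
(`⟨∇_T V, T⟩ = 0`) and the pseudo arc-length parameter (`⟨∇_T² V, W₁⟩ = 0`). -/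
def IsEvolution (a ε₁ ε₂ : ℝ) (V : VecField) : Prop :=
  metric ε₁ ε₂ (covT a ε₁ ε₂ V) T = 0 ∧
    metric ε₁ ε₂ (covT a ε₁ ε₂ (covT a ε₁ ε₂ V)) W₁ = 0

/-! ### The null localized induction equation and the operator `R` -/

/-- `V₀ = b T`. -/
def V₀ (b : ℝ) : VecField := b • T

/-- `V₁ = -a c k₁ T - 2 ε₁ a² c N`, the right-hand side of the null localized induction
equation. -/
def V₁ (a ε₁ c : ℝ) : VecField := -((a * c) • k₁ • T) - (2 * ε₁ * a ^ 2 * c) • N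

/-- Symmetries of the null localized induction equation: evolution vector fields commuting
with `V₁`. -/
def IsSymmetry (a ε₁ ε₂ c : ℝ) (V : VecField) : Prop :=
  IsEvolution a ε₁ ε₂ V ∧ bracket a ε₁ ε₂ (V₁ a ε₁ c) V = 0

/-- The field `𝒳(h, l)` with the constants of integration `c₁`, `c₂`. It is meant for
`(h, l) ∈ Q`. -/
def calX (a ε₁ c₁ c₂ : ℝ) (h l : DiffPoly) : VecField :=
  (-((1 / (2 * a)) • (D h + a • (k₁ * antideriv h) - a • antideriv (k₁ * h - k₂ * l)
      - (ε₁ * c₁) • k₁)) + MvPolynomial.C c₂) • T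
    + h • W₁ + (-((ε₁ * a) • antideriv h) + MvPolynomial.C c₁) • N + l • W₂

/-- The evolution fields on which `R` is defined: those with `(V(k₁)/2, -ε₁ ε₂ V(k₂)) ∈ Q`. -/
def recDomain (a ε₁ ε₂ : ℝ) : Set VecField :=
  {V | IsEvolution a ε₁ ε₂ V ∧
    ((1 / 2 : ℝ) • varK₁ a ε₁ ε₂ V, -((ε₁ * ε₂) • varK₂ a ε₁ ε₂ V)) ∈ Q}

/-- `R(V) = 𝒳(V(k₁)/2, -ε₁ ε₂ V(k₂))` with the constants of integration `c₁`, `c₂`. -/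
def recOp (a ε₁ ε₂ c₁ c₂ : ℝ) (V : VecField) : VecField :=
  calX a ε₁ c₁ c₂ ((1 / 2 : ℝ) • varK₁ a ε₁ ε₂ V) (-((ε₁ * ε₂) • varK₂ a ε₁ ε₂ V))

/-- The hierarchy `V_{2n} = Rⁿ V₀`, `V_{2n+1} = Rⁿ V₁`, where the constants of integration in the
step from `V_n` to `V_{n+2}` are `c₁ n` and `c₂ n`. -/
def hierarchy (a ε₁ ε₂ b c : ℝ) (c₁ c₂ : ℕ → ℝ) : ℕ → VecField
  | 0 => V₀ b
  | 1 => V₁ a ε₁ c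
  | n + 2 => recOp a ε₁ ε₂ (c₁ n) (c₂ n) (hierarchy a ε₁ ε₂ b c c₁ c₂ n)

/-! ### Null curves in `ℝ⁴_q` -/

/-- The inner product of the pseudo-Euclidean space `ℝ⁴_q`, with `q` negative directions. -/
def pseudoInner (q : ℕ) (x y : Fin 4 → ℝ) : ℝ :=
  ∑ i : Fin 4, (if (i : ℕ) < q then -1 else 1) * x i * y i

/-- A null curve in `ℝ⁴_q`, parametrized by the pseudo arc-length parameter (with the normalization
`⟨γ'', γ''⟩ = ε₁ a²`) on an open interval, with its Cartan frame `(T, W₁, N, W₂)` and its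
curvatures. -/
structure CartanCurve (q : ℕ) (a ε₁ ε₂ : ℝ) where
  /-- the parameter interval -/
  I : Set ℝ
  isOpen_I : IsOpen I
  ordConnected_I : I.OrdConnected
  /-- the curve -/
  pos : ℝ → Fin 4 → ℝ
  /-- the vectors `T`, `W₁`, `N`, `W₂` -/
  e : Fin 4 → ℝ → Fin 4 → ℝ
  /-- the curvatures `k₁`, `k₂` -/
  k : Fin 2 → ℝ → ℝ
  smooth_pos : ContDiffOn ℝ ∞ pos I
  smooth_e : ∀ i, ContDiffOn ℝ ∞ (e i) I
  smooth_k : ∀ i, ContDiffOn ℝ ∞ (k i) I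
  gram : ∀ s ∈ I, ∀ i j, pseudoInner q (e i s) (e j s) =
    !![0, 0, -1, 0; 0, ε₁, 0, 0; -1, 0, 0, 0; 0, 0, 0, ε₂] i j
  deriv_pos : ∀ s ∈ I, HasDerivAt pos (e 0 s) s
  deriv_T : ∀ s ∈ I, HasDerivAt (e 0) (a • e 1 s) s
  deriv_W₁ : ∀ s ∈ I, HasDerivAt (e 1) (-(k 0 s • e 0 s) + (a * ε₁) • e 2 s) s
  deriv_N : ∀ s ∈ I, HasDerivAt (e 2) (-((ε₁ * k 0 s) • e 1 s) + (ε₂ * k 1 s) • e 3 s) s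
  deriv_W₂ : ∀ s ∈ I, HasDerivAt (e 3) (k 1 s • e 0 s) s

/-- The vector field along the null curve `γ` that a local vector field defines, the curvatures and
the frame being those of `γ`. -/
def CartanCurve.along {q : ℕ} {a ε₁ ε₂ : ℝ} (γ : CartanCurve q a ε₁ ε₂) (V : VecField) (s : ℝ) :
    Fin 4 → ℝ :=
  ∑ i, MvPolynomial.aeval (fun j : Fin 2 × ℕ => iteratedDeriv j.2 (γ.k j.1) s) (V i) • γ.e i s

/-- `T_γ Λ`: the smooth vector fields `X` along `γ` with `⟨∇_T X, T⟩ = ⟨∇_T² X, W₁⟩ = 0`. -/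
def CartanCurve.IsTangent {q : ℕ} {a ε₁ ε₂ : ℝ} (γ : CartanCurve q a ε₁ ε₂)
    (X : ℝ → Fin 4 → ℝ) : Prop :=
  ContDiffOn ℝ ∞ X γ.I ∧ ∀ s ∈ γ.I,
    pseudoInner q (deriv X s) (γ.e 0 s) = 0 ∧ pseudoInner q (deriv (deriv X) s) (γ.e 1 s) = 0

end NullCurve

end

open NullCurve

open NullCurve

/-! Under `V₁` the curvatures evolve by a Hirota-Satsuma system (`hsField`, `varK_V₁`), and the
whole statement is transferred to that system. On evolution fields `V ↦ act V` is a Lie algebra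
homomorphism into the derivations commuting with the total derivative (`act_bracket`), and it has
trivial kernel (`IsEvolution.eq_zero_of_varK`). Hence brackets can be tested on k₁ and k₂, and a
symmetry `V` yields a solution (V(k₁), V(k₂)) of the linearized system.

Invariance of `recOp` is a computation (`bracket_V₁_recOp`): the W₁ and W₂ components of [V₁, U]
involve only those of U, and for h = V(k₁)/2, l = -ε₁ε₂V(k₂) they become the linearized
Hirota-Satsuma operator. The T and N components are then determined up to constants, which vanish.

The hard point is that R is defined on every symmetry: V(k₁) and k₁h - k₂l must be total
derivatives. They are the variations along V of two conserved densities, k₁ and `energy`, and so are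
conserved themselves. Such a density is trivial as soon as its variational derivatives have no
constant and linear terms (`exists_totalD_eq_of_conserved`): degree by degree, a variational
derivative y solves a linear dispersive equation L y = l ∂³y, whose solutions without terms of
degree below 2 vanish. The linear terms in question are quadratic symbols at (z, -z). They vanish
because the linear symbols of a symmetry are odd (`IsHSSymmetry.linSymbol_odd`), which is read off
at resonances of the dispersion relation; these lie at non-real wave numbers, whence the passage to
ℂ.

Commutativity is a uniqueness statement: a solution of the linearized system without constant and
linear terms is zero (`IsHSSymmetry.eq_zero`), and the linear parts of symmetries are diagonal, so
they commute and drop out of the bracket. For linear independence, the linear symbol of V_n(k₁) is a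
polynomial of degree 2n+1. -/

namespace NullCurve

/-! ### Derivations of the jet algebra and exponential shifts. -/

section Jets

variable {𝕜 : Type*} [Field 𝕜]

/-- Differential polynomials in two differential indeterminates over a field. -/
abbrev Jet (𝕜 : Type*) [Field 𝕜] : Type _ := MvPolynomial (Fin 2 × ℕ) 𝕜

/-- The total derivative of differential polynomials. -/
noncomputable def totalD (𝕜 : Type*) [Field 𝕜] : Derivation 𝕜 (Jet 𝕜) (Jet 𝕜) :=
  MvPolynomial.mkDerivation 𝕜 fun i => MvPolynomial.X (i.1, i.2 + 1)

/-- The derivation commuting with the total derivative that takes the values `F i` on the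
indeterminates. -/
noncomputable def evolve (F : Fin 2 → Jet 𝕜) : Derivation 𝕜 (Jet 𝕜) (Jet 𝕜) :=
  MvPolynomial.mkDerivation 𝕜 fun i => (totalD 𝕜)^[i.2] (F i.1)

/-- Linearization along the exponential `exp (z x)` in the `i`-th indeterminate. -/
noncomputable def jetShift (i : Fin 2) (z : 𝕜) : Derivation 𝕜 (Jet 𝕜) (Jet 𝕜) :=
  MvPolynomial.mkDerivation 𝕜 fun j => if j.1 = i then MvPolynomial.C (z ^ j.2) else 0

/-- The linear third order evolutionary derivation with dispersion constants `l`. -/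
noncomputable def dispersion (l : Fin 2 → 𝕜) : Derivation 𝕜 (Jet 𝕜) (Jet 𝕜) :=
  MvPolynomial.mkDerivation 𝕜 fun j => l j.1 • MvPolynomial.X (j.1, j.2 + 3)

/-- The generating polynomial of the partial derivatives with respect to the jets of the `i`-th
indeterminate. -/
noncomputable def symbolDer (i : Fin 2) : Derivation 𝕜 (Jet 𝕜) (Polynomial (Jet 𝕜)) :=
  MvPolynomial.mkDerivation 𝕜 fun j => if j.1 = i then Polynomial.X ^ j.2 else 0

@[simp] lemma totalD_X (j : Fin 2 × ℕ) :
    totalD 𝕜 (MvPolynomial.X j) = MvPolynomial.X (j.1, j.2 + 1) := by simp [totalD]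

@[simp] lemma totalD_C (r : 𝕜) : totalD 𝕜 (MvPolynomial.C r) = 0 := by simp [totalD]

lemma evolve_X (F : Fin 2 → Jet 𝕜) (j : Fin 2 × ℕ) :
    evolve F (MvPolynomial.X j) = (totalD 𝕜)^[j.2] (F j.1) := by simp [evolve]

lemma jetShift_X (i : Fin 2) (z : 𝕜) (j : Fin 2 × ℕ) :
    jetShift i z (MvPolynomial.X j) = if j.1 = i then MvPolynomial.C (z ^ j.2) else 0 := by
  simp [jetShift]

lemma dispersion_X (l : Fin 2 → 𝕜) (j : Fin 2 × ℕ) :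
    dispersion l (MvPolynomial.X j) = l j.1 • MvPolynomial.X (j.1, j.2 + 3) := by
  simp [dispersion]

lemma symbolDer_X (i : Fin 2) (j : Fin 2 × ℕ) :
    symbolDer i (MvPolynomial.X j : Jet 𝕜) = if j.1 = i then Polynomial.X ^ j.2 else 0 := by
  simp [symbolDer]

lemma X_eq_iterate_totalD (i : Fin 2) (m : ℕ) :
    (MvPolynomial.X (i, m) : Jet 𝕜) = (totalD 𝕜)^[m] (MvPolynomial.X (i, 0)) := by
  induction m with
  | zero => rfl
  | succ m ih => rw [Function.iterate_succ_apply', ← ih]; simp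

lemma iterate_comm_of_comm {d : Derivation 𝕜 (Jet 𝕜) (Jet 𝕜)}
    (h : ∀ f, d (totalD 𝕜 f) = totalD 𝕜 (d f)) (m : ℕ) (f : Jet 𝕜) :
    d ((totalD 𝕜)^[m] f) = (totalD 𝕜)^[m] (d f) :=
  (Function.Commute.iterate_right (f := ⇑d) (g := ⇑(totalD 𝕜)) h m) f

lemma eq_of_comm_totalD {d₁ d₂ : Derivation 𝕜 (Jet 𝕜) (Jet 𝕜)}
    (h₁ : ∀ f, d₁ (totalD 𝕜 f) = totalD 𝕜 (d₁ f)) (h₂ : ∀ f, d₂ (totalD 𝕜 f) = totalD 𝕜 (d₂ f))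
    (h : ∀ i, d₁ (MvPolynomial.X (i, 0)) = d₂ (MvPolynomial.X (i, 0))) : d₁ = d₂ := by
  refine MvPolynomial.derivation_ext fun j => ?_
  obtain ⟨i, m⟩ := j
  rw [X_eq_iterate_totalD, iterate_comm_of_comm h₁, iterate_comm_of_comm h₂, h]

lemma evolve_totalD (F : Fin 2 → Jet 𝕜) (f : Jet 𝕜) :
    evolve F (totalD 𝕜 f) = totalD 𝕜 (evolve F f) := by
  have : ⁅evolve F, totalD 𝕜⁆ = 0 := by
    refine MvPolynomial.derivation_ext fun j => ?_
    simp [Derivation.commutator_apply, evolve_X, Function.iterate_succ_apply']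
  have h := DFunLike.congr_fun this f
  rw [Derivation.commutator_apply] at h
  exact sub_eq_zero.mp h

lemma dispersion_totalD (l : Fin 2 → 𝕜) (f : Jet 𝕜) :
    dispersion l (totalD 𝕜 f) = totalD 𝕜 (dispersion l f) := by
  have : ⁅dispersion l, totalD 𝕜⁆ = 0 := by
    refine MvPolynomial.derivation_ext fun j => ?_
    simp only [Derivation.commutator_apply, dispersion_X, totalD_X, Derivation.map_smul,
      Derivation.coe_zero, Pi.zero_apply]
    rw [show j.2 + 1 + 3 = j.2 + 3 + 1 by ring, sub_self]
  have h := DFunLike.congr_fun this f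
  rw [Derivation.commutator_apply] at h
  exact sub_eq_zero.mp h

/-- Differentiating exp(zx) produces a factor z, so a shift turns ∂ into ∂ + z. The inductions on
degree below only track how such parameters move. -/
lemma jetShift_totalD (i : Fin 2) (z : 𝕜) (f : Jet 𝕜) :
    jetShift i z (totalD 𝕜 f) = totalD 𝕜 (jetShift i z f) + z • jetShift i z f := by
  have : ⁅jetShift i z, totalD 𝕜⁆ = z • jetShift i z := by
    refine MvPolynomial.derivation_ext fun j => ?_
    simp only [Derivation.commutator_apply, jetShift_X, totalD_X, Derivation.smul_apply]
    split_ifs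
    · rw [totalD_C, sub_zero, MvPolynomial.smul_eq_C_mul, ← map_mul]; congr 1; ring
    · simp
  have h := DFunLike.congr_fun this f
  rw [Derivation.commutator_apply, Derivation.smul_apply] at h
  rw [← h]; ring

lemma jetShift_dispersion (i : Fin 2) (z : 𝕜) (l : Fin 2 → 𝕜) (f : Jet 𝕜) :
    jetShift i z (dispersion l f) =
      dispersion l (jetShift i z f) + (l i * z ^ 3) • jetShift i z f := by
  have : ⁅jetShift i z, dispersion l⁆ = (l i * z ^ 3) • jetShift i z := by
    refine MvPolynomial.derivation_ext fun j => ?_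
    simp only [Derivation.commutator_apply, jetShift_X, dispersion_X, Derivation.smul_apply,
      Derivation.map_smul]
    split_ifs with h
    · rw [MvPolynomial.derivation_C, sub_zero, MvPolynomial.smul_eq_C_mul,
        MvPolynomial.smul_eq_C_mul, ← map_mul, ← map_mul, h]; congr 1; ring
    · simp
  have h := DFunLike.congr_fun this f
  rw [Derivation.commutator_apply, Derivation.smul_apply] at h
  rw [← h]; ring

lemma jetShift_comm (i j : Fin 2) (z w : 𝕜) (f : Jet 𝕜) :
    jetShift i z (jetShift j w f) = jetShift j w (jetShift i z f) := by
  have : ⁅jetShift i z, jetShift j w⁆ = 0 := by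
    refine MvPolynomial.derivation_ext fun k => ?_
    simp only [Derivation.commutator_apply, jetShift_X]
    split_ifs <;> simp
  have h := DFunLike.congr_fun this f
  rw [Derivation.commutator_apply] at h
  exact sub_eq_zero.mp h

/-! ### Partial derivatives and shifts -/

lemma coeff_symbolDer (i : Fin 2) (m : ℕ) (f : Jet 𝕜) :
    (symbolDer i f).coeff m = MvPolynomial.pderiv (i, m) f := by
  have : (Polynomial.lcoeff (Jet 𝕜) m).compDer (symbolDer (𝕜 := 𝕜) i) =
      MvPolynomial.pderiv (i, m) := by
    classical
    refine MvPolynomial.derivation_ext fun j => ?_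
    simp only [Derivation.coe_comp, LinearMap.coe_comp, LinearMap.coe_restrictScalars,
      Function.comp_apply, Derivation.coeFn_coe, symbolDer_X, MvPolynomial.pderiv_X,
      Polynomial.lcoeff_apply]
    obtain ⟨j, n⟩ := j
    by_cases h : j = i
    · subst h
      by_cases h' : m = n
      · subst h'; simp
      · rw [Pi.single_eq_of_ne (by simpa using fun h => h' h.symm)]
        simp [Polynomial.coeff_X_pow, h']
    · rw [Pi.single_eq_of_ne (by simp [h])]
      simp [h]
  exact DFunLike.congr_fun this f

lemma eval_symbolDer (i : Fin 2) (z : 𝕜) (f : Jet 𝕜) :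
    (symbolDer i f).eval (MvPolynomial.C z) = jetShift i z f := by
  have : (Polynomial.leval (MvPolynomial.C z : Jet 𝕜)).compDer (symbolDer (𝕜 := 𝕜) i) =
      jetShift i z := by
    refine MvPolynomial.derivation_ext fun j => ?_
    simp only [Derivation.coe_comp, LinearMap.coe_comp, LinearMap.coe_restrictScalars,
      Function.comp_apply, Derivation.coeFn_coe, symbolDer_X, jetShift_X, Polynomial.leval_apply]
    split_ifs <;> simp
  exact DFunLike.congr_fun this f

/-- The shift is a polynomial in z whose coefficients are the partial derivatives; over a domain,
infinitely many roots force all of them to vanish. -/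
lemma pderiv_eq_zero_of_jetShift {i : Fin 2} {f : Jet 𝕜} (h : {z | jetShift i z f = 0}.Infinite)
    (m : ℕ) : MvPolynomial.pderiv (i, m) f = 0 := by
  rw [← coeff_symbolDer]
  suffices h0 : symbolDer i f = 0 by simp [h0]
  refine Polynomial.eq_zero_of_infinite_isRoot _
    ((h.image (MvPolynomial.C_injective (Fin 2 × ℕ) 𝕜).injOn).mono ?_)
  rintro _ ⟨z, hz, rfl⟩
  exact (eval_symbolDer i z f).trans hz

lemma jetShift_of_pderiv {i : Fin 2} {f : Jet 𝕜}
    (h : ∀ m, MvPolynomial.constantCoeff (MvPolynomial.pderiv (i, m) f) = 0) (z : 𝕜) :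
    MvPolynomial.constantCoeff (jetShift i z f) = 0 := by
  rw [← eval_symbolDer, Polynomial.eval_eq_sum_range, map_sum]
  refine Finset.sum_eq_zero fun m _ => ?_
  rw [map_mul, coeff_symbolDer, h, zero_mul]

lemma constantCoeff_pderiv_eq_zero {i : Fin 2} {f : Jet 𝕜}
    (h : {z | MvPolynomial.constantCoeff (jetShift i z f) = 0}.Infinite) (m : ℕ) :
    MvPolynomial.constantCoeff (MvPolynomial.pderiv (i, m) f) = 0 := by
  rw [← coeff_symbolDer, ← Polynomial.coeff_map]
  suffices h0 : (symbolDer i f).map MvPolynomial.constantCoeff = 0 by simp [h0]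
  refine Polynomial.eq_zero_of_infinite_isRoot _ (h.mono fun z hz => ?_)
  simp only [Set.mem_ofPred_eq, ← eval_symbolDer] at hz
  rw [Set.mem_ofPred_eq, Polynomial.IsRoot.def]
  have := Polynomial.eval_map_apply (p := symbolDer i f) MvPolynomial.constantCoeff (MvPolynomial.C z)
  rwa [MvPolynomial.constantCoeff_C, hz] at this

lemma totalDegree_jetShift_le (i : Fin 2) (z : 𝕜) (f : Jet 𝕜) :
    (jetShift i z f).totalDegree ≤ f.totalDegree - 1 := by
  conv_lhs => rw [f.as_sum, map_sum]
  refine (MvPolynomial.totalDegree_finsetSum_le (d := f.totalDegree - 1) fun s hs => ?_)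
  rw [jetShift, MvPolynomial.mkDerivation_monomial]
  refine (MvPolynomial.totalDegree_smul_le _ _).trans ?_
  refine MvPolynomial.totalDegree_finsetSum_le fun j hj => ?_
  have hb : ∀ q : 𝕜, (MvPolynomial.monomial (s - Finsupp.single j 1) (s j : 𝕜) *
      MvPolynomial.C q).totalDegree ≤ f.totalDegree - 1 := by
    intro q
    rw [mul_comm, MvPolynomial.C_mul_monomial]
    refine (MvPolynomial.totalDegree_monomial_le _ _).trans ?_
    have h1 := MvPolynomial.le_totalDegree hs
    have h2 := congrArg Finsupp.degree
      (Finsupp.sub_add_single_one_cancel (Finsupp.mem_support_iff.mp hj))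
    rw [map_add, Finsupp.degree_single] at h2
    have h3 : (s.sum fun _ e => e) = s.degree := rfl
    have h4 : ((s - Finsupp.single j 1).sum fun _ => id) = (s - Finsupp.single j 1).degree := rfl
    omega
  dsimp only
  split_ifs
  · exact hb _
  · simp

/-- A shift replaces one jet factor by a scalar and so lowers the degree. The alternative `= 0`
covers constants, whose degree cannot drop. -/
lemma totalDegree_induction {p : Jet 𝕜 → Prop}
    (h : ∀ f, (∀ i z, jetShift i z f = 0 ∨ p (jetShift i z f)) → p f) (f : Jet 𝕜) : p f := by
  induction hn : f.totalDegree using Nat.strong_induction_on generalizing f with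
  | _ n ih =>
    refine h f fun i z => ?_
    by_cases h0 : f.totalDegree = 0
    · left
      rw [MvPolynomial.totalDegree_eq_zero_iff_eq_C.mp h0, MvPolynomial.derivation_C]
    · right
      refine ih _ ?_ _ rfl
      have := totalDegree_jetShift_le i z f
      omega

variable [CharZero 𝕜]

lemma eq_C_of_pderiv_eq_zero {f : Jet 𝕜} (h : ∀ j, MvPolynomial.pderiv j f = 0) :
    f = MvPolynomial.C (MvPolynomial.constantCoeff f) := by
  classical
  ext s
  rw [MvPolynomial.coeff_C]
  split_ifs with hs
  · subst hs; rfl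
  · obtain ⟨j, hj⟩ : ∃ j, s j ≠ 0 := by
      by_contra! hc
      exact hs (Finsupp.ext fun j => (hc j).symm)
    have h1 := MvPolynomial.coeff_pderiv (i := j) f (s - Finsupp.single j 1)
    rw [h j, MvPolynomial.coeff_zero, Finsupp.sub_add_single_one_cancel hj] at h1
    have : ((s - Finsupp.single j 1 : Fin 2 × ℕ →₀ ℕ) j : 𝕜) + 1 ≠ 0 := Nat.cast_add_one_ne_zero _
    exact (mul_eq_zero.mp h1.symm).resolve_right this

lemma eq_C_of_jetShift {f : Jet 𝕜} (h : ∀ i, {z | jetShift i z f = 0}.Infinite) :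
    f = MvPolynomial.C (MvPolynomial.constantCoeff f) :=
  eq_C_of_pderiv_eq_zero fun j => pderiv_eq_zero_of_jetShift (h j.1) j.2

lemma infinite_eval_ne_zero {p : Polynomial 𝕜} (hp : p ≠ 0) : {z | p.eval z ≠ 0}.Infinite :=
  (Polynomial.finite_setOfPred_isRoot hp).infinite_compl

end Jets

/-! ### Injectivity of linear dispersive operators. -/

section Dispersive

variable {𝕜 : Type*} [Field 𝕜]

/-- The shifted total derivative `∂ + s`. -/
noncomputable def shiftD (s : 𝕜) (f : Jet 𝕜) : Jet 𝕜 := totalD 𝕜 f + s • f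

lemma jetShift_shiftD (i : Fin 2) (z s : 𝕜) (f : Jet 𝕜) :
    jetShift i z (shiftD s f) = shiftD (s + z) (jetShift i z f) := by
  simp only [shiftD, map_add, jetShift_totalD, Derivation.map_smul, add_smul]; abel

variable [CharZero 𝕜]

/-- A shift of f by z is annihilated by ∂ + s + z, so by induction it vanishes for all z ≠ -s. Hence
f is constant, and on constants the operator is multiplication by s. -/
lemma eq_zero_of_shiftD_eq_zero {s : 𝕜} (hs : s ≠ 0) {f : Jet 𝕜} (h : shiftD s f = 0) :
    f = 0 := by
  induction f using totalDegree_induction generalizing s with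
  | h f ih =>
    have hC : f = MvPolynomial.C (MvPolynomial.constantCoeff f) := by
      refine eq_C_of_jetShift fun i => (Set.Finite.infinite_compl
        (Set.finite_singleton (-s))).mono fun z hz => ?_
      rcases ih i z with h0 | h0
      · exact h0
      · refine h0 (s := s + z) (fun hsz => hz (Set.mem_singleton_iff.mpr (by linear_combination hsz))) ?_
        rw [← jetShift_shiftD, h, map_zero]
    rw [hC, shiftD, totalD_C, zero_add] at h
    rw [hC]
    exact (smul_eq_zero.mp h).resolve_left hs

lemma eq_C_of_totalD_eq_zero {f : Jet 𝕜} (h : totalD 𝕜 f = 0) :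
    f = MvPolynomial.C (MvPolynomial.constantCoeff f) := by
  refine eq_C_of_jetShift fun i => (Set.Finite.infinite_compl
        (Set.finite_singleton 0)).mono fun z hz => eq_zero_of_shiftD_eq_zero (s := z) hz ?_
  rw [shiftD, ← jetShift_totalD, h, map_zero]

/-- A linear operator of the form `L + c - κ (∂ + s)³` with `c ≠ κ s³` is injective on differential
polynomials. -/
lemma eq_zero_of_dispersion_sub {l : Fin 2 → 𝕜} {κ c s : 𝕜} (hc : c ≠ κ * s ^ 3) {f : Jet 𝕜}
    (h : dispersion l f + c • f - κ • shiftD s (shiftD s (shiftD s f)) = 0) : f = 0 := by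
  induction f using totalDegree_induction generalizing c s with
  | h f ih =>
    have hC : f = MvPolynomial.C (MvPolynomial.constantCoeff f) := by
      refine eq_C_of_jetShift fun i => ?_
      -- After a shift by z the pair (c, s) becomes (c + l i z³, s + z), and p(z) is the new value
      -- of c - κ s³. It is nonzero at z = 0 by hypothesis, hence at all but finitely many z.
      let p : Polynomial 𝕜 := Polynomial.C c + Polynomial.C (l i) * Polynomial.X ^ 3 -
        Polynomial.C κ * (Polynomial.C s + Polynomial.X) ^ 3
      have hp : p ≠ 0 := fun h0 => hc (by
        have := congrArg (Polynomial.eval 0) h0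
        simp [p] at this
        linear_combination this)
      refine (infinite_eval_ne_zero hp).mono fun z hz => ?_
      rcases ih i z with h0 | h0
      · exact h0
      · refine h0 (c := c + l i * z ^ 3) (s := s + z) (fun hsz => hz ?_) ?_
        · simp [p]; linear_combination hsz
        · have h1 := congrArg (jetShift i z) h
          simp only [map_sub, map_add, Derivation.map_smul, jetShift_shiftD, jetShift_dispersion,
            map_zero] at h1
          rw [← h1, add_smul]; abel
    rw [hC] at h ⊢
    simp only [shiftD, zero_add, Derivation.map_smul, smul_zero,
      MvPolynomial.derivation_C, smul_smul, ← sub_smul] at h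
    exact (smul_eq_zero.mp h).resolve_left fun h0 => hc (by linear_combination h0)

/-- A solution of `L y = κ ∂³ y` without constant and linear terms vanishes. -/
lemma eq_zero_of_dispersion_eq {l : Fin 2 → 𝕜} {κ : 𝕜} (hκ : κ ≠ 0) {y : Jet 𝕜}
    (h : dispersion l y = κ • totalD 𝕜 (totalD 𝕜 (totalD 𝕜 y)))
    (h0 : MvPolynomial.constantCoeff y = 0)
    (h1 : ∀ j, MvPolynomial.constantCoeff (MvPolynomial.pderiv j y) = 0) : y = 0 := by
  have hy : dispersion l y - κ • shiftD 0 (shiftD 0 (shiftD 0 y)) = 0 := by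
    simp [shiftD, h]
  suffices hC : y = MvPolynomial.C (MvPolynomial.constantCoeff y) by rw [hC, h0, map_zero]
  refine eq_C_of_jetShift fun i => (Set.Finite.infinite_compl
        (Set.finite_singleton 0)).mono fun x hx => ?_
  suffices hC : jetShift i x y =
      MvPolynomial.C (MvPolynomial.constantCoeff (jetShift i x y)) by
    rw [Set.mem_ofPred_eq, hC, jetShift_of_pderiv fun m => h1 (i, m), map_zero]
  refine eq_C_of_jetShift fun j => ?_
  let p : Polynomial 𝕜 := Polynomial.C (l i * x ^ 3) + Polynomial.C (l j) * Polynomial.X ^ 3 -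
        Polynomial.C κ * (Polynomial.C x + Polynomial.X) ^ 3
  -- The coefficient of z in p is -3κx², which is nonzero since x ≠ 0. This is why two shifts, that
  -- is terms of degree at least 2, are needed: with a single shift the factor (l i - κ) x³ may
  -- vanish identically.
  have hp : p ≠ 0 := fun hp0 => by
    have := congrArg (fun q => (Polynomial.derivative q).eval 0) hp0
    simp [p, Polynomial.derivative_pow] at this
    tauto
  refine (infinite_eval_ne_zero hp).mono fun z hz => ?_
  refine eq_zero_of_dispersion_sub (l := l) (κ := κ) (c := l i * x ^ 3 + l j * z ^ 3) (s := x + z)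
    (fun hsz => hz ?_) ?_
  · simp [p]; linear_combination hsz
  · have h2 := congrArg (jetShift j z) (congrArg (jetShift i x) hy)
    simp only [map_sub, map_add, Derivation.map_smul, jetShift_shiftD, jetShift_dispersion,
      map_zero, zero_add] at h2
    rw [← h2, add_smul]; abel

end Dispersive

/-! ### The Euler operator and its commutation relations. -/

section Euler

variable {𝕜 : Type*} [Field 𝕜]

/-- The substitution `a Z ^ m ↦ (-∂)^m a`. -/
noncomputable def evalNegD : Polynomial (Jet 𝕜) →ₗ[𝕜] Jet 𝕜 :=
  Polynomial.lsum fun m => (-(totalD 𝕜 : Jet 𝕜 →ₗ[𝕜] Jet 𝕜)) ^ m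

/-- The Euler operator (variational derivative) with respect to the `i`-th indeterminate. -/
noncomputable def euler (i : Fin 2) : Jet 𝕜 →ₗ[𝕜] Jet 𝕜 :=
  evalNegD ∘ₗ (symbolDer (𝕜 := 𝕜) i).toLinearMap

lemma euler_apply (i : Fin 2) (f : Jet 𝕜) : euler i f = evalNegD (symbolDer i f) := rfl

lemma evalNegD_monomial (m : ℕ) (a : Jet 𝕜) :
    evalNegD (Polynomial.monomial m a) = ((-(totalD 𝕜 : Jet 𝕜 →ₗ[𝕜] Jet 𝕜)) ^ m) a := by
  simp [evalNegD, Polynomial.lsum_apply]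

lemma evalNegD_eq_sum (p : Polynomial (Jet 𝕜)) :
    evalNegD p = ∑ m ∈ Finset.range (p.natDegree + 1),
      ((-(totalD 𝕜 : Jet 𝕜 →ₗ[𝕜] Jet 𝕜)) ^ m) (p.coeff m) := by
  conv_lhs => rw [p.as_sum_range, map_sum]
  exact Finset.sum_congr rfl fun m _ => evalNegD_monomial _ _

/-- Application of a linear map to the coefficients. -/
noncomputable def coeffMap (φ : Jet 𝕜 →ₗ[𝕜] Jet 𝕜) : Polynomial (Jet 𝕜) →ₗ[𝕜] Polynomial (Jet 𝕜) :=
  Polynomial.lsum fun m => (Polynomial.monomial m).restrictScalars 𝕜 ∘ₗ φ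

lemma coeffMap_monomial (φ : Jet 𝕜 →ₗ[𝕜] Jet 𝕜) (m : ℕ) (a : Jet 𝕜) :
    coeffMap φ (Polynomial.monomial m a) = Polynomial.monomial m (φ a) := by
  simp [coeffMap, Polynomial.lsum_apply]

lemma coeffMap_mul (d : Derivation 𝕜 (Jet 𝕜) (Jet 𝕜)) (a : Jet 𝕜) (p : Polynomial (Jet 𝕜)) :
    coeffMap (d : Jet 𝕜 →ₗ[𝕜] Jet 𝕜) (a • p) = a • coeffMap (d : Jet 𝕜 →ₗ[𝕜] Jet 𝕜) p + d a • p := by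
  induction p using Polynomial.induction_on' with
  | add p q hp hq => simp only [smul_add, map_add, hp, hq]; abel
  | monomial m b =>
    simp only [Polynomial.smul_monomial, coeffMap_monomial, Derivation.coeFn_coe,
      Derivation.leibniz, smul_eq_mul, map_add]
    rw [mul_comm b]

lemma coeffMap_X_pow (d : Derivation 𝕜 (Jet 𝕜) (Jet 𝕜)) (m : ℕ) :
    coeffMap (d : Jet 𝕜 →ₗ[𝕜] Jet 𝕜) (Polynomial.X ^ m) = 0 := by
  rw [← Polynomial.monomial_one_right_eq_X_pow, coeffMap_monomial]; simp

/-- The commutator of a symbol derivation with a derivation of `𝒫`. -/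
noncomputable def symbolComm (i : Fin 2) (d : Derivation 𝕜 (Jet 𝕜) (Jet 𝕜)) :
    Derivation 𝕜 (Jet 𝕜) (Polynomial (Jet 𝕜)) :=
  Derivation.mk' ((symbolDer (𝕜 := 𝕜) i).toLinearMap ∘ₗ d.toLinearMap -
    coeffMap d.toLinearMap ∘ₗ (symbolDer (𝕜 := 𝕜) i).toLinearMap)
    fun a b => by
      have h1 : symbolDer i (d (a * b)) = (a • symbolDer i (d b) + d b • symbolDer i a) +
          (b • symbolDer i (d a) + d a • symbolDer i b) := by
        rw [d.leibniz, map_add, smul_eq_mul, smul_eq_mul, Derivation.leibniz, Derivation.leibniz]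
      have h2 : coeffMap (d : Jet 𝕜 →ₗ[𝕜] Jet 𝕜) (symbolDer i (a * b)) =
          (a • coeffMap (d : Jet 𝕜 →ₗ[𝕜] Jet 𝕜) (symbolDer i b) + d a • symbolDer i b) +
          (b • coeffMap (d : Jet 𝕜 →ₗ[𝕜] Jet 𝕜) (symbolDer i a) + d b • symbolDer i a) := by
        rw [Derivation.leibniz, map_add, coeffMap_mul, coeffMap_mul]
      refine (congrArg₂ (· - ·) h1 h2).trans ?_
      change _ = a • (symbolDer i (d b) - coeffMap (d : Jet 𝕜 →ₗ[𝕜] Jet 𝕜) (symbolDer i b)) +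
        b • (symbolDer i (d a) - coeffMap (d : Jet 𝕜 →ₗ[𝕜] Jet 𝕜) (symbolDer i a))
      rw [smul_sub, smul_sub]
      abel

lemma symbolComm_apply (i : Fin 2) (d : Derivation 𝕜 (Jet 𝕜) (Jet 𝕜)) (f : Jet 𝕜) :
    symbolComm i d f = symbolDer i (d f) - coeffMap (d : Jet 𝕜 →ₗ[𝕜] Jet 𝕜) (symbolDer i f) := rfl

lemma coeffMap_symbolDer_X (d : Derivation 𝕜 (Jet 𝕜) (Jet 𝕜)) (i : Fin 2) (j : Fin 2 × ℕ) :
    coeffMap (d : Jet 𝕜 →ₗ[𝕜] Jet 𝕜) (symbolDer i (MvPolynomial.X j)) = 0 := by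
  rw [symbolDer_X]
  split_ifs
  · exact coeffMap_X_pow d _
  · simp

lemma symbolDer_totalD (i : Fin 2) (f : Jet 𝕜) :
    symbolDer i (totalD 𝕜 f) = coeffMap (totalD 𝕜 : Jet 𝕜 →ₗ[𝕜] Jet 𝕜) (symbolDer i f) +
      Polynomial.X * symbolDer i f := by
  have : symbolComm i (totalD 𝕜) =
      (LinearMap.mulLeft (Jet 𝕜) (Polynomial.X : Polynomial (Jet 𝕜))).compDer (symbolDer i) := by
    refine MvPolynomial.derivation_ext fun j => ?_
    rw [symbolComm_apply, coeffMap_symbolDer_X]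
    simp only [totalD_X, symbolDer_X, sub_zero, Derivation.coe_comp, LinearMap.coe_comp,
      LinearMap.coe_restrictScalars, Function.comp_apply, Derivation.coeFn_coe,
      LinearMap.mulLeft_apply]
    split_ifs
    · rw [pow_succ']
    · simp
  have h := DFunLike.congr_fun this f
  rw [symbolComm_apply, sub_eq_iff_eq_add'] at h
  exact h

lemma symbolDer_dispersion (i : Fin 2) (l : Fin 2 → 𝕜) (f : Jet 𝕜) :
    symbolDer i (dispersion l f) =
      coeffMap (dispersion l : Jet 𝕜 →ₗ[𝕜] Jet 𝕜) (symbolDer i f) +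
      l i • (Polynomial.X ^ 3 * symbolDer i f) := by
  have : symbolComm i (dispersion l) = l i •
      (LinearMap.mulLeft (Jet 𝕜) (Polynomial.X ^ 3 : Polynomial (Jet 𝕜))).compDer
        (symbolDer i) := by
    refine MvPolynomial.derivation_ext fun j => ?_
    rw [symbolComm_apply, coeffMap_symbolDer_X]
    simp only [dispersion_X, Derivation.map_smul, symbolDer_X, sub_zero, Derivation.smul_apply,
      Derivation.coe_comp, LinearMap.coe_comp,
      LinearMap.coe_restrictScalars, Function.comp_apply, Derivation.coeFn_coe,
      LinearMap.mulLeft_apply]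
    split_ifs with h
    · rw [h, ← pow_add, add_comm]
    · simp
  have h := DFunLike.congr_fun this f
  rw [symbolComm_apply, sub_eq_iff_eq_add'] at h
  exact h

lemma evalNegD_X_pow_mul (k : ℕ) (p : Polynomial (Jet 𝕜)) :
    evalNegD (Polynomial.X ^ k * p) = ((-(totalD 𝕜 : Jet 𝕜 →ₗ[𝕜] Jet 𝕜)) ^ k) (evalNegD p) := by
  induction p using Polynomial.induction_on' with
  | add p q hp hq => rw [mul_add, map_add, hp, hq, map_add, map_add]
  | monomial m b =>
    rw [Polynomial.X_pow_mul_monomial, evalNegD_monomial, evalNegD_monomial, add_comm m k, pow_add]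
    rfl

lemma evalNegD_coeffMap {d : Derivation 𝕜 (Jet 𝕜) (Jet 𝕜)}
    (h : ∀ f, d (totalD 𝕜 f) = totalD 𝕜 (d f)) (p : Polynomial (Jet 𝕜)) :
    evalNegD (coeffMap (d : Jet 𝕜 →ₗ[𝕜] Jet 𝕜) p) = d (evalNegD p) := by
  induction p using Polynomial.induction_on' with
  | add p q hp hq => rw [map_add, map_add, map_add, map_add, hp, hq]
  | monomial m b =>
    have hc : Commute (d : Jet 𝕜 →ₗ[𝕜] Jet 𝕜) (-(totalD 𝕜 : Jet 𝕜 →ₗ[𝕜] Jet 𝕜)) := by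
      refine LinearMap.ext fun f => ?_
      simp [Module.End.mul_apply, h]
    rw [coeffMap_monomial, evalNegD_monomial, evalNegD_monomial]
    exact (LinearMap.congr_fun (hc.pow_right m).eq b).symm

/-- The symbol of ∂f is (∂ + Z) applied to the symbol of f, and the substitution Z ↦ -∂ makes the
two terms cancel. -/
lemma euler_totalD (i : Fin 2) (f : Jet 𝕜) : euler i (totalD 𝕜 f) = 0 := by
  have h1 := evalNegD_X_pow_mul 1 (symbolDer i f)
  rw [pow_one, pow_one] at h1
  simp only [euler_apply]
  rw [symbolDer_totalD, map_add, evalNegD_coeffMap fun _ => rfl, h1]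
  simp

/-- The minus sign is that of the adjoint of ∂³. If the dispersion of f is a total derivative, its
variational derivative y therefore solves L y = l i ∂³y. -/
lemma euler_dispersion (i : Fin 2) (l : Fin 2 → 𝕜) (f : Jet 𝕜) :
    euler i (dispersion l f) =
      dispersion l (euler i f) - l i • totalD 𝕜 (totalD 𝕜 (totalD 𝕜 (euler i f))) := by
  simp only [euler_apply]
  rw [symbolDer_dispersion, map_add, evalNegD_coeffMap (dispersion_totalD l), map_smul,
    evalNegD_X_pow_mul]
  simp [pow_succ, Module.End.mul_apply, sub_eq_add_neg]

/-- `𝒫`-linear pairing of the symbols with the jets of the `i`-th indeterminate. -/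
noncomputable def pairX (i : Fin 2) : Polynomial (Jet 𝕜) →ₗ[Jet 𝕜] Jet 𝕜 :=
  Polynomial.lsum fun m => LinearMap.mulLeft (Jet 𝕜) (MvPolynomial.X (i, m))

/-- Integration by parts, m times. -/
lemma X_mul_sub_mem_range (i : Fin 2) (m : ℕ) (a : Jet 𝕜) :
    ∃ q, MvPolynomial.X (i, m) * a - MvPolynomial.X (i, 0) *
      ((-(totalD 𝕜 : Jet 𝕜 →ₗ[𝕜] Jet 𝕜)) ^ m) a = totalD 𝕜 q := by
  induction m generalizing a with
  | zero => exact ⟨0, by simp⟩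
  | succ m ih =>
    obtain ⟨q, hq⟩ := ih (-totalD 𝕜 a)
    refine ⟨q + MvPolynomial.X (i, m) * a, ?_⟩
    rw [map_add, ← hq, pow_succ, Module.End.mul_apply]
    simp only [LinearMap.neg_apply, Derivation.coeFn_coe, Derivation.leibniz, totalD_X,
      smul_eq_mul]
    ring

lemma pairX_sub_mem_range (i : Fin 2) (f : Jet 𝕜) :
    ∃ q, pairX i (symbolDer i f) - MvPolynomial.X (i, 0) * euler i f = totalD 𝕜 q := by
  rw [euler_apply]
  generalize symbolDer i f = p
  induction p using Polynomial.induction_on' with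
  | add p q hp hq =>
    obtain ⟨x, hx⟩ := hp
    obtain ⟨y, hy⟩ := hq
    exact ⟨x + y, by
      rw [map_add, map_add, Derivation.map_add, ← hx, ← hy]; ring⟩
  | monomial m b =>
    obtain ⟨q, hq⟩ := X_mul_sub_mem_range i m b
    refine ⟨q, ?_⟩
    rw [← hq, evalNegD_monomial]
    simp [pairX, Polynomial.lsum_apply]

/-- Euler's identity: the sum of the two pairings is the derivation fixing every jet variable.
Combined with `pairX_sub_mem_range`, it shows that a form of positive degree with zero variational
derivatives is a total derivative. -/
lemma pairX_symbolDer_of_isHomogeneous {n : ℕ} {f : Jet 𝕜} (hf : f.IsHomogeneous n) :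
    pairX 0 (symbolDer 0 f) + pairX 1 (symbolDer 1 f) = (n : 𝕜) • f := by
  have : (pairX 0).compDer (symbolDer (𝕜 := 𝕜) 0) + (pairX 1).compDer (symbolDer 1) =
      MvPolynomial.mkDerivation 𝕜 fun j => MvPolynomial.X j := by
    refine MvPolynomial.derivation_ext fun j => ?_
    obtain ⟨j, m⟩ := j
    simp only [Derivation.add_apply, Derivation.coe_comp, LinearMap.coe_comp,
      LinearMap.coe_restrictScalars, Function.comp_apply, Derivation.coeFn_coe, symbolDer_X,
      MvPolynomial.mkDerivation_X]
    fin_cases j <;>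
      simp [pairX, Polynomial.lsum_apply, ← Polynomial.monomial_one_right_eq_X_pow]
  have h := DFunLike.congr_fun this f
  simp only [Derivation.add_apply, Derivation.coe_comp, LinearMap.coe_comp,
      LinearMap.coe_restrictScalars, Function.comp_apply, Derivation.coeFn_coe] at h
  rw [h]
  conv_lhs => rw [f.as_sum, map_sum]
  conv_rhs => rw [f.as_sum, Finset.smul_sum]
  refine Finset.sum_congr rfl fun s hs => ?_
  have hd : s.degree = n := by
    by_contra hne
    exact (MvPolynomial.mem_support_iff.mp hs) (hf.coeff_eq_zero hne)
  have key : ∀ j ∈ s.support, MvPolynomial.monomial (s - Finsupp.single j 1) (s j : 𝕜) •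
      (MvPolynomial.X j : Jet 𝕜) = (s j : 𝕜) • MvPolynomial.monomial s 1 := fun j hj => by
    rw [smul_eq_mul, MvPolynomial.X, MvPolynomial.monomial_mul,
      Finsupp.sub_add_single_one_cancel (Finsupp.mem_support_iff.mp hj),
      MvPolynomial.smul_monomial, smul_eq_mul]
  rw [MvPolynomial.mkDerivation_monomial, Finsupp.sum, Finset.sum_congr rfl key,
    ← Finset.sum_smul, ← Nat.cast_sum, ← Finsupp.degree_apply, hd, smul_comm,
    MvPolynomial.smul_monomial (MvPolynomial.coeff s f), smul_eq_mul, mul_one]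

end Euler

/-! ### Homogeneous components. -/

section Homogeneous

variable {𝕜 : Type*} [Field 𝕜]

lemma isHomogeneous_mkDerivation {F : Fin 2 × ℕ → Jet 𝕜} {e n : ℕ}
    (hF : ∀ j, (F j).IsHomogeneous e) {f : Jet 𝕜} (hf : f.IsHomogeneous (n + 1)) :
    (MvPolynomial.mkDerivation 𝕜 F f).IsHomogeneous (n + e) := by
  rw [f.as_sum, map_sum]
  refine MvPolynomial.IsHomogeneous.sum _ _ _ fun s hs => ?_
  have hd : s.degree = n + 1 := by
    by_contra hne
    exact (MvPolynomial.mem_support_iff.mp hs) (hf.coeff_eq_zero hne)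
  rw [MvPolynomial.mkDerivation_monomial, MvPolynomial.smul_eq_C_mul]
  refine MvPolynomial.IsHomogeneous.C_mul (MvPolynomial.IsHomogeneous.sum _ _ _ fun j hj => ?_) _
  refine MvPolynomial.IsHomogeneous.mul (MvPolynomial.isHomogeneous_monomial _ ?_) (hF j)
  have h2 := congrArg Finsupp.degree
      (Finsupp.sub_add_single_one_cancel (Finsupp.mem_support_iff.mp hj))
  rw [map_add, Finsupp.degree_single] at h2
  omega

lemma derivation_eq_zero_of_isHomogeneous_zero {M : Type*} [AddCommGroup M] [Module 𝕜 M]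
    [Module (Jet 𝕜) M] (d : Derivation 𝕜 (Jet 𝕜) M) {f : Jet 𝕜}
    (hf : f.IsHomogeneous 0) : d f = 0 := by
  rw [← MvPolynomial.totalDegree_zero_iff_isHomogeneous,
    MvPolynomial.totalDegree_eq_zero_iff_eq_C] at hf
  rw [hf, MvPolynomial.derivation_C]

lemma isHomogeneous_mkDerivation_succ {F : Fin 2 × ℕ → Jet 𝕜} {e : ℕ}
    (hF : ∀ j, (F j).IsHomogeneous (e + 1)) {n : ℕ} {f : Jet 𝕜} (hf : f.IsHomogeneous n) :
    (MvPolynomial.mkDerivation 𝕜 F f).IsHomogeneous (n + e) := by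
  cases n with
  | zero =>
    rw [derivation_eq_zero_of_isHomogeneous_zero _ hf]
    exact MvPolynomial.isHomogeneous_zero _ _ _
  | succ n =>
    have := isHomogeneous_mkDerivation hF hf
    rwa [show n + (e + 1) = n + 1 + e by ring] at this

lemma isHomogeneous_totalD {n : ℕ} {f : Jet 𝕜} (hf : f.IsHomogeneous n) :
    (totalD 𝕜 f).IsHomogeneous n :=
  isHomogeneous_mkDerivation_succ (e := 0) (fun _ => MvPolynomial.isHomogeneous_X _ _) hf

lemma isHomogeneous_iterate_totalD {n : ℕ} {f : Jet 𝕜} (hf : f.IsHomogeneous n) (m : ℕ) :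
    ((totalD 𝕜)^[m] f).IsHomogeneous n := by
  induction m with
  | zero => exact hf
  | succ m ih => rw [Function.iterate_succ_apply']; exact isHomogeneous_totalD ih

lemma isHomogeneous_dispersion (l : Fin 2 → 𝕜) {n : ℕ} {f : Jet 𝕜} (hf : f.IsHomogeneous n) :
    (dispersion l f).IsHomogeneous n :=
  isHomogeneous_mkDerivation_succ (e := 0) (fun j => by
    rw [MvPolynomial.smul_eq_C_mul]
    exact (MvPolynomial.isHomogeneous_X _ _).C_mul _) hf

lemma isHomogeneous_evolve {q : Fin 2 → Jet 𝕜} {e : ℕ} (hq : ∀ i, (q i).IsHomogeneous (e + 1))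
    {n : ℕ} {f : Jet 𝕜} (hf : f.IsHomogeneous n) : (evolve q f).IsHomogeneous (n + e) :=
  isHomogeneous_mkDerivation_succ (fun _ => isHomogeneous_iterate_totalD (hq _) _) hf

lemma isHomogeneous_neg_totalD_pow {n : ℕ} {f : Jet 𝕜} (hf : f.IsHomogeneous n) (m : ℕ) :
    (((-(totalD 𝕜 : Jet 𝕜 →ₗ[𝕜] Jet 𝕜)) ^ m) f).IsHomogeneous n := by
  induction m with
  | zero => exact hf
  | succ m ih =>
    rw [pow_succ', Module.End.mul_apply]
    exact (isHomogeneous_totalD ih).neg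

lemma isHomogeneous_euler (i : Fin 2) {n : ℕ} {f : Jet 𝕜} (hf : f.IsHomogeneous n) :
    (euler i f).IsHomogeneous (n - 1) := by
  rw [euler_apply, evalNegD_eq_sum]
  refine MvPolynomial.IsHomogeneous.sum _ _ _ fun m _ => ?_
  rw [coeff_symbolDer]
  exact isHomogeneous_neg_totalD_pow hf.pderiv m

/-- A linear map that maps homogeneous polynomials of degree `k` to homogeneous polynomials of
degree `g k` commutes with the projections to the homogeneous components. -/
lemma homogeneousComponent_map {φ : Jet 𝕜 →ₗ[𝕜] Jet 𝕜} {g : ℕ → ℕ}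
    (hφ : ∀ k f, MvPolynomial.IsHomogeneous f k → (φ f).IsHomogeneous (g k)) {m n : ℕ}
    (hmn : g m = n)
    (hg : ∀ k, k ≠ m → g k = n → ∀ f, MvPolynomial.IsHomogeneous f k → φ f = 0) (f : Jet 𝕜) :
    MvPolynomial.homogeneousComponent n (φ f) = φ (MvPolynomial.homogeneousComponent m f) := by
  have key : ∀ k, MvPolynomial.homogeneousComponent n (φ (MvPolynomial.homogeneousComponent k f)) =
      if k = m then φ (MvPolynomial.homogeneousComponent m f) else 0 := fun k => by
    have hk := hφ k _ (MvPolynomial.homogeneousComponent_isHomogeneous k f)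
    rw [MvPolynomial.homogeneousComponent_of_mem hk]
    by_cases h : k = m
    · rw [if_pos h, if_pos (h ▸ hmn.symm), h]
    · rw [if_neg h]
      split_ifs with h'
      · exact hg k h h'.symm _ (MvPolynomial.homogeneousComponent_isHomogeneous k f)
      · rfl
  conv_lhs => rw [← f.sum_homogeneousComponent, map_sum, map_sum]
  rw [Finset.sum_congr rfl fun k _ => key k, Finset.sum_ite_eq']
  split_ifs with h
  · rfl
  · rw [Finset.mem_range, not_lt] at h
    rw [MvPolynomial.homogeneousComponent_eq_zero _ _ (by omega), map_zero]

lemma homogeneousComponent_totalD (n : ℕ) (f : Jet 𝕜) :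
    MvPolynomial.homogeneousComponent n (totalD 𝕜 f) =
      totalD 𝕜 (MvPolynomial.homogeneousComponent n f) :=
  homogeneousComponent_map (φ := (totalD 𝕜).toLinearMap) (g := id)
    (fun _ _ => isHomogeneous_totalD) rfl (fun _ h h' => absurd h' h) f

lemma homogeneousComponent_dispersion (l : Fin 2 → 𝕜) (n : ℕ) (f : Jet 𝕜) :
    MvPolynomial.homogeneousComponent n (dispersion l f) =
      dispersion l (MvPolynomial.homogeneousComponent n f) :=
  homogeneousComponent_map (φ := (dispersion l).toLinearMap) (g := id)
    (fun _ _ => isHomogeneous_dispersion l) rfl (fun _ h h' => absurd h' h) f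

lemma homogeneousComponent_evolve {q : Fin 2 → Jet 𝕜} (hq : ∀ i, (q i).IsHomogeneous 2)
    (n : ℕ) (f : Jet 𝕜) :
    MvPolynomial.homogeneousComponent (n + 1) (evolve q f) =
      evolve q (MvPolynomial.homogeneousComponent n f) :=
  homogeneousComponent_map (φ := (evolve q).toLinearMap) (g := fun k => k + 1)
    (fun _ _ => isHomogeneous_evolve hq) rfl (fun _ h h' => absurd (Nat.succ_injective h') h) f

lemma homogeneousComponent_X_mul (j : Fin 2 × ℕ) (n : ℕ) (f : Jet 𝕜) :
    MvPolynomial.homogeneousComponent (n + 1) (MvPolynomial.X j * f) =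
      MvPolynomial.X j * MvPolynomial.homogeneousComponent n f :=
  homogeneousComponent_map (φ := LinearMap.mulLeft 𝕜 (MvPolynomial.X j : Jet 𝕜))
    (g := fun k => k + 1)
    (fun k _ h => by
      have := (MvPolynomial.isHomogeneous_X 𝕜 j).mul h
      rwa [add_comm 1 k] at this) rfl
    (fun _ h h' => absurd (Nat.succ_injective h') h) f

lemma homogeneousComponent_euler (i : Fin 2) (n : ℕ) (f : Jet 𝕜) :
    MvPolynomial.homogeneousComponent n (euler i f) =
      euler i (MvPolynomial.homogeneousComponent (n + 1) f) := by
  refine homogeneousComponent_map (φ := euler i) (g := fun k => k - 1) (m := n + 1)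
    (fun _ _ => isHomogeneous_euler i) (Nat.add_sub_cancel n 1) (fun k h h' f hf => ?_) f
  -- The subtraction in `k - 1` truncates, so degree 0 also lands in degree 0; it does no harm, as
  -- the Euler operator kills constants.
  obtain rfl : k = 0 := by omega
  rw [euler_apply, derivation_eq_zero_of_isHomogeneous_zero _ hf, map_zero]

lemma constantCoeff_homogeneousComponent {f : Jet 𝕜} (h : MvPolynomial.constantCoeff f = 0)
    (n : ℕ) : MvPolynomial.constantCoeff (MvPolynomial.homogeneousComponent n f) = 0 := by
  rw [MvPolynomial.constantCoeff_eq] at h ⊢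
  rw [MvPolynomial.coeff_homogeneousComponent]
  split_ifs <;> simp [h]

lemma constantCoeff_pderiv (j : Fin 2 × ℕ) (f : Jet 𝕜) :
    MvPolynomial.constantCoeff (MvPolynomial.pderiv j f) =
      MvPolynomial.coeff (Finsupp.single j 1) f := by
  simp [MvPolynomial.constantCoeff_eq, MvPolynomial.coeff_pderiv]

lemma constantCoeff_pderiv_homogeneousComponent {j : Fin 2 × ℕ} {f : Jet 𝕜}
    (h : MvPolynomial.constantCoeff (MvPolynomial.pderiv j f) = 0) (n : ℕ) :
    MvPolynomial.constantCoeff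
      (MvPolynomial.pderiv j (MvPolynomial.homogeneousComponent n f)) = 0 := by
  rw [constantCoeff_pderiv] at h ⊢
  rw [MvPolynomial.coeff_homogeneousComponent]
  split_ifs <;> simp [h]

lemma eq_zero_of_homogeneousComponent {f : Jet 𝕜}
    (h : ∀ n, MvPolynomial.homogeneousComponent n f = 0) : f = 0 := by
  rw [← f.sum_homogeneousComponent]
  exact Finset.sum_eq_zero fun n _ => h n

end Homogeneous

/-! ### Triviality of conserved densities. -/

section Conserved

variable {𝕜 : Type*} [Field 𝕜] [CharZero 𝕜]

/-- A conserved density of a third order evolution equation with a quadratic nonlinearity, with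
variational derivatives that have no constant and linear terms, is trivial. -/
theorem exists_totalD_eq_of_conserved {l : Fin 2 → 𝕜} (hl : ∀ i, l i ≠ 0) {q : Fin 2 → Jet 𝕜}
    (hq : ∀ i, (q i).IsHomogeneous 2) {f : Jet 𝕜} (hf : MvPolynomial.constantCoeff f = 0)
    (hcons : ∃ p, dispersion l f + evolve q f = totalD 𝕜 p)
    (h0 : ∀ i, MvPolynomial.constantCoeff (euler i f) = 0)
    (h1 : ∀ i j, MvPolynomial.constantCoeff (MvPolynomial.pderiv j (euler i f)) = 0) :
    ∃ p, totalD 𝕜 p = f := by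
  obtain ⟨p, hp⟩ := hcons
  have key : ∀ n, ∃ p, totalD 𝕜 p = MvPolynomial.homogeneousComponent n f := by
    intro n
    induction n with
    | zero =>
      refine ⟨0, ?_⟩
      rw [map_zero, MvPolynomial.homogeneousComponent_zero, ← MvPolynomial.constantCoeff_eq, hf,
        map_zero]
    | succ n ih =>
      obtain ⟨g, hg⟩ := ih
      -- In degree n+1 the quadratic part of the flow acts on the component of degree n. That
      -- component is already ∂g, so its contribution is a total derivative.
      have hL : dispersion l (MvPolynomial.homogeneousComponent (n + 1) f) =
          totalD 𝕜 (MvPolynomial.homogeneousComponent (n + 1) p - evolve q g) := by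
        rw [map_sub, ← homogeneousComponent_totalD, ← hp, map_add,
          homogeneousComponent_dispersion, homogeneousComponent_evolve hq, ← hg, evolve_totalD]
        ring
      -- The Euler operator annihilates the right side of `hL` and leaves a dispersive equation for
      -- the variational derivative.
      have hE : ∀ i, euler i (MvPolynomial.homogeneousComponent (n + 1) f) = 0 := fun i => by
        refine eq_zero_of_dispersion_eq (hl i) (l := l) ?_ ?_ fun j => ?_
        · have := congrArg (euler i) hL
          rw [euler_totalD, euler_dispersion] at this
          exact sub_eq_zero.mp this
        · rw [← homogeneousComponent_euler]
          exact constantCoeff_homogeneousComponent (h0 i) n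
        · rw [← homogeneousComponent_euler]
          exact constantCoeff_pderiv_homogeneousComponent (h1 i j) n
      obtain ⟨a, ha⟩ := pairX_sub_mem_range 0 (MvPolynomial.homogeneousComponent (n + 1) f)
      obtain ⟨b, hb⟩ := pairX_sub_mem_range 1 (MvPolynomial.homogeneousComponent (n + 1) f)
      have hs := pairX_symbolDer_of_isHomogeneous
        (MvPolynomial.homogeneousComponent_isHomogeneous (n + 1) f)
      rw [hE, mul_zero, sub_zero] at ha hb
      refine ⟨((n + 1 : ℕ) : 𝕜)⁻¹ • (a + b), ?_⟩
      rw [Derivation.map_smul, map_add, ← ha, ← hb, hs, inv_smul_smul₀]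
      exact Nat.cast_ne_zero.mpr n.succ_ne_zero
  choose g hg using key
  refine ⟨∑ n ∈ Finset.range (f.totalDegree + 1), g n, ?_⟩
  rw [map_sum, Finset.sum_congr rfl fun n _ => hg n, MvPolynomial.sum_homogeneousComponent]

end Conserved

/-! ### Linear and quadratic symbols. -/

section Symbols

variable {𝕜 : Type*} [Field 𝕜]

@[simp] lemma constantCoeff_totalD (f : Jet 𝕜) :
    MvPolynomial.constantCoeff (totalD 𝕜 f) = 0 := by
  induction f using MvPolynomial.induction_on with
  | C r => simp
  | add p q hp hq => simp [hp, hq]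
  | mul_X p j hp => simp [hp]

lemma constantCoeff_derivation_congr {d d' : Derivation 𝕜 (Jet 𝕜) (Jet 𝕜)}
    (h : ∀ j, MvPolynomial.constantCoeff (d (MvPolynomial.X j)) =
      MvPolynomial.constantCoeff (d' (MvPolynomial.X j))) (f : Jet 𝕜) :
    MvPolynomial.constantCoeff (d f) = MvPolynomial.constantCoeff (d' f) := by
  induction f using MvPolynomial.induction_on with
  | C r => simp
  | add p q hp hq => simp [hp, hq]
  | mul_X p j hp => simp [h]

lemma constantCoeff_derivation_eq_zero {d : Derivation 𝕜 (Jet 𝕜) (Jet 𝕜)}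
    (h : ∀ j, MvPolynomial.constantCoeff (d (MvPolynomial.X j)) = 0) (f : Jet 𝕜) :
    MvPolynomial.constantCoeff (d f) = 0 := by
  rw [constantCoeff_derivation_congr (d' := 0) (by simpa using h)]; simp

lemma constantCoeff_iterate_totalD {f : Jet 𝕜} (h : MvPolynomial.constantCoeff f = 0) (m : ℕ) :
    MvPolynomial.constantCoeff ((totalD 𝕜)^[m] f) = 0 := by
  cases m with
  | zero => exact h
  | succ m => rw [Function.iterate_succ_apply', constantCoeff_totalD]

lemma constantCoeff_evolve {F : Fin 2 → Jet 𝕜} (hF : ∀ i, MvPolynomial.constantCoeff (F i) = 0)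
    (f : Jet 𝕜) : MvPolynomial.constantCoeff (evolve F f) = 0 :=
  constantCoeff_derivation_eq_zero
    (fun j => by rw [evolve_X]; exact constantCoeff_iterate_totalD (hF _) _) f

lemma constantCoeff_dispersion (l : Fin 2 → 𝕜) (f : Jet 𝕜) :
    MvPolynomial.constantCoeff (dispersion l f) = 0 :=
  constantCoeff_derivation_eq_zero (fun j => by rw [dispersion_X]; simp) f

lemma constantCoeff_iterate_shiftD (s : 𝕜) (m : ℕ) (f : Jet 𝕜) :
    MvPolynomial.constantCoeff ((shiftD s)^[m] f) = s ^ m * MvPolynomial.constantCoeff f := by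
  induction m with
  | zero => simp
  | succ m ih => rw [Function.iterate_succ_apply', shiftD]; simp [ih]; ring

lemma jetShift_iterate_shiftD (i : Fin 2) (z s : 𝕜) (m : ℕ) (f : Jet 𝕜) :
    jetShift i z ((shiftD s)^[m] f) = (shiftD (s + z))^[m] (jetShift i z f) := by
  induction m with
  | zero => rfl
  | succ m ih => rw [Function.iterate_succ_apply', jetShift_shiftD, ih, Function.iterate_succ_apply']

lemma jetShift_iterate_totalD (i : Fin 2) (z : 𝕜) (m : ℕ) (f : Jet 𝕜) :
    jetShift i z ((totalD 𝕜)^[m] f) = (shiftD z)^[m] (jetShift i z f) := by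
  have h := jetShift_iterate_shiftD i z 0 m f
  have h0 : (shiftD 0 : Jet 𝕜 → Jet 𝕜) = totalD 𝕜 := by ext1 f; simp [shiftD]
  rwa [zero_add, h0] at h

lemma commutator_jetShift_evolve_X (i : Fin 2) (z : 𝕜) (F : Fin 2 → Jet 𝕜) (j : Fin 2 × ℕ) :
    ⁅jetShift i z, evolve F⁆ (MvPolynomial.X j) = (shiftD z)^[j.2] (jetShift i z (F j.1)) := by
  rw [Derivation.commutator_apply, evolve_X, jetShift_X, jetShift_iterate_totalD]
  split_ifs <;> simp

/-- The chain rule at the origin: since F has no constant terms, linear parts compose like matrices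
of symbols. -/
lemma constantCoeff_jetShift_evolve (i : Fin 2) (z : 𝕜) {F : Fin 2 → Jet 𝕜}
    (hF : ∀ i, MvPolynomial.constantCoeff (F i) = 0) (f : Jet 𝕜) :
    MvPolynomial.constantCoeff (jetShift i z (evolve F f)) =
      MvPolynomial.constantCoeff (jetShift i z (F 0)) *
          MvPolynomial.constantCoeff (jetShift 0 z f) +
        MvPolynomial.constantCoeff (jetShift i z (F 1)) *
          MvPolynomial.constantCoeff (jetShift 1 z f) := by
  have h1 := Derivation.commutator_apply (D1 := jetShift i z) (D2 := evolve F) f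
  have h2 := constantCoeff_derivation_congr (d := ⁅jetShift i z, evolve F⁆)
    (d' := MvPolynomial.constantCoeff (jetShift i z (F 0)) • jetShift 0 z +
      MvPolynomial.constantCoeff (jetShift i z (F 1)) • jetShift 1 z) (fun j => by
        rw [commutator_jetShift_evolve_X, constantCoeff_iterate_shiftD]
        obtain ⟨j, m⟩ := j
        fin_cases j <;> simp [jetShift_X, mul_comm]) f
  rw [h1, map_sub, constantCoeff_evolve hF, sub_zero] at h2
  simpa using h2

/-- If q starts in degree 2, the quadratic part of the evolution of f comes from inserting q into
the linear part of f. A product of exponentials with exponents z and w has exponent z + w. -/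
lemma constantCoeff_jetShift_jetShift_evolve (i j : Fin 2) (z w : 𝕜) {q : Fin 2 → Jet 𝕜}
    (hq : ∀ i, MvPolynomial.constantCoeff (q i) = 0)
    (hq' : ∀ i k z, MvPolynomial.constantCoeff (jetShift i z (q k)) = 0) (f : Jet 𝕜) :
    MvPolynomial.constantCoeff (jetShift i z (jetShift j w (evolve q f))) =
      MvPolynomial.constantCoeff (jetShift i z (jetShift j w (q 0))) *
          MvPolynomial.constantCoeff (jetShift 0 (z + w) f) +
        MvPolynomial.constantCoeff (jetShift i z (jetShift j w (q 1))) *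
          MvPolynomial.constantCoeff (jetShift 1 (z + w) f) := by
  have hc : ∀ i z f, MvPolynomial.constantCoeff (⁅jetShift i z, evolve q⁆ f) = 0 := fun i z f =>
    constantCoeff_derivation_eq_zero (fun j => by
      rw [commutator_jetShift_evolve_X, constantCoeff_iterate_shiftD, hq', mul_zero]) f
  have h2 := constantCoeff_derivation_congr (d := ⁅jetShift i z, ⁅jetShift j w, evolve q⁆⁆)
    (d' := MvPolynomial.constantCoeff (jetShift i z (jetShift j w (q 0))) • jetShift 0 (z + w) +
      MvPolynomial.constantCoeff (jetShift i z (jetShift j w (q 1))) • jetShift 1 (z + w))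
      (fun k => by
        have h0 : ⁅jetShift j w, evolve q⁆ (jetShift i z (MvPolynomial.X k)) = 0 := by
          rw [jetShift_X]; split_ifs <;> simp
        rw [Derivation.commutator_apply, h0, sub_zero, commutator_jetShift_evolve_X,
          jetShift_iterate_shiftD, constantCoeff_iterate_shiftD]
        obtain ⟨k, m⟩ := k
        fin_cases k <;> simp [jetShift_X, mul_comm, add_comm]) f
  -- Only the double commutator has a constant term: the single commutators involve the linear
  -- symbols of q, which vanish.
  have e1 : jetShift i z (jetShift j w (evolve q f)) = ⁅jetShift i z, ⁅jetShift j w, evolve q⁆⁆ f +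
      ⁅jetShift j w, evolve q⁆ (jetShift i z f) + ⁅jetShift i z, evolve q⁆ (jetShift j w f) +
      evolve q (jetShift i z (jetShift j w f)) := by
    simp only [Derivation.commutator_apply, map_sub]; ring
  rw [e1]
  simp only [map_add, hc, constantCoeff_evolve hq, h2, add_zero]
  simp

lemma constantCoeff_jetShift_jetShift_dispersion (i j : Fin 2) (z w : 𝕜) (l : Fin 2 → 𝕜)
    (f : Jet 𝕜) :
    MvPolynomial.constantCoeff (jetShift i z (jetShift j w (dispersion l f))) =
      (l i * z ^ 3 + l j * w ^ 3) *
        MvPolynomial.constantCoeff (jetShift i z (jetShift j w f)) := by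
  simp only [jetShift_dispersion, map_add, Derivation.map_smul, MvPolynomial.constantCoeff_smul,
    constantCoeff_dispersion, smul_eq_mul]
  ring

lemma constantCoeff_euler (i : Fin 2) (f : Jet 𝕜) :
    MvPolynomial.constantCoeff (euler i f) = MvPolynomial.constantCoeff (jetShift i 0 f) := by
  rw [euler_apply, ← eval_symbolDer]
  generalize symbolDer i f = p
  induction p using Polynomial.induction_on' with
  | add p q hp hq => simp [hp, hq]
  | monomial m b =>
    rw [evalNegD_monomial]
    cases m with
    | zero => simp
    | succ m => simp [pow_succ', Module.End.mul_apply]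

/-- At the level of constant terms, a shift by z after (-∂)^m yields the factor (-z)^m, which is
what evaluating the symbol in the i-th indeterminate at -z gives. -/
lemma constantCoeff_jetShift_euler (i j : Fin 2) (z : 𝕜) (f : Jet 𝕜) :
    MvPolynomial.constantCoeff (jetShift j z (euler i f)) =
      MvPolynomial.constantCoeff (jetShift j z (jetShift i (-z) f)) := by
  rw [euler_apply, ← eval_symbolDer i (-z)]
  generalize symbolDer i f = p
  induction p using Polynomial.induction_on' with
  | add p q hp hq => simp [hp, hq]
  | monomial m b =>
    rw [evalNegD_monomial]
    have : ∀ b, MvPolynomial.constantCoeff (jetShift j z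
        (((-(totalD 𝕜 : Jet 𝕜 →ₗ[𝕜] Jet 𝕜)) ^ m) b)) =
        (-z) ^ m * MvPolynomial.constantCoeff (jetShift j z b) := by
      induction m with
      | zero => simp
      | succ m ih =>
        intro b
        rw [pow_succ, Module.End.mul_apply, ih]
        simp [jetShift_totalD]
        ring
    rw [this, Polynomial.eval_monomial, ← map_pow, mul_comm b, MvPolynomial.C_mul',
      Derivation.map_smul, MvPolynomial.constantCoeff_smul, smul_eq_mul]

end Symbols

/-! ### Symmetries of the Hirota-Satsuma system: uniqueness and symbol relations. -/

section HirotaSatsuma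

variable {𝕜 : Type*} [Field 𝕜]

/-- The quadratic part of the Hirota-Satsuma system. -/
noncomputable def hsQuad (p r : 𝕜) : Fin 2 → Jet 𝕜 :=
  ![p • (MvPolynomial.X (0, 0) * MvPolynomial.X (0, 1)) +
      r • (MvPolynomial.X (1, 0) * MvPolynomial.X (1, 1)),
    -(p • (MvPolynomial.X (0, 0) * MvPolynomial.X (1, 1)))]

/-- The Hirota-Satsuma system
`u_t = c u''' + p u u' + r v v'`, `v_t = -2 c v''' - p u v'`. -/
noncomputable def hsField (c p r : 𝕜) (i : Fin 2) : Jet 𝕜 :=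
  (![c, -2 * c] : Fin 2 → 𝕜) i • MvPolynomial.X (i, 3) + hsQuad p r i

/-- The linearization of the Hirota-Satsuma system: `K` is the characteristic of a symmetry. -/
def IsHSSymmetry (c p r : 𝕜) (K : Fin 2 → Jet 𝕜) : Prop :=
  ∀ i, evolve (hsField c p r) (K i) = evolve K (hsField c p r i)

lemma evolve_hsField (c p r : 𝕜) (f : Jet 𝕜) :
    evolve (hsField c p r) f =
      dispersion ![c, -2 * c] f + evolve (hsQuad p r) f := by
  have h : evolve (hsField c p r) = dispersion ![c, -2 * c] + evolve (hsQuad p r) := by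
    refine eq_of_comm_totalD (evolve_totalD _) (fun f => ?_) fun i => ?_
    · simp only [Derivation.add_apply, map_add, evolve_totalD, dispersion_totalD]
    · simp only [Derivation.add_apply, evolve_X, dispersion_X, hsField, Function.iterate_zero,
        id_eq, zero_add]
  rw [h, Derivation.add_apply]

lemma isHomogeneous_hsQuad (p r : 𝕜) (i : Fin 2) : (hsQuad p r i).IsHomogeneous 2 := by
  have h : ∀ (s : 𝕜) (j k : Fin 2 × ℕ),
      (s • (MvPolynomial.X j * MvPolynomial.X k) : Jet 𝕜).IsHomogeneous 2 := fun s j k => by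
    rw [MvPolynomial.smul_eq_C_mul]
    exact ((MvPolynomial.isHomogeneous_X _ j).mul (MvPolynomial.isHomogeneous_X _ k)).C_mul s
  fin_cases i
  · exact (h _ _ _).add (h _ _ _)
  · exact (h _ _ _).neg

lemma constantCoeff_hsQuad (p r : 𝕜) (i : Fin 2) :
    MvPolynomial.constantCoeff (hsQuad p r i) = 0 := by
  fin_cases i <;> simp [hsQuad]

lemma constantCoeff_jetShift_hsQuad (p r : 𝕜) (i k : Fin 2) (z : 𝕜) :
    MvPolynomial.constantCoeff (jetShift i z (hsQuad p r k)) = 0 := by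
  fin_cases k <;> simp [hsQuad]

lemma evolve_X_add_three (K : Fin 2 → Jet 𝕜) (i : Fin 2) :
    evolve K (MvPolynomial.X (i, 3)) = totalD 𝕜 (totalD 𝕜 (totalD 𝕜 (K i))) := by
  rw [evolve_X]; rfl

lemma isHSSymmetry_iff (c p r : 𝕜) (K : Fin 2 → Jet 𝕜) :
    IsHSSymmetry c p r K ↔
      (dispersion ![c, -2 * c] (K 0) + evolve (hsQuad p r) (K 0) =
        c • totalD 𝕜 (totalD 𝕜 (totalD 𝕜 (K 0))) +
        p • (MvPolynomial.X (0, 0) * totalD 𝕜 (K 0) + MvPolynomial.X (0, 1) * K 0) +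
        r • (MvPolynomial.X (1, 0) * totalD 𝕜 (K 1) + MvPolynomial.X (1, 1) * K 1)) ∧
      (dispersion ![c, -2 * c] (K 1) + evolve (hsQuad p r) (K 1) =
        (-2 * c) • totalD 𝕜 (totalD 𝕜 (totalD 𝕜 (K 1))) -
        p • (MvPolynomial.X (0, 0) * totalD 𝕜 (K 1) + MvPolynomial.X (1, 1) * K 0)) := by
  have e1 : ∀ i : Fin 2, evolve K (MvPolynomial.X (i, 0)) = K i := fun i => by simp [evolve_X]
  have e2 : ∀ i : Fin 2, evolve K (MvPolynomial.X (i, 1)) = totalD 𝕜 (K i) := fun i => by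
    simp [evolve_X]
  unfold IsHSSymmetry
  rw [Fin.forall_fin_two]
  simp only [evolve_hsField]
  simp only [hsField, hsQuad, Matrix.cons_val_zero, Matrix.cons_val_one, map_add, map_sub,
    Derivation.map_smul, Derivation.leibniz, evolve_X_add_three, e1, e2, smul_eq_mul, ← add_assoc,
    ← sub_eq_add_neg]

section Uniqueness

variable [CharZero 𝕜]

/-- A symmetry of the Hirota-Satsuma system without constant and linear terms vanishes. -/
theorem IsHSSymmetry.eq_zero {c p r : 𝕜} (hc : c ≠ 0) {K : Fin 2 → Jet 𝕜}
    (hK : IsHSSymmetry c p r K) (h0 : ∀ i, MvPolynomial.constantCoeff (K i) = 0)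
    (h1 : ∀ i j, MvPolynomial.constantCoeff (MvPolynomial.pderiv j (K i)) = 0) (i : Fin 2) :
    K i = 0 := by
  rw [isHSSymmetry_iff] at hK
  obtain ⟨hK0, hK1⟩ := hK
  suffices h : ∀ n, MvPolynomial.homogeneousComponent n (K 0) = 0 ∧
      MvPolynomial.homogeneousComponent n (K 1) = 0 by
    fin_cases i
    · exact eq_zero_of_homogeneousComponent fun n => (h n).1
    · exact eq_zero_of_homogeneousComponent fun n => (h n).2
  intro n
  induction n with
  | zero =>
    have h2 : ∀ i, MvPolynomial.homogeneousComponent 0 (K i) = 0 := fun i => by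
      rw [MvPolynomial.homogeneousComponent_zero, ← MvPolynomial.constantCoeff_eq, h0, map_zero]
    exact ⟨h2 0, h2 1⟩
  | succ n ih =>
    -- Once the components of degree n vanish, the quadratic nonlinearity does not contribute in
    -- degree n+1, and two uncoupled dispersive equations remain.
    have e0 := congrArg (MvPolynomial.homogeneousComponent (n + 1)) hK0
    have e1 := congrArg (MvPolynomial.homogeneousComponent (n + 1)) hK1
    simp only [map_add, map_sub, map_smul, homogeneousComponent_totalD,
      homogeneousComponent_dispersion, homogeneousComponent_evolve (isHomogeneous_hsQuad p r),
      homogeneousComponent_X_mul, ih.1, ih.2, map_zero, mul_zero, add_zero, smul_zero,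
      sub_zero] at e0 e1
    have hv : ∀ i, MvPolynomial.constantCoeff
        (MvPolynomial.homogeneousComponent (n + 1) (K i)) = 0 := fun i =>
      constantCoeff_homogeneousComponent (h0 i) _
    have hd : ∀ i j, MvPolynomial.constantCoeff (MvPolynomial.pderiv j
        (MvPolynomial.homogeneousComponent (n + 1) (K i))) = 0 := fun i j =>
      constantCoeff_pderiv_homogeneousComponent (h1 i j) _
    exact ⟨eq_zero_of_dispersion_eq hc e0 (hv 0) (hd 0),
      eq_zero_of_dispersion_eq (mul_ne_zero (by norm_num) hc) e1 (hv 1) (hd 1)⟩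

end Uniqueness

/-- The linear symbol of a differential polynomial. -/
noncomputable def linSymbol (i : Fin 2) (z : 𝕜) (f : Jet 𝕜) : 𝕜 :=
  MvPolynomial.constantCoeff (jetShift i z f)

/-- The quadratic symbol of a differential polynomial. -/
noncomputable def quadSymbol (i j : Fin 2) (z w : 𝕜) (f : Jet 𝕜) : 𝕜 :=
  MvPolynomial.constantCoeff (jetShift i z (jetShift j w f))

section Symbols

variable {c p r : 𝕜} {K : Fin 2 → Jet 𝕜}

lemma quadSymbol_flow (c p r : 𝕜) (i j : Fin 2) (z w : 𝕜) (f : Jet 𝕜) :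
    quadSymbol i j z w (dispersion ![c, -2 * c] f + evolve (hsQuad p r) f) =
      ((![c, -2 * c] : Fin 2 → 𝕜) i * z ^ 3 + (![c, -2 * c] : Fin 2 → 𝕜) j * w ^ 3) *
        quadSymbol i j z w f +
      (quadSymbol i j z w (hsQuad p r 0) * linSymbol 0 (z + w) f +
        quadSymbol i j z w (hsQuad p r 1) * linSymbol 1 (z + w) f) := by
  simp only [quadSymbol, linSymbol, map_add]
  rw [constantCoeff_jetShift_jetShift_dispersion, constantCoeff_jetShift_jetShift_evolve _ _ _ _
    (constantCoeff_hsQuad p r) (fun i k z => constantCoeff_jetShift_hsQuad p r i k z)]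

lemma linSymbol_flow (c p r : 𝕜) (i : Fin 2) (z : 𝕜) (f : Jet 𝕜) :
    linSymbol i z (dispersion ![c, -2 * c] f + evolve (hsQuad p r) f) =
      (![c, -2 * c] : Fin 2 → 𝕜) i * z ^ 3 * linSymbol i z f := by
  simp only [linSymbol, map_add]
  rw [constantCoeff_jetShift_evolve _ _ (constantCoeff_hsQuad p r), jetShift_dispersion]
  simp [constantCoeff_dispersion, constantCoeff_jetShift_hsQuad]

lemma linSymbol_totalD (i : Fin 2) (z : 𝕜) (f : Jet 𝕜) :
    linSymbol i z (totalD 𝕜 f) = z * linSymbol i z f := by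
  simp [linSymbol, jetShift_totalD]

lemma quadSymbol_totalD (i j : Fin 2) (z w : 𝕜) (f : Jet 𝕜) :
    quadSymbol i j z w (totalD 𝕜 f) = (z + w) * quadSymbol i j z w f := by
  simp [quadSymbol, jetShift_totalD]
  ring

lemma quadSymbol_X_mul (i j : Fin 2) (z w : 𝕜) (k : Fin 2) (m : ℕ) (f : Jet 𝕜) :
    quadSymbol i j z w (MvPolynomial.X (k, m) * f) =
      (if k = i then z ^ m * linSymbol j w f else 0) +
        (if k = j then w ^ m * linSymbol i z f else 0) := by
  simp only [quadSymbol, linSymbol, Derivation.leibniz, map_add, smul_eq_mul, jetShift_X, map_mul,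
    MvPolynomial.constantCoeff_X, zero_mul, zero_add]
  split_ifs <;> simp <;> ring

lemma linSymbol_X_mul (i : Fin 2) (z : 𝕜) (k : Fin 2) (m : ℕ) {f : Jet 𝕜}
    (hf : MvPolynomial.constantCoeff f = 0) :
    linSymbol i z (MvPolynomial.X (k, m) * f) = 0 := by
  simp [linSymbol, hf]

lemma linSymbol_X (i : Fin 2) (z : 𝕜) (k : Fin 2) (m : ℕ) :
    linSymbol i z (MvPolynomial.X (k, m) : Jet 𝕜) = if k = i then z ^ m else 0 := by
  simp only [linSymbol, jetShift_X]; split_ifs <;> simp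

lemma linSymbol_add (i : Fin 2) (z : 𝕜) (f g : Jet 𝕜) :
    linSymbol i z (f + g) = linSymbol i z f + linSymbol i z g := by simp [linSymbol]

lemma linSymbol_sub (i : Fin 2) (z : 𝕜) (f g : Jet 𝕜) :
    linSymbol i z (f - g) = linSymbol i z f - linSymbol i z g := by simp [linSymbol]

lemma linSymbol_smul (i : Fin 2) (z s : 𝕜) (f : Jet 𝕜) :
    linSymbol i z (s • f) = s * linSymbol i z f := by simp [linSymbol]

lemma quadSymbol_add (i j : Fin 2) (z w : 𝕜) (f g : Jet 𝕜) :
    quadSymbol i j z w (f + g) = quadSymbol i j z w f + quadSymbol i j z w g := by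
  simp [quadSymbol]

lemma quadSymbol_sub (i j : Fin 2) (z w : 𝕜) (f g : Jet 𝕜) :
    quadSymbol i j z w (f - g) = quadSymbol i j z w f - quadSymbol i j z w g := by
  simp [quadSymbol]

lemma quadSymbol_neg (i j : Fin 2) (z w : 𝕜) (f : Jet 𝕜) :
    quadSymbol i j z w (-f) = -quadSymbol i j z w f := by
  simp [quadSymbol]

lemma quadSymbol_smul (i j : Fin 2) (z w s : 𝕜) (f : Jet 𝕜) :
    quadSymbol i j z w (s • f) = s * quadSymbol i j z w f := by simp [quadSymbol]

lemma quadSymbol_comm (i j : Fin 2) (z w : 𝕜) (f : Jet 𝕜) :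
    quadSymbol i j z w f = quadSymbol j i w z f := by
  simp only [quadSymbol, jetShift_comm i j]

lemma quadSymbol_hsQuad_zero (p r : 𝕜) (i j : Fin 2) (z w : 𝕜) :
    quadSymbol i j z w (hsQuad p r 0) =
      if i = j then (if i = 0 then p * (z + w) else r * (z + w)) else 0 := by
  simp only [hsQuad, Matrix.cons_val_zero, quadSymbol_add, quadSymbol_smul, quadSymbol_X_mul,
    linSymbol_X]
  fin_cases i <;> fin_cases j <;> simp [-mul_eq_mul_left_iff] <;> ring

lemma quadSymbol_hsQuad_one (p r : 𝕜) (i j : Fin 2) (z w : 𝕜) :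
    quadSymbol i j z w (hsQuad p r 1) =
      if i = j then 0 else (if i = 0 then -(p * w) else -(p * z)) := by
  change quadSymbol i j z w (-(p • (MvPolynomial.X (0, 0) * MvPolynomial.X (1, 1)))) = _
  simp only [quadSymbol_neg, quadSymbol_smul, quadSymbol_X_mul, linSymbol_X]
  fin_cases i <;> fin_cases j <;> simp

lemma linSymbol_eq_zero_of_ne [CharZero 𝕜] {i : Fin 2} {f : Jet 𝕜}
    (h : ∀ z, z ≠ 0 → linSymbol i z f = 0) (z : 𝕜) : linSymbol i z f = 0 :=
  jetShift_of_pderiv (constantCoeff_pderiv_eq_zero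
    ((Set.Finite.infinite_compl (Set.finite_singleton 0)).mono fun z hz => h z hz)) z

/-- Comparison of the quadratic terms of the linearized equation. Where the dispersion factor on the
left vanishes (a resonance), the linear symbols must satisfy a relation. -/
lemma IsHSSymmetry.quad_zero (hK : IsHSSymmetry c p r K) (i j : Fin 2) (z w : 𝕜) :
    ((![c, -2 * c] : Fin 2 → 𝕜) i * z ^ 3 + (![c, -2 * c] : Fin 2 → 𝕜) j * w ^ 3 -
        c * (z + w) ^ 3) * quadSymbol i j z w (K 0) =
      (if i = 0 then p * (z + w) * linSymbol j w (K 0) else r * (z + w) * linSymbol j w (K 1)) +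
      (if j = 0 then p * (z + w) * linSymbol i z (K 0) else r * (z + w) * linSymbol i z (K 1)) -
      (if i = j then (if i = 0 then p * (z + w) else r * (z + w)) else 0) *
        linSymbol 0 (z + w) (K 0) +
      (if i = j then 0 else (if i = 0 then p * w else p * z)) * linSymbol 1 (z + w) (K 0) := by
  have h := congrArg (quadSymbol i j z w) ((isHSSymmetry_iff c p r K).mp hK).1
  rw [quadSymbol_flow] at h
  simp only [quadSymbol_add, quadSymbol_smul, quadSymbol_totalD,
    quadSymbol_X_mul, linSymbol_totalD, quadSymbol_hsQuad_zero, quadSymbol_hsQuad_one] at h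
  fin_cases i <;> fin_cases j <;> simp at h ⊢ <;> linear_combination h

lemma IsHSSymmetry.quad_one (hK : IsHSSymmetry c p r K) (z w : 𝕜) :
    (c * z ^ 3 - 2 * c * w ^ 3 + 2 * c * (z + w) ^ 3) * quadSymbol 0 1 z w (K 1) =
      -(p * w * (linSymbol 1 w (K 1) + linSymbol 0 z (K 0) - linSymbol 1 (z + w) (K 1))) := by
  have h := congrArg (quadSymbol 0 1 z w) ((isHSSymmetry_iff c p r K).mp hK).2
  rw [quadSymbol_flow] at h
  simp only [quadSymbol_sub, quadSymbol_add, quadSymbol_smul, quadSymbol_totalD,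
    quadSymbol_X_mul, linSymbol_totalD, quadSymbol_hsQuad_zero, quadSymbol_hsQuad_one] at h
  simp at h
  linear_combination h

lemma IsHSSymmetry.linSymbol_at_zero (hp : p ≠ 0) (hK : IsHSSymmetry c p r K) :
    linSymbol 0 0 (K 0) = 0 := by
  -- At (1, 0) the dispersion factor vanishes and the symbols at 1 cancel, leaving p times the
  -- symbol at 0.
  have h := hK.quad_zero 0 0 1 0
  simp at h
  exact h.resolve_left hp

variable [CharZero 𝕜]

/-- The two dispersion constants c and -2c differ, so the linear part of a symmetry cannot mix the
two curvatures. -/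
lemma IsHSSymmetry.linSymbol_one_zero (hc : c ≠ 0) (hK : IsHSSymmetry c p r K)
    (h0 : ∀ i, MvPolynomial.constantCoeff (K i) = 0) (z : 𝕜) : linSymbol 1 z (K 0) = 0 := by
  refine linSymbol_eq_zero_of_ne (fun z hz => ?_) z
  have h := congrArg (linSymbol 1 z) ((isHSSymmetry_iff c p r K).mp hK).1
  rw [linSymbol_flow] at h
  simp only [linSymbol_add, linSymbol_smul, linSymbol_totalD,
    linSymbol_X_mul 1 z _ _ (constantCoeff_totalD _), linSymbol_X_mul 1 z _ _ (h0 _)] at h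
  simp at h
  have h2 : (-3 * c * z ^ 3) * linSymbol 1 z (K 0) = 0 := by linear_combination h
  exact (mul_eq_zero.mp h2).resolve_left
    (mul_ne_zero (mul_ne_zero (by norm_num) hc) (pow_ne_zero _ hz))

lemma IsHSSymmetry.linSymbol_zero_one (hc : c ≠ 0) (hK : IsHSSymmetry c p r K)
    (h0 : ∀ i, MvPolynomial.constantCoeff (K i) = 0) (z : 𝕜) : linSymbol 0 z (K 1) = 0 := by
  refine linSymbol_eq_zero_of_ne (fun z hz => ?_) z
  have h := congrArg (linSymbol 0 z) ((isHSSymmetry_iff c p r K).mp hK).2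
  rw [linSymbol_flow] at h
  simp only [linSymbol_add, linSymbol_sub, linSymbol_smul, linSymbol_totalD,
    linSymbol_X_mul 0 z _ _ (constantCoeff_totalD _), linSymbol_X_mul 0 z _ _ (h0 _)] at h
  simp at h
  have h2 : (3 * c * z ^ 3) * linSymbol 0 z (K 1) = 0 := by linear_combination h
  exact (mul_eq_zero.mp h2).resolve_left
    (mul_ne_zero (mul_ne_zero (by norm_num) hc) (pow_ne_zero _ hz))

end Symbols

end HirotaSatsuma

/-! ### Complexification. -/

section BaseChange

/-- Complexification of differential polynomials. -/
noncomputable def toComplex : DiffPoly →+* Jet ℂ := MvPolynomial.map Complex.ofRealHom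

lemma toComplex_smul (s : ℝ) (f : DiffPoly) : toComplex (s • f) = (s : ℂ) • toComplex f := by
  simp [toComplex, MvPolynomial.smul_eq_C_mul]

lemma toComplex_derivation {d : Derivation ℝ DiffPoly DiffPoly}
    {d' : Derivation ℂ (Jet ℂ) (Jet ℂ)}
    (h : ∀ j, toComplex (d (MvPolynomial.X j)) = d' (MvPolynomial.X j)) (f : DiffPoly) :
    toComplex (d f) = d' (toComplex f) := by
  have hX : ∀ j, toComplex (MvPolynomial.X j) = MvPolynomial.X j := fun j => by simp [toComplex]
  induction f using MvPolynomial.induction_on with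
  | C r => simp [toComplex]
  | add p q hp hq => simp [hp, hq]
  | mul_X p j hp => simp [hp, h, hX]

lemma toComplex_X (j : Fin 2 × ℕ) : toComplex (MvPolynomial.X j) = MvPolynomial.X j := by
  simp [toComplex]

lemma toComplex_totalD (f : DiffPoly) : toComplex (totalD ℝ f) = totalD ℂ (toComplex f) :=
  toComplex_derivation (fun j => by simp [toComplex_X]) f

lemma toComplex_evolve (F : Fin 2 → DiffPoly) (f : DiffPoly) :
    toComplex (evolve F f) = evolve (fun i => toComplex (F i)) (toComplex f) := by
  refine toComplex_derivation (fun j => ?_) f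
  rw [evolve_X, evolve_X]
  exact (Function.Semiconj.iterate_right (f := toComplex) toComplex_totalD j.2) _

lemma linSymbol_toComplex (i : Fin 2) (z : ℝ) (f : DiffPoly) :
    linSymbol i (z : ℂ) (toComplex f) = (linSymbol i z f : ℝ) := by
  rw [linSymbol, ← toComplex_derivation (d := jetShift i z)]
  · simp [toComplex, linSymbol, MvPolynomial.constantCoeff_map]
  · intro j
    rw [jetShift_X, jetShift_X]
    split_ifs <;> simp [toComplex]

lemma IsHSSymmetry.toComplex {c p r : ℝ} {K : Fin 2 → DiffPoly} (hK : IsHSSymmetry c p r K) :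
    IsHSSymmetry (c : ℂ) p r fun i => NullCurve.toComplex (K i) := by
  have hF : ∀ i, NullCurve.toComplex (hsField c p r i) = hsField (c : ℂ) p r i := by
    intro i
    fin_cases i <;>
      simp [hsField, hsQuad, toComplex_smul, toComplex_X]
  intro i
  have h := congrArg NullCurve.toComplex (hK i)
  rw [toComplex_evolve, toComplex_evolve] at h
  simpa only [hF] using h

end BaseChange

/-! ### Oddness of the linear symbols. -/

section Parity

/-- The linear symbols of a symmetry of the Hirota-Satsuma system are odd (complex version). -/
lemma IsHSSymmetry.linSymbol_odd_complex {c p r : ℂ} (hp : p ≠ 0) (hr : r ≠ 0)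
    {K : Fin 2 → Jet ℂ} (hK : IsHSSymmetry c p r K) {z : ℂ} (hz : z ≠ 0) :
    linSymbol 1 (-z) (K 1) = -linSymbol 1 z (K 1) ∧
      linSymbol 0 ((1 + Complex.I) * (-z)) (K 0) = -linSymbol 0 ((1 + Complex.I) * z) (K 0) := by
  have hI := Complex.I_sq
  have h1I : (1 + Complex.I) ≠ 0 := fun h => by simpa using congrArg Complex.re h
  -- The dispersion factor for i = j = 1 is -3c(z + w)(z² + w²), which vanishes at (w, iw).
  have key1 : ∀ w : ℂ, w ≠ 0 → linSymbol 0 ((1 + Complex.I) * w) (K 0) =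
      linSymbol 1 w (K 1) + linSymbol 1 (Complex.I * w) (K 1) := by
    intro w hw
    have h := hK.quad_zero 1 1 w (Complex.I * w)
    simp at h
    have h2 : r * ((1 + Complex.I) * w) * (linSymbol 1 w (K 1) +
        linSymbol 1 (Complex.I * w) (K 1) - linSymbol 0 (w + Complex.I * w) (K 0)) = 0 := by
      linear_combination (-1 : ℂ) * h + (-3 * c * w ^ 3 * (1 + Complex.I) *
        quadSymbol 1 1 w (Complex.I * w) (K 0)) * hI
    have h3 := (mul_eq_zero.mp h2).resolve_left (mul_ne_zero hr (mul_ne_zero h1I hw))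
    rw [show (1 + Complex.I) * w = w + Complex.I * w by ring]
    linear_combination (-1 : ℂ) * h3
  -- The dispersion factor in `quad_one` is 3cz((z + w)² + w²); it vanishes for z = -(1 + i)w, where
  -- z + w = -iw.
  have key2 : ∀ w : ℂ, w ≠ 0 → linSymbol 0 ((1 + Complex.I) * (-w)) (K 0) =
      linSymbol 1 (-(Complex.I * w)) (K 1) - linSymbol 1 w (K 1) := by
    intro w hw
    have h := hK.quad_one ((1 + Complex.I) * (-w)) w
    have h2 : p * w * (linSymbol 1 w (K 1) + linSymbol 0 ((1 + Complex.I) * (-w)) (K 0) -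
        linSymbol 1 ((1 + Complex.I) * (-w) + w) (K 1)) = 0 := by
      linear_combination h - (-3 * c * w ^ 3 * (1 + Complex.I) *
        quadSymbol 0 1 ((1 + Complex.I) * (-w)) w (K 1)) * hI
    have h3 := (mul_eq_zero.mp h2).resolve_left (mul_ne_zero hp hw)
    rw [show (1 + Complex.I) * (-w) + w = -(Complex.I * w) by ring] at h3
    linear_combination h3
  -- `key1` at -w and `key2` at w evaluate the same symbol of `K 0`.
  have odd : ∀ w : ℂ, w ≠ 0 → linSymbol 1 (-w) (K 1) = -linSymbol 1 w (K 1) := by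
    intro w hw
    have a2 := key1 (-w) (neg_ne_zero.mpr hw)
    rw [mul_neg Complex.I] at a2
    linear_combination key2 w hw - a2
  refine ⟨odd z hz, ?_⟩
  have a2 := key1 (-z) (neg_ne_zero.mpr hz)
  rw [mul_neg Complex.I] at a2
  linear_combination key1 z hz + a2 + odd z hz + odd (Complex.I * z) (mul_ne_zero Complex.I_ne_zero hz)

lemma IsHSSymmetry.linSymbol_odd {c p r : ℝ} (hp : p ≠ 0) (hr : r ≠ 0) {K : Fin 2 → DiffPoly}
    (hK : IsHSSymmetry c p r K) {z : ℝ} (hz : z ≠ 0) :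
    linSymbol 0 (-z) (K 0) = -linSymbol 0 z (K 0) ∧
      linSymbol 1 (-z) (K 1) = -linSymbol 1 z (K 1) := by
  have h := fun w hw => hK.toComplex.linSymbol_odd_complex (Complex.ofReal_ne_zero.mpr hp)
    (Complex.ofReal_ne_zero.mpr hr) (z := w) hw
  have hz' : (z : ℂ) ≠ 0 := Complex.ofReal_ne_zero.mpr hz
  have h1I : (1 + Complex.I) ≠ 0 := fun h => by simpa using congrArg Complex.re h
  constructor
  -- The point is chosen so that multiplication by 1 + i returns the real number z.
  · have h2 := (h ((1 + Complex.I)⁻¹ * z) (mul_ne_zero (inv_ne_zero h1I) hz')).2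
    rw [mul_neg, mul_inv_cancel_left₀ h1I, ← Complex.ofReal_neg, linSymbol_toComplex,
      linSymbol_toComplex] at h2
    exact_mod_cast h2
  · have h2 := (h z hz').1
    rw [← Complex.ofReal_neg, linSymbol_toComplex, linSymbol_toComplex] at h2
    exact_mod_cast h2

end Parity

/-! ### Densities attached to a symmetry are total derivatives. -/

section SymmetryDensities

variable {c p r : ℝ} {K : Fin 2 → DiffPoly}

lemma continuous_linSymbol (i : Fin 2) (f : DiffPoly) : Continuous fun z : ℝ => linSymbol i z f := by
  have h : (fun z : ℝ => linSymbol i z f) =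
      fun z => ((symbolDer i f).map MvPolynomial.constantCoeff).eval z := by
    ext1 z
    have := Polynomial.eval_map_apply (p := symbolDer i f) MvPolynomial.constantCoeff
      (MvPolynomial.C z)
    rw [MvPolynomial.constantCoeff_C, eval_symbolDer] at this
    exact this.symm
  rw [h]
  exact Polynomial.continuous _

lemma continuous_quadSymbol (i j : Fin 2) (z : ℝ) (f : DiffPoly) :
    Continuous fun w : ℝ => quadSymbol i j z w f := by
  simp only [quadSymbol_comm i j z _ f]
  exact continuous_linSymbol j (jetShift i z f)

/-- Cancels the factor z + w and then evaluates at its zero, by density and continuity. -/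
lemma eq_zero_of_add_mul {R : ℝ → ℝ} (hR : Continuous R) {z : ℝ}
    (h : ∀ w, (z + w) * R w = 0) : R (-z) = 0 := by
  refine congrFun (hR.ext_on (dense_compl_singleton (-z)) (g := fun _ => 0) continuous_const
    fun w hw => ?_) (-z)
  exact (mul_eq_zero.mp (h w)).resolve_left fun h0 => hw (by
    rw [Set.mem_singleton_iff]; linarith)

lemma IsHSSymmetry.quadSymbol_zero_zero (hc : c ≠ 0) (hp : p ≠ 0) (hr : r ≠ 0)
    (hK : IsHSSymmetry c p r K) {z : ℝ} (hz : z ≠ 0) : quadSymbol 0 0 z (-z) (K 0) = 0 := by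
  -- Since z³ + w³ - (z + w)³ = -3zw(z + w), the whole relation is divisible by z + w. At w = -z the
  -- quotient contains only the wanted symbol, because the linear symbols are odd and vanish at 0.
  have h := eq_zero_of_add_mul (z := z) (R := fun w => 3 * c * z * w * quadSymbol 0 0 z w (K 0) +
    p * (linSymbol 0 z (K 0) + linSymbol 0 w (K 0) - linSymbol 0 (z + w) (K 0))) (by
      have h1 := continuous_linSymbol 0 (K 0)
      have h2 := continuous_quadSymbol 0 0 z (K 0)
      have h3 : Continuous fun w : ℝ => linSymbol 0 (z + w) (K 0) :=
        h1.comp (continuous_const.add continuous_id)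
      fun_prop) (fun w => by
      have h1 := hK.quad_zero 0 0 z w
      simp only [Matrix.cons_val_zero, if_true] at h1
      linear_combination -h1)
  simp only [add_neg_cancel, hK.linSymbol_at_zero hp, (hK.linSymbol_odd hp hr hz).1] at h
  have h2 : (3 * c * z ^ 2) * quadSymbol 0 0 z (-z) (K 0) = 0 := by linear_combination -h
  exact (mul_eq_zero.mp h2).resolve_left
    (mul_ne_zero (mul_ne_zero (by norm_num) hc) (pow_ne_zero _ hz))

lemma IsHSSymmetry.quadSymbol_one_one (hc : c ≠ 0) (hp : p ≠ 0) (hr : r ≠ 0)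
    (hK : IsHSSymmetry c p r K) {z : ℝ} (hz : z ≠ 0) : quadSymbol 1 1 z (-z) (K 0) = 0 := by
  have h := eq_zero_of_add_mul (z := z) (R := fun w =>
    3 * c * (z ^ 2 + w ^ 2) * quadSymbol 1 1 z w (K 0) +
    r * (linSymbol 1 z (K 1) + linSymbol 1 w (K 1) - linSymbol 0 (z + w) (K 0))) (by
      have h1 := continuous_linSymbol 0 (K 0)
      have h4 := continuous_linSymbol 1 (K 1)
      have h2 := continuous_quadSymbol 1 1 z (K 0)
      have h3 : Continuous fun w : ℝ => linSymbol 0 (z + w) (K 0) :=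
        h1.comp (continuous_const.add continuous_id)
      fun_prop) (fun w => by
      have h1 := hK.quad_zero 1 1 z w
      simp at h1
      linear_combination -h1)
  simp only [add_neg_cancel, hK.linSymbol_at_zero hp, (hK.linSymbol_odd hp hr hz).2] at h
  have h2 : (6 * c * z ^ 2) * quadSymbol 1 1 z (-z) (K 0) = 0 := by linear_combination h
  exact (mul_eq_zero.mp h2).resolve_left
    (mul_ne_zero (mul_ne_zero (by norm_num) hc) (pow_ne_zero _ hz))

lemma IsHSSymmetry.quadSymbol_zero_one (hc : c ≠ 0) (hK : IsHSSymmetry c p r K)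
    (h0 : ∀ i, MvPolynomial.constantCoeff (K i) = 0) {z : ℝ} (hz : z ≠ 0) :
    quadSymbol 0 1 z (-z) (K 0) = 0 := by
  have h := hK.quad_zero 0 1 z (-z)
  simp [hK.linSymbol_one_zero hc h0] at h
  refine h.resolve_left fun h2 => ?_
  have h3 : (3 * c * z ^ 3) = 0 := by linear_combination h2
  exact mul_ne_zero (mul_ne_zero (by norm_num) hc) (pow_ne_zero _ hz) h3

lemma constantCoeff_pderiv_euler_of_quadSymbol {i j : Fin 2} {f : DiffPoly}
    (h : ∀ z : ℝ, z ≠ 0 → quadSymbol j i z (-z) f = 0) (m : ℕ) :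
    MvPolynomial.constantCoeff (MvPolynomial.pderiv (j, m) (euler i f)) = 0 :=
  constantCoeff_pderiv_eq_zero ((Set.Finite.infinite_compl (Set.finite_singleton 0)).mono
    fun z hz => (constantCoeff_jetShift_euler i j z f).trans (h z hz)) m

/-- A symmetry of the Hirota-Satsuma system is conservative with respect to the densities `u` and
`q u² + s v²`. -/
theorem IsHSSymmetry.exists_totalD_eq (hc : c ≠ 0) (hp : p ≠ 0) (hr : r ≠ 0)
    (hK : IsHSSymmetry c p r K) (h0 : ∀ i, MvPolynomial.constantCoeff (K i) = 0) (q s : ℝ)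
    (hcons : ∃ g, evolve (hsField c p r) (q • (MvPolynomial.X (0, 0) * K 0) +
      s • (MvPolynomial.X (1, 0) * K 1)) = totalD ℝ g)
    (hcons' : ∃ g, evolve (hsField c p r) (K 0) = totalD ℝ g) :
    (∃ g, totalD ℝ g = K 0) ∧ (∃ g, totalD ℝ g = q • (MvPolynomial.X (0, 0) * K 0) +
      s • (MvPolynomial.X (1, 0) * K 1)) := by
  have hl : ∀ i, (![c, -2 * c] : Fin 2 → ℝ) i ≠ 0 := by
    intro i; fin_cases i <;> simp [hc]
  have hl10 := hK.linSymbol_one_zero hc h0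
  have hl01 := hK.linSymbol_zero_one hc h0
  have hl00 := hK.linSymbol_at_zero hp
  simp only [evolve_hsField] at hcons hcons'
  constructor
  · refine exists_totalD_eq_of_conserved hl (isHomogeneous_hsQuad p r) (h0 0) hcons' (fun i => ?_)
      fun i j => ?_
    · rw [constantCoeff_euler]
      fin_cases i
      · exact hl00
      · exact hl10 0
    · obtain ⟨j, m⟩ := j
      refine constantCoeff_pderiv_euler_of_quadSymbol (fun z hz => ?_) m
      fin_cases i <;> fin_cases j
      · exact hK.quadSymbol_zero_zero hc hp hr hz
      · change quadSymbol 1 0 z (-z) (K 0) = 0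
        have := hK.quadSymbol_zero_one hc h0 (neg_ne_zero.mpr hz)
        rwa [neg_neg, quadSymbol_comm] at this
      · exact hK.quadSymbol_zero_one hc h0 hz
      · exact hK.quadSymbol_one_one hc hp hr hz
  · refine exists_totalD_eq_of_conserved hl (isHomogeneous_hsQuad p r) (by simp) hcons
      (fun i => ?_) fun i j => ?_
    · rw [constantCoeff_euler]
      change linSymbol i 0 _ = 0
      rw [linSymbol_add, linSymbol_smul, linSymbol_smul, linSymbol_X_mul _ _ _ _ (h0 0),
        linSymbol_X_mul _ _ _ _ (h0 1)]
      ring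
    · obtain ⟨j, m⟩ := j
      refine constantCoeff_pderiv_euler_of_quadSymbol (fun z hz => ?_) m
      -- At (z, -z) the quadratic symbol of this density is a combination of sums of linear symbols
      -- at z and -z, which cancel by oddness.
      have ho := hK.linSymbol_odd hp hr hz
      rw [quadSymbol_add, quadSymbol_smul, quadSymbol_smul, quadSymbol_X_mul, quadSymbol_X_mul]
      fin_cases i <;> fin_cases j <;> simp [ho.1, ho.2, hl10, hl01]

end SymmetryDensities

/-! ### Frame components of the geometric operators. -/

section Components

open MvPolynomial (C)

lemma D_eq_totalD : D = totalD ℝ := rfl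

lemma covT_zero (a ε₁ ε₂ : ℝ) (V : VecField) :
    covT a ε₁ ε₂ V 0 = D (V 0) - k₁ * V 1 + k₂ * V 3 := by
  simp [covT, Fin.sum_univ_four, frame, covFrame, T, W₁, N, W₂]
  ring

lemma covT_one (a ε₁ ε₂ : ℝ) (V : VecField) :
    covT a ε₁ ε₂ V 1 = D (V 1) + C a * V 0 - C ε₁ * k₁ * V 2 := by
  simp [covT, Fin.sum_univ_four, frame, covFrame, T, W₁, N, W₂, MvPolynomial.smul_eq_C_mul]
  ring

lemma covT_two (a ε₁ ε₂ : ℝ) (V : VecField) :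
    covT a ε₁ ε₂ V 2 = D (V 2) + C a * C ε₁ * V 1 := by
  simp [covT, Fin.sum_univ_four, frame, covFrame, T, W₁, N, W₂, MvPolynomial.smul_eq_C_mul]
  ring

lemma covT_three (a ε₁ ε₂ : ℝ) (V : VecField) :
    covT a ε₁ ε₂ V 3 = D (V 3) + C ε₂ * k₂ * V 2 := by
  simp [covT, Fin.sum_univ_four, frame, covFrame, T, W₁, N, W₂, MvPolynomial.smul_eq_C_mul]
  ring

lemma metric_T (ε₁ ε₂ : ℝ) (U : VecField) : metric ε₁ ε₂ U T = -U 2 := by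
  simp [metric, T]

lemma metric_W₁ (ε₁ ε₂ : ℝ) (U : VecField) : metric ε₁ ε₂ U W₁ = ε₁ • U 1 := by
  simp [metric, W₁]

lemma metric_W₂ (ε₁ ε₂ : ℝ) (U : VecField) : metric ε₁ ε₂ U W₂ = ε₂ • U 3 := by
  simp [metric, W₂]

variable {a ε₁ ε₂ : ℝ}

lemma phi_eq (hε₁ : ε₁ * ε₁ = 1) (V : VecField) : phi a ε₁ ε₂ V = covT a ε₁ ε₂ V 1 := by
  rw [phi, metric_W₁, smul_smul, hε₁, one_smul]

lemma psi_eq (hε₂ : ε₂ * ε₂ = 1) (V : VecField) : psi a ε₁ ε₂ V = covT a ε₁ ε₂ V 3 := by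
  rw [psi, metric_W₂, smul_smul, hε₂, one_smul]

lemma C_mul_self {s : ℝ} (hs : s * s = 1) : (C s : DiffPoly) * C s = 1 := by
  rw [← map_mul, hs, map_one]

lemma C_mul_C_inv (ha : a ≠ 0) : (C a : DiffPoly) * C a⁻¹ = 1 := by
  rw [← map_mul, mul_inv_cancel₀ ha, map_one]

lemma isEvolution_iff (hε₁ : ε₁ * ε₁ = 1) (V : VecField) :
    IsEvolution a ε₁ ε₂ V ↔ covT a ε₁ ε₂ V 2 = 0 ∧
      D (covT a ε₁ ε₂ V 1) + C a * covT a ε₁ ε₂ V 0 = 0 := by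
  have h0 : ε₁ ≠ 0 := fun h => by simp [h] at hε₁
  rw [IsEvolution, metric_T, metric_W₁, neg_eq_zero, smul_eq_zero, or_iff_right h0]
  refine and_congr_right fun h => ?_
  rw [covT_one a ε₁ ε₂ (covT a ε₁ ε₂ V), h, mul_zero, sub_zero]

lemma IsEvolution.rho_eq_zero {V : VecField} (hV : IsEvolution a ε₁ ε₂ V) :
    rho a ε₁ ε₂ V = 0 := by
  rw [rho, hV.2, smul_zero, neg_zero]

/-- This and the next three formulas express the derivatives of the components through φ, ψ and the
components themselves, which eliminates them from the bracket computations. -/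
lemma IsEvolution.D_zero (ha : a ≠ 0) (hε₁ : ε₁ * ε₁ = 1) {V : VecField}
    (hV : IsEvolution a ε₁ ε₂ V) :
    D (V 0) = k₁ * V 1 - k₂ * V 3 - C a⁻¹ * D (phi a ε₁ ε₂ V) := by
  have h := ((isEvolution_iff hε₁ V).mp hV).2
  rw [← phi_eq hε₁, covT_zero] at h
  linear_combination C a⁻¹ * h - (D (V 0) - k₁ * V 1 + k₂ * V 3) * C_mul_C_inv ha

lemma D_one_eq (hε₁ : ε₁ * ε₁ = 1) (V : VecField) :
    D (V 1) = phi a ε₁ ε₂ V - C a * V 0 + C ε₁ * k₁ * V 2 := by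
  rw [phi_eq hε₁, covT_one]; ring

lemma IsEvolution.D_two (hε₁ : ε₁ * ε₁ = 1) {V : VecField} (hV : IsEvolution a ε₁ ε₂ V) :
    D (V 2) = -(C a * C ε₁ * V 1) := by
  have h := ((isEvolution_iff hε₁ V).mp hV).1
  rw [covT_two] at h
  linear_combination h

lemma D_three_eq (hε₂ : ε₂ * ε₂ = 1) (V : VecField) :
    D (V 3) = psi a ε₁ ε₂ V - C ε₂ * k₂ * V 2 := by
  rw [psi_eq hε₂, covT_three]; ring

lemma IsEvolution.alpha_eq {V : VecField} (hV : IsEvolution a ε₁ ε₂ V) :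
    alpha a ε₁ ε₂ V = C a⁻¹ * D (phi a ε₁ ε₂ V) := by
  rw [alpha, hV.rho_eq_zero, smul_zero, add_zero, one_div, MvPolynomial.smul_eq_C_mul]

lemma IsEvolution.beta_eq {V : VecField} (hV : IsEvolution a ε₁ ε₂ V) :
    beta a ε₁ ε₂ V = C a⁻¹ * (C a⁻¹ * D (D (phi a ε₁ ε₂ V)) + k₁ * phi a ε₁ ε₂ V -
      k₂ * psi a ε₁ ε₂ V) := by
  rw [beta, hV.alpha_eq, one_div, MvPolynomial.smul_eq_C_mul, Derivation.leibniz,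
    MvPolynomial.derivation_C, smul_zero, add_zero, smul_eq_mul]

lemma delta_eq (V : VecField) :
    delta a ε₁ ε₂ V = C a⁻¹ * D (D (psi a ε₁ ε₂ V)) + k₁ * psi a ε₁ ε₂ V +
      C ε₁ * C ε₂ * (k₂ * phi a ε₁ ε₂ V) := by
  rw [delta, one_div, MvPolynomial.smul_eq_C_mul, MvPolynomial.smul_eq_C_mul, map_mul]

lemma IsEvolution.varK₁_eq {V : VecField} (hV : IsEvolution a ε₁ ε₂ V) :
    varK₁ a ε₁ ε₂ V = C a⁻¹ * (C a⁻¹ * D (D (D (phi a ε₁ ε₂ V))) + 2 * k₁ * D (phi a ε₁ ε₂ V) +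
      D k₁ * phi a ε₁ ε₂ V - 2 * k₂ * D (psi a ε₁ ε₂ V) - D k₂ * psi a ε₁ ε₂ V) := by
  simp only [varK₁, hV.rho_eq_zero, theta, opS, one_div, MvPolynomial.smul_eq_C_mul, map_zero,
    mul_zero, add_zero, Derivation.leibniz, smul_eq_mul]
  ring

lemma IsEvolution.varK₂_eq {V : VecField} (hV : IsEvolution a ε₁ ε₂ V) :
    varK₂ a ε₁ ε₂ V = C a⁻¹ * (2 * k₂ * D (phi a ε₁ ε₂ V) + D k₂ * phi a ε₁ ε₂ V) +
      C ε₁ * C ε₂ * C a⁻¹ * (C a⁻¹ * D (D (D (psi a ε₁ ε₂ V))) + 2 * k₁ * D (psi a ε₁ ε₂ V) +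
      D k₁ * psi a ε₁ ε₂ V) := by
  simp only [varK₂, hV.rho_eq_zero, theta, opS, div_eq_mul_inv,
    MvPolynomial.smul_eq_C_mul, map_mul, mul_zero, add_zero, Derivation.leibniz,
    smul_eq_mul, one_mul]
  ring

lemma IsEvolution.act_eq {V : VecField} (hV : IsEvolution a ε₁ ε₂ V) :
    act a ε₁ ε₂ V = evolve ![varK₁ a ε₁ ε₂ V, varK₂ a ε₁ ε₂ V] := by
  refine MvPolynomial.derivation_ext fun j => ?_
  obtain ⟨i, m⟩ := j
  rw [act, MvPolynomial.mkDerivation_X, evolve_X]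
  induction m with
  | zero => fin_cases i <;> simp [varJet]
  | succ m ih =>
    simp only [varJet, hV.rho_eq_zero, zero_mul, smul_zero, add_zero,
      Function.iterate_succ_apply']
    exact congrArg (totalD ℝ) ih

lemma act_k₁ (V : VecField) : act a ε₁ ε₂ V k₁ = varK₁ a ε₁ ε₂ V := by
  simp [act, k₁, varJet]

lemma act_k₂ (V : VecField) : act a ε₁ ε₂ V k₂ = varK₂ a ε₁ ε₂ V := by
  simp [act, k₂, varJet]

lemma IsEvolution.act_D {V : VecField} (hV : IsEvolution a ε₁ ε₂ V) (f : DiffPoly) :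
    act a ε₁ ε₂ V (D f) = D (act a ε₁ ε₂ V f) := by
  rw [hV.act_eq]; exact evolve_totalD _ _

lemma tensorD_zero (V U : VecField) :
    tensorD a ε₁ ε₂ V U 0 = act a ε₁ ε₂ V (U 0) - alpha a ε₁ ε₂ V * U 0 - beta a ε₁ ε₂ V * U 1 +
      C ε₁ * C ε₂ * C a⁻¹ * delta a ε₁ ε₂ V * U 3 := by
  simp [tensorD, Fin.sum_univ_four, frame, tensorFrame, T, W₁, N, W₂, div_eq_mul_inv,
    MvPolynomial.smul_eq_C_mul]
  ring

lemma tensorD_one (V U : VecField) :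
    tensorD a ε₁ ε₂ V U 1 = act a ε₁ ε₂ V (U 1) + phi a ε₁ ε₂ V * U 0 -
      C ε₁ * beta a ε₁ ε₂ V * U 2 - C ε₁ * C ε₂ * C a⁻¹ * D (psi a ε₁ ε₂ V) * U 3 := by
  simp [tensorD, Fin.sum_univ_four, frame, tensorFrame, T, W₁, N, W₂, div_eq_mul_inv,
    MvPolynomial.smul_eq_C_mul]
  ring

lemma tensorD_two (V U : VecField) :
    tensorD a ε₁ ε₂ V U 2 = act a ε₁ ε₂ V (U 2) + C ε₁ * phi a ε₁ ε₂ V * U 1 +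
      alpha a ε₁ ε₂ V * U 2 + C ε₂ * psi a ε₁ ε₂ V * U 3 := by
  simp [tensorD, Fin.sum_univ_four, frame, tensorFrame, T, W₁, N, W₂, div_eq_mul_inv,
    MvPolynomial.smul_eq_C_mul]
  ring

lemma tensorD_three (V U : VecField) :
    tensorD a ε₁ ε₂ V U 3 = act a ε₁ ε₂ V (U 3) + psi a ε₁ ε₂ V * U 0 +
      C a⁻¹ * D (psi a ε₁ ε₂ V) * U 1 + C ε₁ * C a⁻¹ * delta a ε₁ ε₂ V * U 2 := by
  simp [tensorD, Fin.sum_univ_four, frame, tensorFrame, T, W₁, N, W₂, div_eq_mul_inv,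
    MvPolynomial.smul_eq_C_mul]
  ring

end Components

/-! ### The bracket of evolution fields. -/

section Bracket

open MvPolynomial (C)

variable {a ε₁ ε₂ : ℝ}

/-- The components of `∇_T [V, U] = [D_V, D_U] T` for evolution fields. -/
lemma covT_bracket_two (ha : a ≠ 0) (hε₁ : ε₁ * ε₁ = 1) (hε₂ : ε₂ * ε₂ = 1) {V U : VecField}
    (hV : IsEvolution a ε₁ ε₂ V) (hU : IsEvolution a ε₁ ε₂ U) :
    covT a ε₁ ε₂ (bracket a ε₁ ε₂ V U) 2 = 0 := by
  have hA := C_mul_C_inv ha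
  have h1 := C_mul_self hε₁
  have h2 := C_mul_self hε₂
  -- The total derivative is moved inside `act`, where the derivatives of the components are
  -- eliminated; what remains is a polynomial identity.
  simp only [covT_two, bracket, Pi.sub_apply, tensorD_two, tensorD_one, map_add, map_sub,
    ← hV.act_D, ← hU.act_D, Derivation.leibniz, smul_eq_mul, MvPolynomial.derivation_C,
    hV.D_two hε₁, hU.D_two hε₁, D_one_eq hε₁ (a := a) (ε₂ := ε₂), D_three_eq hε₂ (a := a) (ε₁ := ε₁),
    hV.alpha_eq, hU.alpha_eq, hV.beta_eq, hU.beta_eq, map_neg, mul_zero, add_zero]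
  generalize phi a ε₁ ε₂ V = φ
  generalize psi a ε₁ ε₂ V = ψ
  generalize phi a ε₁ ε₂ U = φ'
  generalize psi a ε₁ ε₂ U = ψ'
  generalize (C a : DiffPoly) = A at *
  generalize (C a⁻¹ : DiffPoly) = B at *
  generalize (C ε₁ : DiffPoly) = e at *
  generalize (C ε₂ : DiffPoly) = f at *
  grind

end Bracket

section Bracket

open MvPolynomial (C)

variable {a ε₁ ε₂ : ℝ}

/-- The components of the fields cancel and only φ, ψ and their variations survive, so the action of
the bracket on the curvatures can be computed from φ and ψ alone. -/
lemma covT_bracket_one (ha : a ≠ 0) (hε₁ : ε₁ * ε₁ = 1) (hε₂ : ε₂ * ε₂ = 1) {V U : VecField}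
    (hV : IsEvolution a ε₁ ε₂ V) (hU : IsEvolution a ε₁ ε₂ U) :
    covT a ε₁ ε₂ (bracket a ε₁ ε₂ V U) 1 =
      act a ε₁ ε₂ V (phi a ε₁ ε₂ U) - act a ε₁ ε₂ U (phi a ε₁ ε₂ V) -
      C a⁻¹ * (phi a ε₁ ε₂ V * D (phi a ε₁ ε₂ U) - phi a ε₁ ε₂ U * D (phi a ε₁ ε₂ V)) -
      C ε₁ * C ε₂ * C a⁻¹ * (psi a ε₁ ε₂ U * D (psi a ε₁ ε₂ V) -
        psi a ε₁ ε₂ V * D (psi a ε₁ ε₂ U)) := by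
  have hA := C_mul_C_inv ha
  have h1 := C_mul_self hε₁
  have h2 := C_mul_self hε₂
  simp only [covT_one, bracket, Pi.sub_apply, tensorD_zero, tensorD_two, tensorD_one, map_add,
    map_sub, ← hV.act_D, ← hU.act_D, Derivation.leibniz, smul_eq_mul, MvPolynomial.derivation_C,
    hV.D_two hε₁, hU.D_two hε₁, D_one_eq hε₁ (a := a) (ε₂ := ε₂),
    D_three_eq hε₂ (a := a) (ε₁ := ε₁), hV.D_zero ha hε₁, hU.D_zero ha hε₁,
    hV.alpha_eq, hU.alpha_eq, hV.beta_eq, hU.beta_eq, delta_eq, act_k₁, hV.varK₁_eq,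
    hU.varK₁_eq, mul_zero, add_zero]
  generalize phi a ε₁ ε₂ V = φ
  generalize psi a ε₁ ε₂ V = ψ
  generalize phi a ε₁ ε₂ U = φ'
  generalize psi a ε₁ ε₂ U = ψ'
  generalize (C a : DiffPoly) = A at *
  generalize (C a⁻¹ : DiffPoly) = B at *
  generalize (C ε₁ : DiffPoly) = e at *
  generalize (C ε₂ : DiffPoly) = f at *
  grind

lemma covT_bracket_three (ha : a ≠ 0) (hε₁ : ε₁ * ε₁ = 1) (hε₂ : ε₂ * ε₂ = 1) {V U : VecField}
    (hV : IsEvolution a ε₁ ε₂ V) (hU : IsEvolution a ε₁ ε₂ U) :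
    covT a ε₁ ε₂ (bracket a ε₁ ε₂ V U) 3 =
      act a ε₁ ε₂ V (psi a ε₁ ε₂ U) - act a ε₁ ε₂ U (psi a ε₁ ε₂ V) -
      C a⁻¹ * (psi a ε₁ ε₂ V * D (phi a ε₁ ε₂ U) - psi a ε₁ ε₂ U * D (phi a ε₁ ε₂ V)) +
      C a⁻¹ * (phi a ε₁ ε₂ U * D (psi a ε₁ ε₂ V) -
        phi a ε₁ ε₂ V * D (psi a ε₁ ε₂ U)) := by
  have hA := C_mul_C_inv ha
  have h1 := C_mul_self hε₁
  have h2 := C_mul_self hε₂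
  simp only [covT_three, bracket, Pi.sub_apply, tensorD_three, tensorD_two, map_add,
    map_sub, ← hV.act_D, ← hU.act_D, Derivation.leibniz, smul_eq_mul, MvPolynomial.derivation_C,
    hV.D_two hε₁, hU.D_two hε₁, D_one_eq hε₁ (a := a) (ε₂ := ε₂),
    D_three_eq hε₂ (a := a) (ε₁ := ε₁), hV.D_zero ha hε₁, hU.D_zero ha hε₁,
    hV.alpha_eq, hU.alpha_eq, delta_eq, act_k₂, hV.varK₂_eq,
    hU.varK₂_eq, mul_zero, add_zero]
  generalize phi a ε₁ ε₂ V = φ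
  generalize psi a ε₁ ε₂ V = ψ
  generalize phi a ε₁ ε₂ U = φ'
  generalize psi a ε₁ ε₂ U = ψ'
  generalize (C a : DiffPoly) = A at *
  generalize (C a⁻¹ : DiffPoly) = B at *
  generalize (C ε₁ : DiffPoly) = e at *
  generalize (C ε₂ : DiffPoly) = f at *
  grind

lemma covT_bracket_zero (ha : a ≠ 0) (hε₁ : ε₁ * ε₁ = 1) (hε₂ : ε₂ * ε₂ = 1) {V U : VecField}
    (hV : IsEvolution a ε₁ ε₂ V) (hU : IsEvolution a ε₁ ε₂ U) :
    C a * covT a ε₁ ε₂ (bracket a ε₁ ε₂ V U) 0 =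
      -D (act a ε₁ ε₂ V (phi a ε₁ ε₂ U) - act a ε₁ ε₂ U (phi a ε₁ ε₂ V) -
      C a⁻¹ * (phi a ε₁ ε₂ V * D (phi a ε₁ ε₂ U) - phi a ε₁ ε₂ U * D (phi a ε₁ ε₂ V)) -
      C ε₁ * C ε₂ * C a⁻¹ * (psi a ε₁ ε₂ U * D (psi a ε₁ ε₂ V) -
        psi a ε₁ ε₂ V * D (psi a ε₁ ε₂ U))) := by
  have hA := C_mul_C_inv ha
  have h1 := C_mul_self hε₁
  have h2 := C_mul_self hε₂
  simp only [covT_zero, bracket, Pi.sub_apply, tensorD_three, tensorD_zero, tensorD_one, map_add,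
    map_sub, ← hV.act_D, ← hU.act_D, Derivation.leibniz, smul_eq_mul, MvPolynomial.derivation_C,
    D_one_eq hε₁ (a := a) (ε₂ := ε₂),
    D_three_eq hε₂ (a := a) (ε₁ := ε₁), hV.D_zero ha hε₁, hU.D_zero ha hε₁,
    hV.alpha_eq, hU.alpha_eq, hV.beta_eq, hU.beta_eq, delta_eq, act_k₁, act_k₂, hV.varK₁_eq,
    hU.varK₁_eq, hV.varK₂_eq, hU.varK₂_eq, mul_zero, add_zero]
  generalize phi a ε₁ ε₂ V = φ
  generalize psi a ε₁ ε₂ V = ψ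
  generalize phi a ε₁ ε₂ U = φ'
  generalize psi a ε₁ ε₂ U = ψ'
  generalize (C a : DiffPoly) = A at *
  generalize (C a⁻¹ : DiffPoly) = B at *
  generalize (C ε₁ : DiffPoly) = e at *
  generalize (C ε₂ : DiffPoly) = f at *
  grind

/-- The bracket of evolution fields is an evolution field. -/
theorem IsEvolution.bracket (ha : a ≠ 0) (hε₁ : ε₁ * ε₁ = 1) (hε₂ : ε₂ * ε₂ = 1) {V U : VecField}
    (hV : IsEvolution a ε₁ ε₂ V) (hU : IsEvolution a ε₁ ε₂ U) :
    IsEvolution a ε₁ ε₂ (bracket a ε₁ ε₂ V U) := by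
  rw [isEvolution_iff hε₁, covT_bracket_one ha hε₁ hε₂ hV hU, covT_bracket_zero ha hε₁ hε₂ hV hU]
  exact ⟨covT_bracket_two ha hε₁ hε₂ hV hU, add_neg_cancel _⟩

lemma varK₁_bracket (ha : a ≠ 0) (hε₁ : ε₁ * ε₁ = 1) (hε₂ : ε₂ * ε₂ = 1) {V U : VecField}
    (hV : IsEvolution a ε₁ ε₂ V) (hU : IsEvolution a ε₁ ε₂ U) :
    varK₁ a ε₁ ε₂ (NullCurve.bracket a ε₁ ε₂ V U) =
      act a ε₁ ε₂ V (varK₁ a ε₁ ε₂ U) - act a ε₁ ε₂ U (varK₁ a ε₁ ε₂ V) := by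
  have h1 := C_mul_self hε₁
  have h2 := C_mul_self hε₂
  have hn : ∀ W : VecField, ∀ n : ℕ, [n.AtLeastTwo] →
    act a ε₁ ε₂ W (OfNat.ofNat n : DiffPoly) = 0 := fun W n _ => Derivation.map_natCast _ n
  have hn' : ∀ n : ℕ, [n.AtLeastTwo] →
    D (OfNat.ofNat n : DiffPoly) = 0 := fun n _ => Derivation.map_natCast _ n
  rw [(hV.bracket ha hε₁ hε₂ hU).varK₁_eq, phi_eq hε₁, psi_eq hε₂,
    covT_bracket_one ha hε₁ hε₂ hV hU, covT_bracket_three ha hε₁ hε₂ hV hU]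
  simp only [map_add, map_sub, hV.act_D, hU.act_D, Derivation.leibniz,
    smul_eq_mul, MvPolynomial.derivation_C, act_k₁, act_k₂, hV.varK₁_eq, hU.varK₁_eq, hV.varK₂_eq,
    hU.varK₂_eq, mul_zero, add_zero, hn, hn']
  generalize phi a ε₁ ε₂ V = φ
  generalize psi a ε₁ ε₂ V = ψ
  generalize phi a ε₁ ε₂ U = φ'
  generalize psi a ε₁ ε₂ U = ψ'
  generalize (C a⁻¹ : DiffPoly) = B at *
  generalize (C ε₁ : DiffPoly) = e at *
  generalize (C ε₂ : DiffPoly) = f at *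
  grind

lemma varK₂_bracket (ha : a ≠ 0) (hε₁ : ε₁ * ε₁ = 1) (hε₂ : ε₂ * ε₂ = 1) {V U : VecField}
    (hV : IsEvolution a ε₁ ε₂ V) (hU : IsEvolution a ε₁ ε₂ U) :
    varK₂ a ε₁ ε₂ (NullCurve.bracket a ε₁ ε₂ V U) =
      act a ε₁ ε₂ V (varK₂ a ε₁ ε₂ U) - act a ε₁ ε₂ U (varK₂ a ε₁ ε₂ V) := by
  have h1 := C_mul_self hε₁
  have h2 := C_mul_self hε₂
  have hn : ∀ W : VecField, ∀ n : ℕ, [n.AtLeastTwo] →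
    act a ε₁ ε₂ W (OfNat.ofNat n : DiffPoly) = 0 := fun W n _ => Derivation.map_natCast _ n
  have hn' : ∀ n : ℕ, [n.AtLeastTwo] →
    D (OfNat.ofNat n : DiffPoly) = 0 := fun n _ => Derivation.map_natCast _ n
  rw [(hV.bracket ha hε₁ hε₂ hU).varK₂_eq, phi_eq hε₁, psi_eq hε₂,
    covT_bracket_one ha hε₁ hε₂ hV hU, covT_bracket_three ha hε₁ hε₂ hV hU]
  simp only [map_add, map_sub, hV.act_D, hU.act_D, Derivation.leibniz,
    smul_eq_mul, MvPolynomial.derivation_C, act_k₁, act_k₂, hV.varK₁_eq, hU.varK₁_eq, hV.varK₂_eq,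
    hU.varK₂_eq, mul_zero, add_zero, hn, hn']
  generalize phi a ε₁ ε₂ V = φ
  generalize psi a ε₁ ε₂ V = ψ
  generalize phi a ε₁ ε₂ U = φ'
  generalize psi a ε₁ ε₂ U = ψ'
  generalize (C a⁻¹ : DiffPoly) = B at *
  generalize (C ε₁ : DiffPoly) = e at *
  generalize (C ε₂ : DiffPoly) = f at *
  grind

end Bracket

/-! ### Faithfulness of the action on the curvatures. -/

section Kernel

open MvPolynomial (C)

variable {a ε₁ ε₂ : ℝ}

lemma k₁_eq : k₁ = MvPolynomial.X (0, 0) := rfl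

lemma k₂_eq : k₂ = MvPolynomial.X (1, 0) := rfl

lemma D_k₁ : D k₁ = MvPolynomial.X (0, 1) := by simp [D_eq_totalD, k₁]

lemma D_k₂ : D k₂ = MvPolynomial.X (1, 1) := by simp [D_eq_totalD, k₂]

@[simp] lemma constantCoeff_k₁ : MvPolynomial.constantCoeff k₁ = 0 := by simp [k₁]

@[simp] lemma constantCoeff_k₂ : MvPolynomial.constantCoeff k₂ = 0 := by simp [k₂]

@[simp] lemma constantCoeff_D (f : DiffPoly) : MvPolynomial.constantCoeff (D f) = 0 :=
  constantCoeff_totalD f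

lemma eq_zero_of_D_eq_zero {f : DiffPoly} (h : D f = 0)
    (h0 : MvPolynomial.constantCoeff f = 0) : f = 0 := by
  rw [eq_C_of_totalD_eq_zero (𝕜 := ℝ) h, h0, map_zero]

lemma act_bracket (ha : a ≠ 0) (hε₁ : ε₁ * ε₁ = 1) (hε₂ : ε₂ * ε₂ = 1) {V U : VecField}
    (hV : IsEvolution a ε₁ ε₂ V) (hU : IsEvolution a ε₁ ε₂ U) :
    act a ε₁ ε₂ (bracket a ε₁ ε₂ V U) = ⁅act a ε₁ ε₂ V, act a ε₁ ε₂ U⁆ := by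
  refine eq_of_comm_totalD (hV.bracket ha hε₁ hε₂ hU).act_D (fun f => ?_) fun i => ?_
  · simp only [Derivation.commutator_apply, ← D_eq_totalD, hV.act_D, hU.act_D, map_sub]
  · rw [Derivation.commutator_apply]
    fin_cases i
    · simp only [Fin.zero_eta, ← k₁_eq, act_k₁, varK₁_bracket ha hε₁ hε₂ hV hU]
    · simp only [Fin.mk_one, ← k₂_eq, act_k₂, varK₂_bracket ha hε₁ hε₂ hV hU]

lemma IsEvolution.constantCoeff_varK₁ {V : VecField} (hV : IsEvolution a ε₁ ε₂ V) :
    MvPolynomial.constantCoeff (varK₁ a ε₁ ε₂ V) = 0 := by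
  rw [hV.varK₁_eq]; simp

lemma IsEvolution.constantCoeff_varK₂ {V : VecField} (hV : IsEvolution a ε₁ ε₂ V) :
    MvPolynomial.constantCoeff (varK₂ a ε₁ ε₂ V) = 0 := by
  rw [hV.varK₂_eq]; simp

lemma homogeneousComponent_D (n : ℕ) (f : DiffPoly) :
    MvPolynomial.homogeneousComponent n (D f) = D (MvPolynomial.homogeneousComponent n f) :=
  homogeneousComponent_totalD n f

lemma homogeneousComponent_D_D_D_eq_zero {n : ℕ} {f : DiffPoly}
    (h0 : MvPolynomial.constantCoeff f = 0)
    (h : D (D (D (MvPolynomial.homogeneousComponent n f))) = 0) :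
    MvPolynomial.homogeneousComponent n f = 0 :=
  eq_zero_of_D_eq_zero (eq_zero_of_D_eq_zero (eq_zero_of_D_eq_zero h (by simp)) (by simp))
    (constantCoeff_homogeneousComponent h0 n)

/-- The kernel of the matrix operator with entries `θ`, `-S`, `S`, `± θ` is trivial. -/
lemma eq_zero_of_theta_opS {b e : ℝ} (hb : b ≠ 0) (he : e ≠ 0) {φ ψ : DiffPoly}
    (h1 : C b * D (D (D φ)) + 2 * k₁ * D φ + D k₁ * φ - 2 * k₂ * D ψ - D k₂ * ψ = 0)
    (h2 : 2 * k₂ * D φ + D k₂ * φ + C e * (C b * D (D (D ψ)) + 2 * k₁ * D ψ + D k₁ * ψ) = 0) :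
    φ = 0 ∧ ψ = 0 := by
  have h1' : b • D (D (D φ)) + (2 : ℝ) • (MvPolynomial.X (0, 0) * D φ) + MvPolynomial.X (0, 1) * φ -
      (2 : ℝ) • (MvPolynomial.X (1, 0) * D ψ) - MvPolynomial.X (1, 1) * ψ = 0 := by
    rw [← h1, D_k₁, D_k₂, k₁_eq, k₂_eq]
    simp only [MvPolynomial.smul_eq_C_mul, map_ofNat]
    ring
  have h2' : (2 : ℝ) • (MvPolynomial.X (1, 0) * D φ) + MvPolynomial.X (1, 1) * φ +
      (e * b) • D (D (D ψ)) + (2 * e) • (MvPolynomial.X (0, 0) * D ψ) +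
      e • (MvPolynomial.X (0, 1) * ψ) = 0 := by
    rw [← h2, D_k₁, D_k₂, k₁_eq, k₂_eq]
    simp only [MvPolynomial.smul_eq_C_mul, map_ofNat, map_mul]
    ring
  have hlin : ∀ (i k : Fin 2) (z : ℝ) (m : ℕ) (f : DiffPoly),
      linSymbol i z (MvPolynomial.X (k, m) * f) =
        if k = i then z ^ m * MvPolynomial.constantCoeff f else 0 := fun i k z m f => by
    simp only [linSymbol, Derivation.leibniz, jetShift_X, map_add, smul_eq_mul, map_mul,
      MvPolynomial.constantCoeff_X, zero_mul, zero_add]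
    split_ifs <;> simp [mul_comm]
  -- The linear terms of the first equation in the jets of k₁ give z(bz²φ̂(z) + φ₀) = 0, with φ̂ the
  -- linear symbol and φ₀ the constant term; cancel z and put z = 0.
  have hφ0 : MvPolynomial.constantCoeff φ = 0 := by
    have h := eq_zero_of_add_mul (z := 0)
      (R := fun z => b * z ^ 2 * linSymbol 0 z φ + MvPolynomial.constantCoeff φ)
      (by have := continuous_linSymbol 0 φ; fun_prop) fun z => by
        have h := congrArg (linSymbol 0 z) h1'
        simp only [linSymbol_add, linSymbol_sub, linSymbol_smul, hlin, D_eq_totalD,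
          linSymbol_totalD] at h
        simp [linSymbol] at h
        simp only [linSymbol]
        linear_combination h
    simpa using h
  have hψ0 : MvPolynomial.constantCoeff ψ = 0 := by
    have h := eq_zero_of_add_mul (z := 0)
      (R := fun z => b * z ^ 2 * linSymbol 1 z φ - MvPolynomial.constantCoeff ψ)
      (by have := continuous_linSymbol 1 φ; fun_prop) fun z => by
        have h := congrArg (linSymbol 1 z) h1'
        simp only [linSymbol_add, linSymbol_sub, linSymbol_smul, hlin, D_eq_totalD,
          linSymbol_totalD] at h
        simp [linSymbol] at h
        simp only [linSymbol]
        linear_combination h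
    simpa using h
  have key : ∀ n, MvPolynomial.homogeneousComponent n φ = 0 ∧
      MvPolynomial.homogeneousComponent n ψ = 0 := by
    intro n
    induction n with
    | zero =>
      simp only [MvPolynomial.homogeneousComponent_zero, ← MvPolynomial.constantCoeff_eq, hφ0, hψ0,
        map_zero, and_self]
    | succ n ih =>
      have e1 := congrArg (MvPolynomial.homogeneousComponent (n + 1)) h1'
      have e2 := congrArg (MvPolynomial.homogeneousComponent (n + 1)) h2'
      simp only [map_add, map_sub, map_smul, homogeneousComponent_X_mul, homogeneousComponent_D,
        ih.1, ih.2, map_zero, mul_zero, smul_zero, add_zero, sub_zero, zero_add,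
        smul_eq_zero, hb, mul_ne_zero he hb, false_or] at e1 e2
      exact ⟨homogeneousComponent_D_D_D_eq_zero hφ0 e1, homogeneousComponent_D_D_D_eq_zero hψ0 e2⟩
  exact ⟨eq_zero_of_homogeneousComponent fun n => (key n).1,
    eq_zero_of_homogeneousComponent fun n => (key n).2⟩

/-- There are no parallel local vector fields. -/
lemma eq_zero_of_covT_eq_zero (ha : a ≠ 0) (hε₁ : ε₁ * ε₁ = 1) (hε₂ : ε₂ * ε₂ = 1) {V : VecField}
    (h : ∀ i, covT a ε₁ ε₂ V i = 0) : V = 0 := by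
  have hε₁' : ε₁ ≠ 0 := fun h => by simp [h] at hε₁
  have hε₂' : ε₂ ≠ 0 := fun h => by simp [h] at hε₂
  have r0 : D (V 0) = MvPolynomial.X (0, 0) * V 1 - MvPolynomial.X (1, 0) * V 3 := by
    have := h 0; rw [covT_zero, k₁_eq, k₂_eq] at this; linear_combination this
  have r1 : D (V 1) = ε₁ • (MvPolynomial.X (0, 0) * V 2) - a • V 0 := by
    have := h 1; rw [covT_one, k₁_eq] at this
    simp only [MvPolynomial.smul_eq_C_mul]
    linear_combination this
  have r2 : D (V 2) = -((a * ε₁) • V 1) := by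
    have := h 2; rw [covT_two] at this
    simp only [MvPolynomial.smul_eq_C_mul, map_mul]
    linear_combination this
  have r3 : D (V 3) = -(ε₂ • (MvPolynomial.X (1, 0) * V 2)) := by
    have := h 3; rw [covT_three, k₂_eq] at this
    simp only [MvPolynomial.smul_eq_C_mul]
    linear_combination this
  have c0 : MvPolynomial.constantCoeff (V 0) = 0 := by
    have := congrArg MvPolynomial.constantCoeff r1
    simpa [ha] using this
  have c1 : MvPolynomial.constantCoeff (V 1) = 0 := by
    have := congrArg MvPolynomial.constantCoeff r2
    simpa [ha, hε₁'] using this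
  have c2 : MvPolynomial.constantCoeff (V 2) = 0 := by
    have := congrArg (linSymbol 1 0) r3
    rw [D_eq_totalD, linSymbol_totalD] at this
    simpa [linSymbol, jetShift_X, hε₂'] using this
  have c3 : MvPolynomial.constantCoeff (V 3) = 0 := by
    have := congrArg (linSymbol 1 0) r0
    rw [D_eq_totalD, linSymbol_totalD] at this
    simpa [linSymbol, jetShift_X] using this
  have key : ∀ n i, MvPolynomial.homogeneousComponent n (V i) = 0 := by
    intro n
    induction n with
    | zero =>
      intro i
      rw [MvPolynomial.homogeneousComponent_zero, ← MvPolynomial.constantCoeff_eq]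
      fin_cases i <;> simp [c0, c1, c2, c3]
    | succ n ih =>
      have e0 := congrArg (MvPolynomial.homogeneousComponent (n + 1)) r0
      have e1 := congrArg (MvPolynomial.homogeneousComponent (n + 1)) r1
      have e2 := congrArg (MvPolynomial.homogeneousComponent (n + 1)) r2
      have e3 := congrArg (MvPolynomial.homogeneousComponent (n + 1)) r3
      simp only [map_sub, map_smul, map_neg, homogeneousComponent_X_mul,
        homogeneousComponent_D, ih, mul_zero, smul_zero, neg_zero, sub_zero,
        zero_sub] at e0 e1 e2 e3
      -- In degree n+1 the products with curvatures vanish by induction, so the system is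
      -- triangular: `V 0`, then `V 1`, then `V 2`, while `V 3` decouples.
      have z0 := eq_zero_of_D_eq_zero e0 (constantCoeff_homogeneousComponent c0 _)
      rw [z0, smul_zero, neg_zero] at e1
      have z1 := eq_zero_of_D_eq_zero e1 (constantCoeff_homogeneousComponent c1 _)
      rw [z1, smul_zero, neg_zero] at e2
      have z2 := eq_zero_of_D_eq_zero e2 (constantCoeff_homogeneousComponent c2 _)
      have z3 := eq_zero_of_D_eq_zero e3 (constantCoeff_homogeneousComponent c3 _)
      intro i
      fin_cases i
      exacts [z0, z1, z2, z3]
  ext1 i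
  exact eq_zero_of_homogeneousComponent fun n => key n i

/-- An evolution field with vanishing variations of the curvatures vanishes. -/
theorem IsEvolution.eq_zero_of_varK (ha : a ≠ 0) (hε₁ : ε₁ * ε₁ = 1) (hε₂ : ε₂ * ε₂ = 1)
    {V : VecField} (hV : IsEvolution a ε₁ ε₂ V) (h1 : varK₁ a ε₁ ε₂ V = 0)
    (h2 : varK₂ a ε₁ ε₂ V = 0) : V = 0 := by
  have hε₁' : ε₁ ≠ 0 := fun h => by simp [h] at hε₁
  have hε₂' : ε₂ ≠ 0 := fun h => by simp [h] at hε₂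
  have hA := C_mul_C_inv ha
  rw [hV.varK₁_eq] at h1
  rw [hV.varK₂_eq] at h2
  obtain ⟨hφ, hψ⟩ := eq_zero_of_theta_opS (b := a⁻¹) (e := ε₁ * ε₂) (φ := phi a ε₁ ε₂ V)
    (ψ := psi a ε₁ ε₂ V) (inv_ne_zero ha) (mul_ne_zero hε₁' hε₂') (by grind)
    (by rw [map_mul]; grind)
  refine eq_zero_of_covT_eq_zero ha hε₁ hε₂ fun i => ?_
  have he := (isEvolution_iff hε₁ V).mp hV
  rw [← phi_eq hε₁, hφ, map_zero, zero_add] at he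
  fin_cases i
  · have := he.2
    exact (mul_eq_zero.mp this).resolve_left (by simpa using ha)
  · exact (phi_eq hε₁ V).symm.trans hφ
  · exact he.1
  · exact (psi_eq hε₂ V).symm.trans hψ

lemma IsEvolution.lin (hε₁ : ε₁ * ε₁ = 1) {V U : VecField}
    (hV : IsEvolution a ε₁ ε₂ V) (hU : IsEvolution a ε₁ ε₂ U) (r s : ℝ) :
    IsEvolution a ε₁ ε₂ (r • V + s • U) := by
  rw [isEvolution_iff hε₁] at hV hU ⊢
  simp only [covT_zero, covT_one, covT_two, Pi.add_apply, Pi.smul_apply,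
    MvPolynomial.smul_eq_C_mul, map_add, map_sub, Derivation.leibniz, smul_eq_mul,
    MvPolynomial.derivation_C, mul_zero, add_zero] at hV hU ⊢
  exact ⟨by linear_combination C r * hV.1 + C s * hU.1,
    by linear_combination C r * hV.2 + C s * hU.2⟩

/-- An evolution field is determined by its `W₁` and `W₂` components, up to constants of
integration. -/
lemma IsEvolution.ext (ha : a ≠ 0) (hε₁ : ε₁ * ε₁ = 1) {V U : VecField}
    (hV : IsEvolution a ε₁ ε₂ V) (hU : IsEvolution a ε₁ ε₂ U) (h1 : V 1 = U 1) (h3 : V 3 = U 3)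
    (h0 : MvPolynomial.constantCoeff (V 0) = MvPolynomial.constantCoeff (U 0))
    (h2 : MvPolynomial.constantCoeff (V 2) = MvPolynomial.constantCoeff (U 2)) : V = U := by
  have e2 : V 2 = U 2 := sub_eq_zero.mp (eq_zero_of_D_eq_zero (by
    rw [map_sub, hV.D_two hε₁, hU.D_two hε₁, h1, sub_self]) (by rw [map_sub, h2, sub_self]))
  have e0 : V 0 = U 0 := sub_eq_zero.mp (eq_zero_of_D_eq_zero (by
    have hA := C_mul_C_inv ha
    have a1 := hV.D_zero ha hε₁
    have a2 := hU.D_zero ha hε₁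
    simp only [phi_eq hε₁, covT_one, map_add, map_sub, Derivation.leibniz, smul_eq_mul,
      MvPolynomial.derivation_C, h1, h3, e2] at a1 a2
    -- The factor 2 arises because φ itself contains a times the T component.
    have h : 2 * (D (V 0) - D (U 0)) = 0 := by
      linear_combination a1 - a2 - (D (V 0) - D (U 0)) * hA
    rw [map_sub]
    exact (mul_eq_zero.mp h).resolve_left two_ne_zero) (by rw [map_sub, h0, sub_self]))
  ext1 i
  fin_cases i
  exacts [e0, h1, e2, h3]

end Kernel

/-! ### Antiderivatives, the domain and linearity of the recursion operator. -/

section Recursion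

open MvPolynomial (C)

variable {a ε₁ ε₂ : ℝ}

lemma antideriv_eq {f p : DiffPoly} (hp : MvPolynomial.constantCoeff p = 0) (h : D p = f) :
    antideriv f = p := by
  have hex : ∃ p ∈ P₀, D p = f := ⟨p, hp, h⟩
  rw [antideriv, dif_pos hex]
  have hc := hex.choose_spec
  exact sub_eq_zero.mp (eq_zero_of_D_eq_zero (by rw [map_sub, hc.2, h, sub_self])
    (by rw [map_sub, hp, show MvPolynomial.constantCoeff hex.choose = 0 from hc.1, sub_self]))

lemma exists_P₀_of_exists {f : DiffPoly} (h : ∃ p, D p = f) :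
    ∃ p, MvPolynomial.constantCoeff p = 0 ∧ D p = f := by
  obtain ⟨p, hp⟩ := h
  exact ⟨p - C (MvPolynomial.constantCoeff p), by simp, by
    rw [map_sub, hp, MvPolynomial.derivation_C, sub_zero]⟩

/-- Antiderivatives can be normalized by subtracting constants, and a total derivative has no
constant term. -/
lemma mem_Q_iff {h l : DiffPoly} : (h, l) ∈ Q ↔ MvPolynomial.constantCoeff l = 0 ∧
    (∃ p, D p = h) ∧ ∃ q, D q = k₁ * h - k₂ * l := by
  constructor
  · rintro ⟨-, hl, p, -, q, -, hp, hq⟩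
    exact ⟨hl, ⟨p, hp⟩, q, hq⟩
  · rintro ⟨hl, hp, hq⟩
    obtain ⟨p, hp0, hp⟩ := exists_P₀_of_exists hp
    obtain ⟨q, hq0, hq⟩ := exists_P₀_of_exists hq
    exact ⟨by rw [← hp]; exact constantCoeff_D p, hl, p, hp0, q, hq0, hp, hq⟩

lemma calX_eq (c₁ c₂ : ℝ) {h l p q : DiffPoly} (hp0 : MvPolynomial.constantCoeff p = 0)
    (hp : D p = h) (hq0 : MvPolynomial.constantCoeff q = 0) (hq : D q = k₁ * h - k₂ * l) :
    calX a ε₁ c₁ c₂ h l =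
      ![-(C (1 / (2 * a)) * (D h + C a * (k₁ * p) - C a * q - C ε₁ * C c₁ * k₁)) + C c₂, h,
        -(C ε₁ * C a * p) + C c₁, l] := by
  rw [calX, antideriv_eq hp0 hp, antideriv_eq hq0 hq]
  ext1 i
  fin_cases i <;> simp [T, W₁, N, W₂, MvPolynomial.smul_eq_C_mul]

/-- The T and N components of `calX` are obtained by integrating the two evolution conditions for
prescribed W₁ and W₂ components. -/
lemma isEvolution_calX (ha : a ≠ 0) (hε₁ : ε₁ * ε₁ = 1) (c₁ c₂ : ℝ) {h l : DiffPoly}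
    (hQ : (h, l) ∈ Q) : IsEvolution a ε₁ ε₂ (calX a ε₁ c₁ c₂ h l) := by
  obtain ⟨-, -, p, hp0, q, hq0, hp, hq⟩ := hQ
  dsimp only at hp hq
  rw [calX_eq c₁ c₂ hp0 hp hq0 hq, isEvolution_iff hε₁]
  have h1 := C_mul_self hε₁
  have hA : 2 * C a * C (1 / (2 * a)) = (1 : DiffPoly) := by
    rw [← map_ofNat C 2, ← map_mul, ← map_mul, ← map_one C]
    congr 1
    field_simp
  simp only [covT_zero, covT_one, covT_two]
  simp only [Matrix.cons_val_zero, Matrix.cons_val_one, Matrix.cons_val, map_add, map_sub, map_neg,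
    Derivation.leibniz, smul_eq_mul, MvPolynomial.derivation_C, hp, hq, mul_zero, add_zero]
  generalize (C (1 / (2 * a)) : DiffPoly) = B at *
  generalize (C a : DiffPoly) = A at *
  generalize (C ε₁ : DiffPoly) = e at *
  constructor
  · ring
  · grind

lemma mem_recDomain_iff {V : VecField} :
    V ∈ recDomain a ε₁ ε₂ ↔ IsEvolution a ε₁ ε₂ V ∧ (∃ p, D p = varK₁ a ε₁ ε₂ V) ∧
      ∃ q, D q = (1 / 2 : ℝ) • (MvPolynomial.X (0, 0) * varK₁ a ε₁ ε₂ V) +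
        (ε₁ * ε₂) • (MvPolynomial.X (1, 0) * varK₂ a ε₁ ε₂ V) := by
  have hq : k₁ * ((1 / 2 : ℝ) • varK₁ a ε₁ ε₂ V) - k₂ * -((ε₁ * ε₂) • varK₂ a ε₁ ε₂ V) =
      (1 / 2 : ℝ) • (MvPolynomial.X (0, 0) * varK₁ a ε₁ ε₂ V) +
        (ε₁ * ε₂) • (MvPolynomial.X (1, 0) * varK₂ a ε₁ ε₂ V) := by
    rw [k₁_eq, k₂_eq]; simp only [MvPolynomial.smul_eq_C_mul]; ring
  refine and_congr_right fun hV => ?_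
  rw [mem_Q_iff, hq]
  constructor
  · rintro ⟨-, ⟨p, hp⟩, h⟩
    exact ⟨⟨(2 : ℝ) • p, by rw [Derivation.map_smul, hp, smul_smul]; norm_num⟩, h⟩
  · rintro ⟨⟨p, hp⟩, h⟩
    exact ⟨by simp [hV.constantCoeff_varK₂], ⟨(1 / 2 : ℝ) • p, by rw [Derivation.map_smul, hp]⟩, h⟩

lemma IsEvolution.recOp (ha : a ≠ 0) (hε₁ : ε₁ * ε₁ = 1) (c₁ c₂ : ℝ) {V : VecField}
    (hV : V ∈ recDomain a ε₁ ε₂) : IsEvolution a ε₁ ε₂ (recOp a ε₁ ε₂ c₁ c₂ V) :=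
  isEvolution_calX ha hε₁ c₁ c₂ hV.2

lemma phi_lin (hε₁ : ε₁ * ε₁ = 1) (V U : VecField) (r s : ℝ) :
    phi a ε₁ ε₂ (r • V + s • U) = C r * phi a ε₁ ε₂ V + C s * phi a ε₁ ε₂ U := by
  simp only [phi_eq hε₁, covT_one, Pi.add_apply, Pi.smul_apply,
    MvPolynomial.smul_eq_C_mul, map_add, Derivation.leibniz, smul_eq_mul,
    MvPolynomial.derivation_C, mul_zero, add_zero]
  ring

lemma psi_lin (hε₂ : ε₂ * ε₂ = 1) (V U : VecField) (r s : ℝ) :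
    psi a ε₁ ε₂ (r • V + s • U) = C r * psi a ε₁ ε₂ V + C s * psi a ε₁ ε₂ U := by
  simp only [psi_eq hε₂, covT_three, Pi.add_apply, Pi.smul_apply,
    MvPolynomial.smul_eq_C_mul, map_add, Derivation.leibniz, smul_eq_mul,
    MvPolynomial.derivation_C, mul_zero, add_zero]
  ring

lemma varK_lin (hε₁ : ε₁ * ε₁ = 1) (hε₂ : ε₂ * ε₂ = 1) {V U : VecField}
    (hV : IsEvolution a ε₁ ε₂ V) (hU : IsEvolution a ε₁ ε₂ U) (r s : ℝ) :
    varK₁ a ε₁ ε₂ (r • V + s • U) = C r * varK₁ a ε₁ ε₂ V + C s * varK₁ a ε₁ ε₂ U ∧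
    varK₂ a ε₁ ε₂ (r • V + s • U) = C r * varK₂ a ε₁ ε₂ V + C s * varK₂ a ε₁ ε₂ U := by
  have h := hV.lin hε₁ hU r s
  rw [h.varK₁_eq, h.varK₂_eq, hV.varK₁_eq, hV.varK₂_eq, hU.varK₁_eq, hU.varK₂_eq]
  simp only [phi_lin hε₁, psi_lin hε₂, map_add, Derivation.leibniz, smul_eq_mul,
    MvPolynomial.derivation_C, mul_zero, add_zero]
  constructor <;> ring

lemma recDomain_lin (hε₁ : ε₁ * ε₁ = 1) (hε₂ : ε₂ * ε₂ = 1) {V U : VecField}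
    (hV : V ∈ recDomain a ε₁ ε₂) (hU : U ∈ recDomain a ε₁ ε₂) (r s : ℝ) :
    r • V + s • U ∈ recDomain a ε₁ ε₂ := by
  rw [mem_recDomain_iff] at *
  obtain ⟨hV, ⟨p, hp⟩, q, hq⟩ := hV
  obtain ⟨hU, ⟨p', hp'⟩, q', hq'⟩ := hU
  obtain ⟨e1, e2⟩ := varK_lin hε₁ hε₂ hV hU r s
  refine ⟨hV.lin hε₁ hU r s, ⟨r • p + s • p', ?_⟩, r • q + s • q', ?_⟩
  · rw [map_add, Derivation.map_smul, Derivation.map_smul, hp, hp', e1]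
    simp only [MvPolynomial.smul_eq_C_mul]
  · rw [map_add, Derivation.map_smul, Derivation.map_smul, hq, hq', e1, e2]
    simp only [MvPolynomial.smul_eq_C_mul]
    ring

lemma calX_lin (r s c₁ c₂ d₁ d₂ : ℝ) {h l h' l' : DiffPoly} (hQ : (h, l) ∈ Q)
    (hQ' : (h', l') ∈ Q) :
    calX a ε₁ (r * c₁ + s * d₁) (r * c₂ + s * d₂) (C r * h + C s * h') (C r * l + C s * l') =
      r • calX a ε₁ c₁ c₂ h l + s • calX a ε₁ d₁ d₂ h' l' := by
  obtain ⟨-, -, p, hp0, q, hq0, hp, hq⟩ := hQ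
  obtain ⟨-, -, p', hp0', q', hq0', hp', hq'⟩ := hQ'
  dsimp only at hp hq hp' hq'
  rw [P₀, Set.mem_ofPred_eq] at hp0 hq0 hp0' hq0'
  rw [calX_eq c₁ c₂ hp0 hp hq0 hq, calX_eq d₁ d₂ hp0' hp' hq0' hq',
    calX_eq (p := C r * p + C s * p') (q := C r * q + C s * q')]
  · ext1 i
    fin_cases i <;> simp [MvPolynomial.smul_eq_C_mul] <;> ring
  · simp [hp0, hp0']
  · simp [hp, hp']
  · simp [hq0, hq0']
  · simp [hq, hq']; ring

lemma recOp_lin (hε₁ : ε₁ * ε₁ = 1) (hε₂ : ε₂ * ε₂ = 1) {V U : VecField}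
    (hV : V ∈ recDomain a ε₁ ε₂) (hU : U ∈ recDomain a ε₁ ε₂) (r s c₁ c₂ d₁ d₂ : ℝ) :
    recOp a ε₁ ε₂ (r * c₁ + s * d₁) (r * c₂ + s * d₂) (r • V + s • U) =
      r • recOp a ε₁ ε₂ c₁ c₂ V + s • recOp a ε₁ ε₂ d₁ d₂ U := by
  obtain ⟨e1, e2⟩ := varK_lin hε₁ hε₂ hV.1 hU.1 r s
  rw [recOp, recOp, recOp, ← calX_lin r s c₁ c₂ d₁ d₂ hV.2 hU.2, e1, e2]
  congr 1 <;> simp only [MvPolynomial.smul_eq_C_mul] <;> ring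

end Recursion

/-! ### The null localized induction equation and its curvature flow. -/

section NLIE

open MvPolynomial (C)

variable {a ε₁ ε₂ c : ℝ}

lemma V₁_apply (a ε₁ c : ℝ) : V₁ a ε₁ c =
    ![-(C a * C c * k₁), 0, -(2 * C ε₁ * C a ^ 2 * C c), 0] := by
  ext1 i
  fin_cases i <;> simp [V₁, T, N, MvPolynomial.smul_eq_C_mul, map_ofNat C 2]

lemma phi_V₁ (hε₁ : ε₁ * ε₁ = 1) : phi a ε₁ ε₂ (V₁ a ε₁ c) = C a ^ 2 * C c * k₁ := by
  have h1 := C_mul_self hε₁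
  rw [phi_eq hε₁, covT_one, V₁_apply]
  simp
  linear_combination (2 * C a ^ 2 * C c * k₁) * h1

lemma psi_V₁ (hε₂ : ε₂ * ε₂ = 1) :
    psi a ε₁ ε₂ (V₁ a ε₁ c) = -(2 * C ε₁ * C ε₂ * C a ^ 2 * C c * k₂) := by
  rw [psi_eq hε₂, covT_three, V₁_apply]
  simp
  ring

lemma isEvolution_V₁ (hε₁ : ε₁ * ε₁ = 1) : IsEvolution a ε₁ ε₂ (V₁ a ε₁ c) := by
  have h2 : D (2 : DiffPoly) = 0 := Derivation.map_natCast _ 2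
  rw [isEvolution_iff hε₁, ← phi_eq hε₁, phi_V₁ hε₁, covT_zero, covT_two, V₁_apply]
  simp [Derivation.leibniz_pow, h2]
  ring

/-- The curvature flow of the null localized induction equation is a Hirota-Satsuma system. -/
lemma varK_V₁ (ha : a ≠ 0) (hε₁ : ε₁ * ε₁ = 1) (hε₂ : ε₂ * ε₂ = 1) :
    varK₁ a ε₁ ε₂ (V₁ a ε₁ c) = hsField c (3 * a * c) (6 * a * (ε₁ * ε₂) * c) 0 ∧
    varK₂ a ε₁ ε₂ (V₁ a ε₁ c) = hsField c (3 * a * c) (6 * a * (ε₁ * ε₂) * c) 1 := by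
  have h1 := C_mul_self hε₁
  have h2 := C_mul_self hε₂
  have hA := C_mul_C_inv ha
  have d2 : D (2 : DiffPoly) = 0 := Derivation.map_natCast _ 2
  have e1 : D (D (D k₁)) = MvPolynomial.X (0, 3) := by simp [D_eq_totalD, k₁]
  have e2 : D (D (D k₂)) = MvPolynomial.X (1, 3) := by simp [D_eq_totalD, k₂]
  have hE := isEvolution_V₁ (a := a) (ε₂ := ε₂) (c := c) hε₁
  rw [hE.varK₁_eq, hE.varK₂_eq, phi_V₁ hε₁, psi_V₁ hε₂]
  simp only [hsField, hsQuad, Matrix.cons_val_zero, Matrix.cons_val_one, ← e1, ← e2,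
    ← D_k₁, ← D_k₂, ← k₁_eq, ← k₂_eq, MvPolynomial.smul_eq_C_mul, map_mul, map_neg, map_ofNat,
    Derivation.leibniz, Derivation.leibniz_pow, smul_eq_mul, MvPolynomial.derivation_C, d2,
    mul_zero, add_zero, smul_zero]
  generalize (C a : DiffPoly) = A at *
  generalize (C a⁻¹ : DiffPoly) = B at *
  generalize (C ε₁ : DiffPoly) = e at *
  generalize (C ε₂ : DiffPoly) = f at *
  constructor <;> grind

lemma act_V₁ (ha : a ≠ 0) (hε₁ : ε₁ * ε₁ = 1) (hε₂ : ε₂ * ε₂ = 1) :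
    act a ε₁ ε₂ (V₁ a ε₁ c) = evolve (hsField c (3 * a * c) (6 * a * (ε₁ * ε₂) * c)) := by
  rw [(isEvolution_V₁ hε₁).act_eq, (varK_V₁ ha hε₁ hε₂).1, (varK_V₁ ha hε₁ hε₂).2]
  congr 1
  ext1 i
  fin_cases i <;> rfl

end NLIE

section NLIE

open MvPolynomial (C)

variable {a ε₁ ε₂ c : ℝ}

/-- The T and N components of U drop out. With U 1 = K₁/2 and U 3 = -ε₁ε₂K₂ this is half of the
first linearized Hirota-Satsuma equation for (K₁, K₂); `bracket_V₁_three` matches the second one in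
the same way. -/
lemma bracket_V₁_one (ha : a ≠ 0) (hε₁ : ε₁ * ε₁ = 1) (hε₂ : ε₂ * ε₂ = 1) {U : VecField}
    (hU : IsEvolution a ε₁ ε₂ U) :
    bracket a ε₁ ε₂ (V₁ a ε₁ c) U 1 = act a ε₁ ε₂ (V₁ a ε₁ c) (U 1) - C c * D (D (D (U 1))) -
      3 * C a * C c * D (k₁ * U 1) + 3 * C a * C c * D (k₂ * U 3) := by
  have h1 := C_mul_self hε₁
  have h2 := C_mul_self hε₂
  have hA := C_mul_C_inv ha
  have d2 : D (2 : DiffPoly) = 0 := Derivation.map_natCast _ 2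
  have hE := isEvolution_V₁ (a := a) (ε₂ := ε₂) (c := c) hε₁
  simp only [bracket, Pi.sub_apply, tensorD_one, hE.beta_eq, hU.beta_eq, phi_V₁ hε₁, psi_V₁ hε₂]
  rw [V₁_apply]
  simp only [Matrix.cons_val_zero, Matrix.cons_val_one, Matrix.cons_val, map_neg, map_add,
    map_sub, map_zero, Derivation.leibniz, Derivation.leibniz_pow, smul_eq_mul,
    MvPolynomial.derivation_C, d2, mul_zero, add_zero, smul_zero, hU.D_two hε₁, hU.D_zero ha hε₁,
    D_one_eq hε₁ (a := a) (ε₂ := ε₂) U, D_three_eq hε₂ (a := a) (ε₁ := ε₁) U]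
  generalize phi a ε₁ ε₂ U = φ
  generalize psi a ε₁ ε₂ U = ψ
  generalize (C a : DiffPoly) = A at *
  generalize (C a⁻¹ : DiffPoly) = B at *
  generalize (C ε₁ : DiffPoly) = e at *
  generalize (C ε₂ : DiffPoly) = f at *
  grind

lemma bracket_V₁_three (ha : a ≠ 0) (hε₁ : ε₁ * ε₁ = 1) (hε₂ : ε₂ * ε₂ = 1) {U : VecField}
    (hU : IsEvolution a ε₁ ε₂ U) :
    bracket a ε₁ ε₂ (V₁ a ε₁ c) U 3 = act a ε₁ ε₂ (V₁ a ε₁ c) (U 3) + 2 * C c * D (D (D (U 3))) -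
      6 * C a * C c * (C ε₁ * C ε₂) * (U 1 * D k₂) + 3 * C a * C c * (k₁ * D (U 3)) := by
  have h1 := C_mul_self hε₁
  have h2 := C_mul_self hε₂
  have hA := C_mul_C_inv ha
  have d2 : D (2 : DiffPoly) = 0 := Derivation.map_natCast _ 2
  have hE := isEvolution_V₁ (a := a) (ε₂ := ε₂) (c := c) hε₁
  simp only [bracket, Pi.sub_apply, tensorD_three, delta_eq, phi_V₁ hε₁, psi_V₁ hε₂]
  rw [V₁_apply]
  simp only [Matrix.cons_val_zero, Matrix.cons_val_one, Matrix.cons_val, map_neg, map_add,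
    map_sub, map_zero, Derivation.leibniz, Derivation.leibniz_pow, smul_eq_mul,
    MvPolynomial.derivation_C, d2, mul_zero, add_zero, smul_zero, hU.D_two hε₁,
    D_one_eq hε₁ (a := a) (ε₂ := ε₂) U, D_three_eq hε₂ (a := a) (ε₁ := ε₁) U]
  generalize phi a ε₁ ε₂ U = φ
  generalize psi a ε₁ ε₂ U = ψ
  generalize (C a : DiffPoly) = A at *
  generalize (C a⁻¹ : DiffPoly) = B at *
  generalize (C ε₁ : DiffPoly) = e at *
  generalize (C ε₂ : DiffPoly) = f at *
  grind

end NLIE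

/-! ### Symmetries lie in the domain of the recursion operator, which is invariant. -/

section Symmetries

open MvPolynomial (C)

variable {a ε₁ ε₂ c : ℝ}

/-- The second conserved density of the null localized induction equation. -/
noncomputable def energy (ε₁ ε₂ : ℝ) : DiffPoly :=
  C (1 / 4) * k₁ ^ 2 + C (ε₁ * ε₂ / 2) * k₂ ^ 2

/-- For h = V(k₁)/2 and l = -ε₁ε₂V(k₂) the right side is k₁h - k₂l, so the second integrability
condition says that the variation of the energy is a total derivative. -/
lemma act_energy (V : VecField) : act a ε₁ ε₂ V (energy ε₁ ε₂) =
    (1 / 2 : ℝ) • (MvPolynomial.X (0, 0) * varK₁ a ε₁ ε₂ V) +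
      (ε₁ * ε₂) • (MvPolynomial.X (1, 0) * varK₂ a ε₁ ε₂ V) := by
  have e1 : (2 : DiffPoly) * C (1 / 4) = C (1 / 2) := by
    rw [← map_ofNat C 2, ← map_mul]; norm_num
  have e2 : (2 : DiffPoly) * C (ε₁ * ε₂ / 2) = C (ε₁ * ε₂) := by
    rw [← map_ofNat C 2, ← map_mul]; congr 1; ring
  rw [energy, map_add, Derivation.leibniz, Derivation.leibniz, MvPolynomial.derivation_C,
    MvPolynomial.derivation_C, Derivation.leibniz_pow, Derivation.leibniz_pow, act_k₁, act_k₂,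
    ← k₁_eq, ← k₂_eq]
  simp only [MvPolynomial.smul_eq_C_mul, smul_eq_mul, nsmul_eq_mul, ← e1, ← e2]
  push_cast
  ring

lemma varK_V₁_eq (ha : a ≠ 0) (hε₁ : ε₁ * ε₁ = 1) (hε₂ : ε₂ * ε₂ = 1) :
    varK₁ a ε₁ ε₂ (V₁ a ε₁ c) = C c * D (D (D k₁)) + 3 * C a * C c * (k₁ * D k₁) +
      6 * C a * C c * (C ε₁ * C ε₂) * (k₂ * D k₂) ∧
    varK₂ a ε₁ ε₂ (V₁ a ε₁ c) = -(2 * C c * D (D (D k₂))) - 3 * C a * C c * (k₁ * D k₂) := by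
  have e1 : D (D (D k₁)) = MvPolynomial.X (0, 3) := by simp [D_eq_totalD, k₁]
  have e2 : D (D (D k₂)) = MvPolynomial.X (1, 3) := by simp [D_eq_totalD, k₂]
  rw [(varK_V₁ ha hε₁ hε₂).1, (varK_V₁ ha hε₁ hε₂).2]
  simp only [hsField, hsQuad, Matrix.cons_val_zero, Matrix.cons_val_one, ← e1, ← e2,
    ← D_k₁, ← D_k₂, ← k₁_eq, ← k₂_eq, MvPolynomial.smul_eq_C_mul, map_mul, map_neg, map_ofNat]
  constructor <;> ring

lemma exists_D_eq_varK₁_V₁ (ha : a ≠ 0) (hε₁ : ε₁ * ε₁ = 1) (hε₂ : ε₂ * ε₂ = 1) :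
    ∃ F, D F = varK₁ a ε₁ ε₂ (V₁ a ε₁ c) := by
  refine ⟨C c * D (D k₁) + C (3 / 2) * C a * C c * k₁ ^ 2 +
    3 * C a * C c * (C ε₁ * C ε₂) * k₂ ^ 2, ?_⟩
  have e1 : (2 : DiffPoly) * C (3 / 2) = 3 := by
    rw [← map_ofNat C 2, ← map_mul, ← map_ofNat C 3]; norm_num
  have d3 : D (3 : DiffPoly) = 0 := Derivation.map_natCast _ 3
  rw [(varK_V₁_eq ha hε₁ hε₂).1]
  simp only [map_add, Derivation.leibniz, Derivation.leibniz_pow, smul_eq_mul,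
    MvPolynomial.derivation_C, d3, mul_zero, add_zero]
  grind

lemma exists_D_eq_act_V₁_energy (ha : a ≠ 0) (hε₁ : ε₁ * ε₁ = 1) (hε₂ : ε₂ * ε₂ = 1) :
    ∃ F, D F = act a ε₁ ε₂ (V₁ a ε₁ c) (energy ε₁ ε₂) := by
  refine ⟨C (1 / 2) * C c * (k₁ * D (D k₁) - C (1 / 2) * D k₁ ^ 2) + C (1 / 2) * C a * C c * k₁ ^ 3 -
    2 * (C ε₁ * C ε₂) * C c * (k₂ * D (D k₂) - C (1 / 2) * D k₂ ^ 2), ?_⟩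
  have e1 : (2 : DiffPoly) * C (1 / 2) = 1 := by
    rw [← map_ofNat C 2, ← map_mul, ← map_one C]; norm_num
  have d2 : D (2 : DiffPoly) = 0 := Derivation.map_natCast _ 2
  rw [act_energy, (varK_V₁_eq ha hε₁ hε₂).1, (varK_V₁_eq ha hε₁ hε₂).2, ← k₁_eq, ← k₂_eq]
  simp only [map_add, map_sub, Derivation.leibniz, Derivation.leibniz_pow, smul_eq_mul,
    MvPolynomial.derivation_C, d2, mul_zero, add_zero, MvPolynomial.smul_eq_C_mul, map_mul]
  grind

lemma mem_recDomain_iff_energy {V : VecField} :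
    V ∈ recDomain a ε₁ ε₂ ↔ IsEvolution a ε₁ ε₂ V ∧ (∃ p, D p = varK₁ a ε₁ ε₂ V) ∧
      ∃ q, D q = act a ε₁ ε₂ V (energy ε₁ ε₂) := by
  rw [mem_recDomain_iff, act_energy]

/-- The flow and V both send the densities k₁ and `energy` to total derivatives and both commute
with ∂, so their commutator does the same. -/
lemma bracket_V₁_mem_recDomain (ha : a ≠ 0) (hε₁ : ε₁ * ε₁ = 1) (hε₂ : ε₂ * ε₂ = 1) {V : VecField}
    (hV : V ∈ recDomain a ε₁ ε₂) : bracket a ε₁ ε₂ (V₁ a ε₁ c) V ∈ recDomain a ε₁ ε₂ := by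
  rw [mem_recDomain_iff_energy] at hV ⊢
  obtain ⟨hV, ⟨p, hp⟩, q, hq⟩ := hV
  have hE := isEvolution_V₁ (a := a) (ε₂ := ε₂) (c := c) hε₁
  obtain ⟨F, hF⟩ := exists_D_eq_varK₁_V₁ (c := c) ha hε₁ hε₂
  obtain ⟨G, hG⟩ := exists_D_eq_act_V₁_energy (c := c) ha hε₁ hε₂
  refine ⟨hE.bracket ha hε₁ hε₂ hV, ⟨act a ε₁ ε₂ (V₁ a ε₁ c) p - act a ε₁ ε₂ V F, ?_⟩,
    act a ε₁ ε₂ (V₁ a ε₁ c) q - act a ε₁ ε₂ V G, ?_⟩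
  · rw [varK₁_bracket ha hε₁ hε₂ hE hV, map_sub, ← hE.act_D, ← hV.act_D, hp, hF]
  · rw [act_bracket ha hε₁ hε₂ hE hV, Derivation.commutator_apply, map_sub, ← hE.act_D, ← hV.act_D,
      hq, hG]

lemma IsSymmetry.commutator_eq_zero (ha : a ≠ 0) (hε₁ : ε₁ * ε₁ = 1) (hε₂ : ε₂ * ε₂ = 1)
    {V : VecField} (hV : IsSymmetry a ε₁ ε₂ c V) :
    ⁅act a ε₁ ε₂ (V₁ a ε₁ c), act a ε₁ ε₂ V⁆ = 0 := by
  have h0 : IsEvolution a ε₁ ε₂ 0 := by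
    rw [isEvolution_iff hε₁]; simp [covT_zero, covT_one, covT_two]
  have hp : phi a ε₁ ε₂ 0 = 0 := by simp [phi_eq hε₁, covT_one]
  have hq : psi a ε₁ ε₂ 0 = 0 := by simp [psi_eq hε₂, covT_three]
  rw [← act_bracket ha hε₁ hε₂ (isEvolution_V₁ hε₁) hV.1, hV.2, h0.act_eq, h0.varK₁_eq,
    h0.varK₂_eq, hp, hq]
  refine MvPolynomial.derivation_ext fun j => ?_
  obtain ⟨i, m⟩ := j
  rw [evolve_X]
  fin_cases i <;> simp

lemma isHSSymmetry_of_commutator (ha : a ≠ 0) (hε₁ : ε₁ * ε₁ = 1) (hε₂ : ε₂ * ε₂ = 1)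
    {V : VecField} (hV : IsEvolution a ε₁ ε₂ V)
    (h : ⁅act a ε₁ ε₂ (V₁ a ε₁ c), act a ε₁ ε₂ V⁆ = 0) :
    IsHSSymmetry c (3 * a * c) (6 * a * (ε₁ * ε₂) * c)
      ![varK₁ a ε₁ ε₂ V, varK₂ a ε₁ ε₂ V] := by
  intro i
  rw [← act_V₁ ha hε₁ hε₂, ← hV.act_eq]
  have hc := fun f => sub_eq_zero.mp ((Derivation.commutator_apply f).symm.trans
    (congrArg (fun d : Derivation ℝ DiffPoly DiffPoly => d f) h))
  fin_cases i
  · simpa [act_k₁, (varK_V₁ ha hε₁ hε₂).1] using hc k₁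
  · simpa [act_k₂, (varK_V₁ ha hε₁ hε₂).2] using hc k₂

/-- If V₁(f) = ∂F, then V₁(V(f)) = V(V₁(f)) = ∂V(F), so V(k₁) and V(energy) are conserved densities,
to which `IsHSSymmetry.exists_totalD_eq` applies. -/
lemma IsSymmetry.mem_recDomain (ha : a ≠ 0) (hε₁ : ε₁ * ε₁ = 1) (hε₂ : ε₂ * ε₂ = 1) (hc : c ≠ 0)
    {V : VecField} (hV : IsSymmetry a ε₁ ε₂ c V) : V ∈ recDomain a ε₁ ε₂ := by
  have hε : ε₁ * ε₂ ≠ 0 := fun h => by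
    have : (ε₁ * ε₂) * (ε₁ * ε₂) = 1 := by linear_combination ε₂ * ε₂ * hε₁ + hε₂
    simp [h] at this
  have hcomm := hV.commutator_eq_zero ha hε₁ hε₂
  have hc' := fun f => sub_eq_zero.mp ((Derivation.commutator_apply f).symm.trans
    (congrArg (fun d : Derivation ℝ DiffPoly DiffPoly => d f) hcomm))
  have hK := isHSSymmetry_of_commutator ha hε₁ hε₂ hV.1 hcomm
  obtain ⟨F, hF⟩ := exists_D_eq_varK₁_V₁ (c := c) ha hε₁ hε₂
  obtain ⟨G, hG⟩ := exists_D_eq_act_V₁_energy (c := c) ha hε₁ hε₂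
  rw [mem_recDomain_iff]
  refine ⟨hV.1, hK.exists_totalD_eq hc (by positivity) (by positivity) (fun i => ?_) _ _
    ⟨act a ε₁ ε₂ V G, ?_⟩ ⟨act a ε₁ ε₂ V F, ?_⟩⟩
  · fin_cases i
    exacts [hV.1.constantCoeff_varK₁, hV.1.constantCoeff_varK₂]
  · simp only [Matrix.cons_val_zero, Matrix.cons_val_one]
    rw [← act_energy, ← act_V₁ ha hε₁ hε₂, hc', ← hG, hV.1.act_D]; rfl
  · simp only [Matrix.cons_val_zero]
    rw [← act_k₁ V, ← act_V₁ ha hε₁ hε₂, hc', act_k₁, ← hF, hV.1.act_D]; rfl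

lemma constantCoeff_act {V : VecField} (hV : IsEvolution a ε₁ ε₂ V) (f : DiffPoly) :
    MvPolynomial.constantCoeff (act a ε₁ ε₂ V f) = 0 := by
  rw [hV.act_eq]
  refine constantCoeff_evolve (fun i => ?_) f
  fin_cases i
  exacts [hV.constantCoeff_varK₁, hV.constantCoeff_varK₂]

/-- `act` and `alpha` produce no constant terms, and neither field has any in its W₁ and W₂
components. This is why the constants in `bracket_V₁_recOp` are 0 on the right. -/
lemma constantCoeff_bracket_V₁ (hε₁ : ε₁ * ε₁ = 1) {U : VecField}
    (hU : IsEvolution a ε₁ ε₂ U) (h1 : MvPolynomial.constantCoeff (U 1) = 0)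
    (h3 : MvPolynomial.constantCoeff (U 3) = 0) :
    MvPolynomial.constantCoeff (bracket a ε₁ ε₂ (V₁ a ε₁ c) U 0) = 0 ∧
      MvPolynomial.constantCoeff (bracket a ε₁ ε₂ (V₁ a ε₁ c) U 2) = 0 := by
  have hE := isEvolution_V₁ (a := a) (ε₂ := ε₂) (c := c) hε₁
  rw [bracket, Pi.sub_apply, Pi.sub_apply, tensorD_zero, tensorD_zero, tensorD_two, tensorD_two]
  have v1 : V₁ a ε₁ c 1 = 0 := by rw [V₁_apply]; rfl
  have v3 : V₁ a ε₁ c 3 = 0 := by rw [V₁_apply]; rfl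
  simp [constantCoeff_act hE, constantCoeff_act hU, h1, h3, hE.alpha_eq, hU.alpha_eq, v1, v3]

/-- Both sides are evolution fields, so `IsEvolution.ext` reduces the claim to the W₁ and W₂
components, where it is the linearized curvature flow, and to two constant terms. -/
theorem bracket_V₁_recOp (ha : a ≠ 0) (hε₁ : ε₁ * ε₁ = 1) (hε₂ : ε₂ * ε₂ = 1) {V : VecField}
    (hV : V ∈ recDomain a ε₁ ε₂) (c₁ c₂ : ℝ) :
    bracket a ε₁ ε₂ (V₁ a ε₁ c) (recOp a ε₁ ε₂ c₁ c₂ V) =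
      recOp a ε₁ ε₂ 0 0 (bracket a ε₁ ε₂ (V₁ a ε₁ c) V) := by
  have h1 := C_mul_self hε₁
  have h2 := C_mul_self hε₂
  have hE := isEvolution_V₁ (a := a) (ε₂ := ε₂) (c := c) hε₁
  have hR := IsEvolution.recOp ha hε₁ c₁ c₂ hV
  have hW := bracket_V₁_mem_recDomain (c := c) ha hε₁ hε₂ hV
  have hk : ∀ f, act a ε₁ ε₂ V (D f) = D (act a ε₁ ε₂ V f) := hV.1.act_D
  have a3 : act a ε₁ ε₂ V (3 : DiffPoly) = 0 := Derivation.map_natCast _ 3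
  have a2 : act a ε₁ ε₂ V (2 : DiffPoly) = 0 := Derivation.map_natCast _ 2
  have a6 : act a ε₁ ε₂ V (6 : DiffPoly) = 0 := Derivation.map_natCast _ 6
  have e1 : (2 : DiffPoly) * C (1 / 2) = 1 := by
    rw [← map_ofNat C 2, ← map_mul, ← map_one C]; norm_num
  have hcomp : ∀ (d₁ d₂ : ℝ) (U : VecField), U ∈ recDomain a ε₁ ε₂ →
      recOp a ε₁ ε₂ d₁ d₂ U 1 = C (1 / 2) * varK₁ a ε₁ ε₂ U ∧
      recOp a ε₁ ε₂ d₁ d₂ U 3 = -(C ε₁ * C ε₂ * varK₂ a ε₁ ε₂ U) ∧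
      MvPolynomial.constantCoeff (recOp a ε₁ ε₂ 0 0 U 0) = 0 ∧
      MvPolynomial.constantCoeff (recOp a ε₁ ε₂ 0 0 U 2) = 0 := by
    rintro d₁ d₂ U ⟨-, -, -, p, hp0, q, hq0, hp, hq⟩
    rw [recOp, recOp, calX_eq _ _ hp0 hp hq0 hq, calX_eq _ _ hp0 hp hq0 hq]
    rw [P₀, Set.mem_ofPred_eq] at hp0 hq0
    simp [MvPolynomial.smul_eq_C_mul, hp0, hq0]
  obtain ⟨u1, u3, -, -⟩ := hcomp c₁ c₂ V hV
  obtain ⟨w1, w3, w0, w2⟩ := hcomp 0 0 _ hW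
  obtain ⟨b0, b2⟩ := constantCoeff_bracket_V₁ (c := c) hε₁ hR
    (by rw [u1, map_mul, hV.1.constantCoeff_varK₁, mul_zero])
    (by rw [u3, map_neg, map_mul, hV.1.constantCoeff_varK₂, mul_zero, neg_zero])
  refine (hE.bracket ha hε₁ hε₂ hR).ext ha hε₁ (IsEvolution.recOp ha hε₁ 0 0 hW) ?_ ?_
    (b0.trans w0.symm) (b2.trans w2.symm)
  · rw [w1, bracket_V₁_one ha hε₁ hε₂ hR, u1, u3, varK₁_bracket ha hε₁ hε₂ hE hV.1,
      (varK_V₁_eq ha hε₁ hε₂).1]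
    simp only [map_add, map_neg, Derivation.leibniz, smul_eq_mul, MvPolynomial.derivation_C, hk,
      act_k₁, act_k₂, a3, a6, mul_zero, add_zero]
    grind
  · rw [w3, bracket_V₁_three ha hε₁ hε₂ hR, u1, u3, varK₂_bracket ha hε₁ hε₂ hE hV.1,
      (varK_V₁_eq ha hε₁ hε₂).2]
    simp only [map_sub, map_neg, Derivation.leibniz, smul_eq_mul, MvPolynomial.derivation_C, hk,
      act_k₁, act_k₂, a2, a3, mul_zero, add_zero]
    grind

lemma recOp_zero : recOp a ε₁ ε₂ 0 0 0 = 0 := by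
  have h1 : varK₁ a ε₁ ε₂ 0 = 0 := by
    simp [varK₁, theta, opS, phi, psi, rho, metric, covT]
  have h2 : varK₂ a ε₁ ε₂ 0 = 0 := by
    simp [varK₂, theta, opS, phi, psi, rho, metric, covT]
  rw [recOp, h1, h2, smul_zero, smul_zero, neg_zero,
    calX_eq 0 0 (p := 0) (q := 0) (by simp) (by simp) (by simp) (by simp)]
  ext1 i
  fin_cases i <;> simp

theorem IsSymmetry.recOp (ha : a ≠ 0) (hε₁ : ε₁ * ε₁ = 1) (hε₂ : ε₂ * ε₂ = 1) (hc : c ≠ 0)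
    {V : VecField} (hV : IsSymmetry a ε₁ ε₂ c V) (c₁ c₂ : ℝ) :
    IsSymmetry a ε₁ ε₂ c (recOp a ε₁ ε₂ c₁ c₂ V) := by
  have hm := hV.mem_recDomain ha hε₁ hε₂ hc
  exact ⟨IsEvolution.recOp ha hε₁ c₁ c₂ hm, by
    rw [bracket_V₁_recOp ha hε₁ hε₂ hm, hV.2, recOp_zero]⟩

end Symmetries

/-! ### The hierarchy and the commutation of symmetries. -/

section Hierarchy

open MvPolynomial (C)

variable {a ε₁ ε₂ b c : ℝ}

lemma phi_V₀ (hε₁ : ε₁ * ε₁ = 1) : phi a ε₁ ε₂ (V₀ b) = C a * C b := by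
  rw [phi_eq hε₁, covT_one]
  simp [V₀, T, MvPolynomial.smul_eq_C_mul]

lemma psi_V₀ (hε₂ : ε₂ * ε₂ = 1) : psi a ε₁ ε₂ (V₀ b) = 0 := by
  rw [psi_eq hε₂, covT_three]
  simp [V₀, T]

lemma isEvolution_V₀ (hε₁ : ε₁ * ε₁ = 1) : IsEvolution a ε₁ ε₂ (V₀ b) := by
  rw [isEvolution_iff hε₁, ← phi_eq hε₁, phi_V₀ hε₁, covT_zero, covT_two]
  simp [V₀, T, MvPolynomial.smul_eq_C_mul]

lemma act_V₀ (ha : a ≠ 0) (hε₁ : ε₁ * ε₁ = 1) (hε₂ : ε₂ * ε₂ = 1) (f : DiffPoly) :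
    act a ε₁ ε₂ (V₀ b) f = C b * D f := by
  have hA := C_mul_C_inv ha
  have hE := isEvolution_V₀ (a := a) (b := b) (ε₂ := ε₂) hε₁
  have h : act a ε₁ ε₂ (V₀ b) = b • D := by
    refine eq_of_comm_totalD hE.act_D (fun f => ?_) fun i => ?_
    · rw [Derivation.smul_apply, Derivation.smul_apply, D_eq_totalD, Derivation.map_smul]
    · have h1 := hE.varK₁_eq
      have h2 := hE.varK₂_eq
      rw [phi_V₀ hε₁, psi_V₀ hε₂] at h1 h2
      simp only [Derivation.leibniz, MvPolynomial.derivation_C, smul_eq_mul, mul_zero, add_zero,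
        map_zero, zero_add, sub_zero] at h1 h2
      rw [Derivation.smul_apply, MvPolynomial.smul_eq_C_mul]
      fin_cases i
      · simp only [Fin.zero_eta, ← k₁_eq, act_k₁, h1]
        linear_combination (C b * D k₁) * hA
      · simp only [Fin.mk_one, ← k₂_eq, act_k₂, h2]
        linear_combination (C b * D k₂) * hA
  rw [h, Derivation.smul_apply, MvPolynomial.smul_eq_C_mul]

/-- `V₀` acts as b∂, which commutes with every evolution field, so [V₁, V₀] acts trivially on the
curvatures and vanishes. -/
lemma isSymmetry_V₀ (ha : a ≠ 0) (hε₁ : ε₁ * ε₁ = 1) (hε₂ : ε₂ * ε₂ = 1) :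
    IsSymmetry a ε₁ ε₂ c (V₀ b) := by
  have h0 := isEvolution_V₀ (a := a) (b := b) (ε₂ := ε₂) hε₁
  have h1 := isEvolution_V₁ (a := a) (c := c) (ε₂ := ε₂) hε₁
  refine ⟨h0, (h1.bracket ha hε₁ hε₂ h0).eq_zero_of_varK ha hε₁ hε₂ ?_ ?_⟩
  · rw [varK₁_bracket ha hε₁ hε₂ h1 h0, ← act_k₁, ← act_k₁ (V₁ a ε₁ c), act_V₀ ha hε₁ hε₂,
      act_V₀ ha hε₁ hε₂, Derivation.leibniz, MvPolynomial.derivation_C, h1.act_D]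
    simp
  · rw [varK₂_bracket ha hε₁ hε₂ h1 h0, ← act_k₂, ← act_k₂ (V₁ a ε₁ c), act_V₀ ha hε₁ hε₂,
      act_V₀ ha hε₁ hε₂, Derivation.leibniz, MvPolynomial.derivation_C, h1.act_D]
    simp

lemma isSymmetry_V₁ (hε₁ : ε₁ * ε₁ = 1) : IsSymmetry a ε₁ ε₂ c (V₁ a ε₁ c) :=
  ⟨isEvolution_V₁ hε₁, sub_self _⟩

theorem isSymmetry_hierarchy (ha : a ≠ 0) (hε₁ : ε₁ * ε₁ = 1) (hε₂ : ε₂ * ε₂ = 1) (hc : c ≠ 0)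
    (c₁ c₂ : ℕ → ℝ) (n : ℕ) : IsSymmetry a ε₁ ε₂ c (hierarchy a ε₁ ε₂ b c c₁ c₂ n) := by
  induction n using Nat.twoStepInduction with
  | zero => exact isSymmetry_V₀ ha hε₁ hε₂
  | one => exact isSymmetry_V₁ hε₁
  | more n ih _ => exact ih.recOp ha hε₁ hε₂ hc _ _

/-- The symmetries of the null localized induction equation commute. -/
theorem IsSymmetry.bracket_eq_zero (ha : a ≠ 0) (hε₁ : ε₁ * ε₁ = 1) (hε₂ : ε₂ * ε₂ = 1)
    (hc : c ≠ 0) {V U : VecField} (hV : IsSymmetry a ε₁ ε₂ c V) (hU : IsSymmetry a ε₁ ε₂ c U) :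
    bracket a ε₁ ε₂ V U = 0 := by
  have hW := hV.1.bracket ha hε₁ hε₂ hU.1
  have hVc := hV.commutator_eq_zero ha hε₁ hε₂
  have hUc := hU.commutator_eq_zero ha hε₁ hε₂
  have hKV := isHSSymmetry_of_commutator ha hε₁ hε₂ hV.1 hVc
  have hKU := isHSSymmetry_of_commutator ha hε₁ hε₂ hU.1 hUc
  have h0 : ∀ {W : VecField}, IsEvolution a ε₁ ε₂ W → ∀ i, MvPolynomial.constantCoeff
      ((![varK₁ a ε₁ ε₂ W, varK₂ a ε₁ ε₂ W] : Fin 2 → DiffPoly) i) = 0 := by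
    intro W hW i
    fin_cases i
    exacts [hW.constantCoeff_varK₁, hW.constantCoeff_varK₂]
  -- Jacobi identity: both actions commute with that of `V₁`, hence so does their commutator.
  have hKW := isHSSymmetry_of_commutator (c := c) ha hε₁ hε₂ hW (by
    rw [act_bracket ha hε₁ hε₂ hV.1 hU.1]
    refine Derivation.ext fun f => ?_
    have hB := fun f => sub_eq_zero.mp ((Derivation.commutator_apply f).symm.trans
      (congrArg (fun d : Derivation ℝ DiffPoly DiffPoly => d f) hVc))
    have hC := fun f => sub_eq_zero.mp ((Derivation.commutator_apply f).symm.trans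
      (congrArg (fun d : Derivation ℝ DiffPoly DiffPoly => d f) hUc))
    simp only [Derivation.commutator_apply, map_sub, hB, hC, sub_self, Derivation.zero_apply])
  -- The linear parts of V and U are diagonal, so their symbols multiply commutatively and the
  -- commutator has no linear part.
  have hlin : ∀ l z, linSymbol l z (varK₁ a ε₁ ε₂ (NullCurve.bracket a ε₁ ε₂ V U)) = 0 ∧
      linSymbol l z (varK₂ a ε₁ ε₂ (NullCurve.bracket a ε₁ ε₂ V U)) = 0 := by
    intro l z
    have v1 := hKV.linSymbol_one_zero hc (h0 hV.1) z
    have v2 := hKV.linSymbol_zero_one hc (h0 hV.1) z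
    have u1 := hKU.linSymbol_one_zero hc (h0 hU.1) z
    have u2 := hKU.linSymbol_zero_one hc (h0 hU.1) z
    have eV := fun f => constantCoeff_jetShift_evolve l z (h0 hV.1) f
    have eU := fun f => constantCoeff_jetShift_evolve l z (h0 hU.1) f
    simp only [linSymbol, Matrix.cons_val_zero, Matrix.cons_val_one] at *
    simp only [← hV.1.act_eq, ← hU.1.act_eq] at eV eU
    rw [varK₁_bracket ha hε₁ hε₂ hV.1 hU.1, varK₂_bracket ha hε₁ hε₂ hV.1 hU.1]
    simp only [map_sub, eV, eU, v1, u1, v2, u2, mul_zero, add_zero, zero_add]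
    fin_cases l
    · simp only [Fin.zero_eta, v2, u2]
      exact ⟨by ring, by ring⟩
    · simp only [Fin.mk_one, v1, u1]
      exact ⟨by ring, by ring⟩
  have hz := hKW.eq_zero hc (h0 hW) fun i j => by
    obtain ⟨l, m⟩ := j
    refine constantCoeff_pderiv_eq_zero (Set.infinite_univ.mono fun z _ => ?_) m
    fin_cases i
    exacts [(hlin l z).1, (hlin l z).2]
  exact hW.eq_zero_of_varK ha hε₁ hε₂ (hz 0) (hz 1)

end Hierarchy

/-! ### Evaluation along null curves. -/

section Curves

variable {q : ℕ} {a ε₁ ε₂ : ℝ} (γ : CartanCurve q a ε₁ ε₂)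

/-- The value of a differential polynomial at a point of a null curve. -/
noncomputable def CartanCurve.evalAt (f : DiffPoly) (s : ℝ) : ℝ :=
  MvPolynomial.aeval (fun j : Fin 2 × ℕ => iteratedDeriv j.2 (γ.k j.1) s) f

lemma CartanCurve.contDiffOn_iteratedDeriv (i : Fin 2) (m : ℕ) :
    ContDiffOn ℝ ∞ (iteratedDeriv m (γ.k i)) γ.I := by
  induction m with
  | zero => rw [iteratedDeriv_zero]; exact γ.smooth_k i
  | succ m ih =>
    rw [iteratedDeriv_succ]
    exact ((contDiffOn_infty_iff_deriv_of_isOpen γ.isOpen_I).mp ih).2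

lemma CartanCurve.contDiffOn_evalAt (f : DiffPoly) : ContDiffOn ℝ ∞ (γ.evalAt f) γ.I := by
  have : γ.evalAt f =
      fun s => MvPolynomial.aeval (fun j : Fin 2 × ℕ => iteratedDeriv j.2 (γ.k j.1) s) f := rfl
  rw [this]
  induction f using MvPolynomial.induction_on with
  | C r => simpa using contDiffOn_const
  | add f g hf hg => simpa using (hf rfl).add (hg rfl)
  | mul_X f j hf => simpa using (hf rfl).mul (γ.contDiffOn_iteratedDeriv j.1 j.2)

lemma CartanCurve.hasDerivAt_evalAt (f : DiffPoly) {s : ℝ} (hs : s ∈ γ.I) :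
    HasDerivAt (γ.evalAt f) (γ.evalAt (D f) s) s := by
  have hj : ∀ j : Fin 2 × ℕ, HasDerivAt (fun s => iteratedDeriv j.2 (γ.k j.1) s)
      (iteratedDeriv (j.2 + 1) (γ.k j.1) s) s := fun j => by
    rw [iteratedDeriv_succ]
    exact (((γ.contDiffOn_iteratedDeriv j.1 j.2).contDiffAt
      (γ.isOpen_I.mem_nhds hs)).differentiableAt (by simp)).hasDerivAt
  have : γ.evalAt f =
      fun s => MvPolynomial.aeval (fun j : Fin 2 × ℕ => iteratedDeriv j.2 (γ.k j.1) s) f := rfl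
  rw [this, CartanCurve.evalAt]
  clear this
  induction f using MvPolynomial.induction_on with
  | C r => simpa using hasDerivAt_const s r
  | add f g hf hg =>
    simp only [map_add]
    exact hf.add hg
  | mul_X f j hf =>
    simp only [map_mul, MvPolynomial.aeval_X]
    refine (hf.mul (hj j)).congr_deriv ?_
    rw [Derivation.leibniz, D_eq_totalD, totalD_X]
    simp only [map_add, map_mul, smul_eq_mul, MvPolynomial.aeval_X]
    ring

lemma CartanCurve.along_eq (V : VecField) (s : ℝ) :
    γ.along V s = γ.evalAt (V 0) s • γ.e 0 s + γ.evalAt (V 1) s • γ.e 1 s +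
      γ.evalAt (V 2) s • γ.e 2 s + γ.evalAt (V 3) s • γ.e 3 s := by
  rw [CartanCurve.along, Fin.sum_univ_four]; rfl

lemma CartanCurve.hasDerivAt_along (V : VecField) {s : ℝ} (hs : s ∈ γ.I) :
    HasDerivAt (γ.along V) (γ.along (covT a ε₁ ε₂ V) s) s := by
  have hV : γ.along V = fun s => γ.evalAt (V 0) s • γ.e 0 s + γ.evalAt (V 1) s • γ.e 1 s +
      γ.evalAt (V 2) s • γ.e 2 s + γ.evalAt (V 3) s • γ.e 3 s := funext (γ.along_eq V)
  have h := ((((γ.hasDerivAt_evalAt (V 0) hs).smul (γ.deriv_T s hs)).add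
    ((γ.hasDerivAt_evalAt (V 1) hs).smul (γ.deriv_W₁ s hs))).add
    ((γ.hasDerivAt_evalAt (V 2) hs).smul (γ.deriv_N s hs))).add
    ((γ.hasDerivAt_evalAt (V 3) hs).smul (γ.deriv_W₂ s hs))
  rw [hV]
  refine h.congr_deriv ?_
  rw [γ.along_eq, covT_zero, covT_one, covT_two, covT_three]
  have e0 : γ.evalAt k₁ s = γ.k 0 s := by simp [CartanCurve.evalAt, k₁]
  have e1 : γ.evalAt k₂ s = γ.k 1 s := by simp [CartanCurve.evalAt, k₂]
  simp only [CartanCurve.evalAt] at e0 e1 ⊢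
  ext i
  simp only [map_add, map_sub, map_mul, MvPolynomial.aeval_C, e0, e1, Pi.add_apply, Pi.smul_apply,
    Pi.neg_apply, smul_eq_mul, Algebra.algebraMap_self, RingHom.id_apply]
  ring

lemma CartanCurve.pseudoInner_along (V : VecField) {s : ℝ} (hs : s ∈ γ.I) :
    pseudoInner q (γ.along V s) (γ.e 0 s) = -γ.evalAt (V 2) s ∧
      pseudoInner q (γ.along V s) (γ.e 1 s) = ε₁ * γ.evalAt (V 1) s := by
  have h : ∀ y, pseudoInner q (γ.along V s) y = γ.evalAt (V 0) s * pseudoInner q (γ.e 0 s) y +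
      γ.evalAt (V 1) s * pseudoInner q (γ.e 1 s) y +
      γ.evalAt (V 2) s * pseudoInner q (γ.e 2 s) y +
      γ.evalAt (V 3) s * pseudoInner q (γ.e 3 s) y := fun y => by
    rw [γ.along_eq]
    simp only [pseudoInner, Fin.sum_univ_four, Pi.add_apply, Pi.smul_apply, smul_eq_mul]
    ring
  rw [h, h]
  simp [γ.gram s hs]
  ring

/-- Evolution fields are tangent to the space of pseudo arc-length parametrized null curves. -/
theorem CartanCurve.isTangent_along {V : VecField} (hV : IsEvolution a ε₁ ε₂ V) :
    γ.IsTangent (γ.along V) := by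
  have hd : ∀ (U : VecField), ∀ s ∈ γ.I, deriv (γ.along U) s = γ.along (covT a ε₁ ε₂ U) s :=
    fun U s hs => (γ.hasDerivAt_along U hs).deriv
  refine ⟨?_, fun s hs => ⟨?_, ?_⟩⟩
  · exact ContDiffOn.sum fun i _ => (γ.contDiffOn_evalAt (V i)).smul (γ.smooth_e i)
  · have h : covT a ε₁ ε₂ V 2 = 0 := by simpa [metric_T] using hV.1
    rw [hd V s hs, (γ.pseudoInner_along _ hs).1, h, CartanCurve.evalAt, map_zero, neg_zero]
  · have h : ε₁ • covT a ε₁ ε₂ (covT a ε₁ ε₂ V) 1 = 0 := by simpa [metric_W₁] using hV.2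
    -- The formula for the first derivative holds only on `γ.I`; openness of `γ.I` allows it to be
    -- differentiated again at s.
    have he : deriv (γ.along V) =ᶠ[nhds s] γ.along (covT a ε₁ ε₂ V) :=
      Filter.eventuallyEq_of_mem (γ.isOpen_I.mem_nhds hs) (hd V)
    rw [he.deriv_eq, hd _ s hs, (γ.pseudoInner_along _ hs).2, CartanCurve.evalAt, ← smul_eq_mul,
      ← map_smul, h, map_zero]

end Curves

/-! ### Linear independence of the hierarchy. -/

section Independence

open MvPolynomial (C)

variable {a ε₁ ε₂ b c : ℝ}

/-- The linear symbol of the variation of `k₁` along an evolution field. -/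
noncomputable def curvatureSymbol (a ε₁ ε₂ : ℝ) : VecField →ₗ[ℝ] ℝ → ℝ where
  toFun V z := a⁻¹ * (a⁻¹ * z ^ 3 * linSymbol 0 z (covT a ε₁ ε₂ V 1) +
    z * MvPolynomial.constantCoeff (covT a ε₁ ε₂ V 1))
  map_add' V U := by
    ext z
    simp [covT_one, linSymbol]
    ring
  map_smul' r V := by
    ext z
    simp [covT_one, linSymbol, MvPolynomial.smul_eq_C_mul]
    ring

lemma linSymbol_varK₁ (hε₁ : ε₁ * ε₁ = 1) {V : VecField} (hV : IsEvolution a ε₁ ε₂ V) (z : ℝ) :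
    linSymbol 0 z (varK₁ a ε₁ ε₂ V) = curvatureSymbol a ε₁ ε₂ V z := by
  rw [hV.varK₁_eq, phi_eq hε₁, k₁_eq, k₂_eq]
  simp [curvatureSymbol, linSymbol, D_eq_totalD, jetShift_totalD, jetShift_X]
  exact Or.inl (by ring)

/-- R raises the degree of the symbol by 4, while the constants of integration affect only z³ and z.
The antiderivative of k₁h - k₂l plays no role, as that expression has no linear terms. -/
lemma curvatureSymbol_recOp (ha : a ≠ 0) (hε₁ : ε₁ * ε₁ = 1) (c₁ c₂ : ℝ) {V : VecField}
    (hV : V ∈ recDomain a ε₁ ε₂) (z : ℝ) :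
    curvatureSymbol a ε₁ ε₂ (recOp a ε₁ ε₂ c₁ c₂ V) z =
      1 / (4 * a ^ 2) * z ^ 4 * curvatureSymbol a ε₁ ε₂ V z - ε₁ * c₁ / (2 * a ^ 2) * z ^ 3 +
        c₂ * z := by
  have hA := linSymbol_varK₁ hε₁ hV.1 z
  have hK := hV.1.constantCoeff_varK₁
  have hK' := hV.1.constantCoeff_varK₂
  obtain ⟨-, -, -, p, hp0, q, hq0, hp, hq⟩ := hV
  dsimp only at hp hq
  rw [← hA, recOp, calX_eq c₁ c₂ hp0 hp hq0 hq]
  rw [P₀, Set.mem_ofPred_eq] at hp0 hq0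
  have hzq : z * linSymbol 0 z q = 0 := by
    rw [← linSymbol_totalD, ← D_eq_totalD, hq]
    simp [linSymbol, hK, hK']
  simp only [curvatureSymbol, LinearMap.coe_mk, AddHom.coe_mk, covT_one]
  simp only [linSymbol] at hzq ⊢
  simp [k₁, D_eq_totalD, jetShift_totalD, jetShift_X, hp0, hq0, MvPolynomial.smul_eq_C_mul]
  field_simp
  linear_combination (8 * z ^ 2 * a) * hzq

/-- The symbols of the fields of the hierarchy. -/
noncomputable def hierarchySymbol (a ε₁ b c : ℝ) (c₁ c₂ : ℕ → ℝ) : ℕ → Polynomial ℝ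
  | 0 => Polynomial.C b * Polynomial.X ^ 1
  | 1 => Polynomial.C c * Polynomial.X ^ 3
  | n + 2 => Polynomial.C (1 / (4 * a ^ 2)) * Polynomial.X ^ 4 * hierarchySymbol a ε₁ b c c₁ c₂ n -
      Polynomial.C (ε₁ * c₁ n / (2 * a ^ 2)) * Polynomial.X ^ 3 +
      Polynomial.C (c₂ n) * Polynomial.X ^ 1

lemma degree_hierarchySymbol (ha : a ≠ 0) (hb : b ≠ 0) (hc : c ≠ 0) (c₁ c₂ : ℕ → ℝ) (n : ℕ) :
    (hierarchySymbol a ε₁ b c c₁ c₂ n).degree = ((2 * n + 1 : ℕ) : WithBot ℕ) := by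
  induction n using Nat.twoStepInduction with
  | zero => rw [hierarchySymbol, Polynomial.degree_C_mul_X_pow _ hb]
  | one => rw [hierarchySymbol, Polynomial.degree_C_mul_X_pow _ hc]
  | more n ih _ =>
    have h1 : (Polynomial.C (1 / (4 * a ^ 2)) * Polynomial.X ^ 4 *
        hierarchySymbol a ε₁ b c c₁ c₂ n).degree = ((2 * (n + 2) + 1 : ℕ) : WithBot ℕ) := by
      rw [Polynomial.degree_mul, Polynomial.degree_C_mul_X_pow _ (by positivity), ih, ← Nat.cast_add]
      congr 1
      ring
    have hlt : ∀ (r : ℝ) (k : ℕ), k < 2 * (n + 2) + 1 →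
        (Polynomial.C r * Polynomial.X ^ k).degree < ((2 * (n + 2) + 1 : ℕ) : WithBot ℕ) :=
      fun r k hk => (Polynomial.degree_C_mul_X_pow_le k r).trans_lt (by exact_mod_cast hk)
    have h2 := Polynomial.degree_sub_eq_left_of_degree_lt
      ((hlt (ε₁ * c₁ n / (2 * a ^ 2)) 3 (by lia)).trans_eq h1.symm)
    rw [hierarchySymbol, Polynomial.degree_add_eq_left_of_degree_lt, h2, h1]
    rw [h2, h1]
    exact hlt _ 1 (by lia)

lemma linearIndependent_hierarchySymbol (ha : a ≠ 0) (hb : b ≠ 0) (hc : c ≠ 0) (c₁ c₂ : ℕ → ℝ) :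
    LinearIndependent ℝ (hierarchySymbol a ε₁ b c c₁ c₂) := by
  -- The symbols have the odd degrees 2n+1; powers of X fill in the even degrees to give one
  -- polynomial in each degree.
  let S : Polynomial.Sequence ℝ :=
    { elems' := fun m => if Odd m then hierarchySymbol a ε₁ b c c₁ c₂ (m / 2) else Polynomial.X ^ m
      degree_eq' := fun m => by
        split_ifs with h
        · obtain ⟨k, rfl⟩ := h
          rw [degree_hierarchySymbol ha hb hc, show (2 * k + 1) / 2 = k by lia]
        · exact Polynomial.degree_X_pow m }
  have h := S.linearIndependent.comp (fun n => 2 * n + 1) fun m n h => by simpa using h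
  have he : hierarchySymbol a ε₁ b c c₁ c₂ = S ∘ fun n => 2 * n + 1 := by
    ext1 n
    change _ = if Odd (2 * n + 1) then _ else _
    rw [if_pos ⟨n, rfl⟩, show (2 * n + 1) / 2 = n by lia]
  rw [he]
  exact h

lemma curvatureSymbol_hierarchy (ha : a ≠ 0) (hε₁ : ε₁ * ε₁ = 1) (hε₂ : ε₂ * ε₂ = 1) (hc : c ≠ 0)
    (c₁ c₂ : ℕ → ℝ) (n : ℕ) (z : ℝ) :
    curvatureSymbol a ε₁ ε₂ (hierarchy a ε₁ ε₂ b c c₁ c₂ n) z =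
      (hierarchySymbol a ε₁ b c c₁ c₂ n).eval z := by
  induction n using Nat.twoStepInduction with
  | zero =>
    simp only [curvatureSymbol, LinearMap.coe_mk, AddHom.coe_mk, hierarchy, hierarchySymbol,
      ← phi_eq hε₁, phi_V₀ hε₁]
    simp [linSymbol]
    field_simp
  | one =>
    simp only [curvatureSymbol, LinearMap.coe_mk, AddHom.coe_mk, hierarchy, hierarchySymbol,
      ← phi_eq hε₁, phi_V₁ hε₁]
    simp [linSymbol, k₁, jetShift_X]
    field_simp
  | more n ih _ =>
    rw [hierarchy, curvatureSymbol_recOp ha hε₁ _ _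
      ((isSymmetry_hierarchy ha hε₁ hε₂ hc c₁ c₂ n).mem_recDomain ha hε₁ hε₂ hc), ih]
    simp [hierarchySymbol]

theorem linearIndependent_hierarchy (ha : a ≠ 0) (hε₁ : ε₁ * ε₁ = 1) (hε₂ : ε₂ * ε₂ = 1)
    (hb : b ≠ 0) (hc : c ≠ 0) (c₁ c₂ : ℕ → ℝ) :
    LinearIndependent ℝ (hierarchy a ε₁ ε₂ b c c₁ c₂) := by
  refine LinearIndependent.of_comp (curvatureSymbol a ε₁ ε₂) ?_
  have h := (linearIndependent_hierarchySymbol (ε₁ := ε₁) ha hb hc c₁ c₂).map'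
    (LinearMap.pi fun z : ℝ => Polynomial.leval z) (LinearMap.ker_eq_bot.mpr fun f g h =>
      Polynomial.funext fun z => congrFun h z)
  have he : curvatureSymbol a ε₁ ε₂ ∘ hierarchy a ε₁ ε₂ b c c₁ c₂ =
      (LinearMap.pi fun z : ℝ => Polynomial.leval z) ∘ hierarchySymbol a ε₁ b c c₁ c₂ := by
    ext n z
    exact curvatureSymbol_hierarchy ha hε₁ hε₂ hc c₁ c₂ n z
  rw [he]
  exact h

end Independence

end NullCurve

theorem proposition6 (a ε₁ ε₂ b c : ℝ) (ha : 0 < a) (hε₁ : ε₁ = 1 ∨ ε₁ = -1)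
    (hε₂ : ε₂ = 1 ∨ ε₂ = -1) (hc : c ≠ 0) :
    -- `R` is defined on every symmetry and maps symmetries to symmetries
    (∀ V : VecField, IsSymmetry a ε₁ ε₂ c V →
      V ∈ recDomain a ε₁ ε₂ ∧
        ∀ c₁ c₂ : ℝ, IsSymmetry a ε₁ ε₂ c (recOp a ε₁ ε₂ c₁ c₂ V)) ∧
    -- `R` is linear, up to the choice of the constants of integration
    (∀ V ∈ recDomain a ε₁ ε₂, ∀ U ∈ recDomain a ε₁ ε₂, ∀ r s : ℝ,
      r • V + s • U ∈ recDomain a ε₁ ε₂ ∧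
        ∀ c₁ c₂ d₁ d₂ : ℝ,
          recOp a ε₁ ε₂ (r * c₁ + s * d₁) (r * c₂ + s * d₂) (r • V + s • U) =
            r • recOp a ε₁ ε₂ c₁ c₂ V + s • recOp a ε₁ ε₂ d₁ d₂ U) ∧
    -- `R` is invariant under the flow: the Lie derivative of `R` along `V₁` vanishes
    (∀ V ∈ recDomain a ε₁ ε₂,
      bracket a ε₁ ε₂ (V₁ a ε₁ c) V ∈ recDomain a ε₁ ε₂ ∧
        ∀ c₁ c₂ : ℝ,
          IsEvolution a ε₁ ε₂ (recOp a ε₁ ε₂ c₁ c₂ V) ∧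
            bracket a ε₁ ε₂ (V₁ a ε₁ c) (recOp a ε₁ ε₂ c₁ c₂ V) =
              recOp a ε₁ ε₂ 0 0 (bracket a ε₁ ε₂ (V₁ a ε₁ c) V)) ∧
    -- the iterates of `R` on `V₀` and `V₁` form an infinite hierarchy of commuting symmetries
    (∀ c₁ c₂ : ℕ → ℝ,
      (∀ n, IsSymmetry a ε₁ ε₂ c (hierarchy a ε₁ ε₂ b c c₁ c₂ n) ∧
        hierarchy a ε₁ ε₂ b c c₁ c₂ n ∈ recDomain a ε₁ ε₂) ∧
      (∀ (q : ℕ) (γ : CartanCurve q a ε₁ ε₂) (n : ℕ),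
        γ.IsTangent (γ.along (hierarchy a ε₁ ε₂ b c c₁ c₂ n))) ∧
      (∀ m n, bracket a ε₁ ε₂ (hierarchy a ε₁ ε₂ b c c₁ c₂ m)
        (hierarchy a ε₁ ε₂ b c c₁ c₂ n) = 0) ∧
      (b ≠ 0 → LinearIndependent ℝ (hierarchy a ε₁ ε₂ b c c₁ c₂))) := by
  have ha' : a ≠ 0 := ha.ne'
  have h₁ : ε₁ * ε₁ = 1 := by rcases hε₁ with rfl | rfl <;> norm_num
  have h₂ : ε₂ * ε₂ = 1 := by rcases hε₂ with rfl | rfl <;> norm_num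
  refine ⟨fun V hV => ⟨hV.mem_recDomain ha' h₁ h₂ hc, hV.recOp ha' h₁ h₂ hc⟩,
    fun V hV U hU r s => ⟨recDomain_lin h₁ h₂ hV hU r s, recOp_lin h₁ h₂ hV hU r s⟩,
    fun V hV => ⟨bracket_V₁_mem_recDomain ha' h₁ h₂ hV, fun c₁ c₂ =>
      ⟨IsEvolution.recOp ha' h₁ c₁ c₂ hV, bracket_V₁_recOp ha' h₁ h₂ hV c₁ c₂⟩⟩,
    fun c₁ c₂ => ?_⟩
  have hS := isSymmetry_hierarchy (b := b) ha' h₁ h₂ hc c₁ c₂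
  exact ⟨fun n => ⟨hS n, (hS n).mem_recDomain ha' h₁ h₂ hc⟩,
    fun q γ n => γ.isTangent_along (hS n).1,
    fun m n => (hS m).bracket_eq_zero ha' h₁ h₂ hc (hS n),
    fun hb => linearIndependent_hierarchy ha' h₁ h₂ hb hc c₁ c₂⟩
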